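/- Let $k$ be a field with separable closure $k_s$ and $\mathcal G=\mathrm{Gal}(k_s/k)$. Let $A=\prod_{i=1}^r K_i$ and $B=\prod_{j=1}^s E_j$ be étale $k$-algebras with $\dim_k A=m$ and $\dim_k B=n$, where $K_i$ and $E_j$ are finite separable field extensions of $k$ with $[K_i:k]=m_i$ and $[E_j:k]=n_j$. For an étale $k$-algebra $C$, the norm one torus $T_C=R^{(1)}_{C/k}(\mathbb G_m)$ is the kernel of the norm $N_{C/k}:R_{C/k}(\mathbb G_m)\to\mathbb G_m$, i.e. the group scheme $R\mapsto\{x\in R\otimes_k C: N_{R\otimes_k C/R}(x)=1\}$. For algebraic $k$-tori $T_1,T_2$ with character lattices $\widehat T_i=\mathrm{Hom}(T_i\times_k k_s,\mathbb G_{m,k_s})$, the torus $T_1\otimes T_2$ is the algebraic $k$-torus with character lattice $\widehat T_1\otimes_{\mathbb Z}\widehat T_2$ (diagonal $\mathcal G$-action), i.e. $T_1\otimes T_2=\mathrm{Spec}\big(k_s[\widehat T_1\otimes_{\mathbb Z}\widehat T_2]^{\mathcal G}\big)$. An integral $k$-variety with function field $F$ is *stably $k$-rational* if $F(y_1,\dots,y_a)\cong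 k(z_1,\dots,z_b)$ over $k$ for some $a,b\ge 0$ and independent variables $y_i$, $z_j$; it is *retract $k$-rational* if $F$ is the quotient field of a $k$-subalgebra $R\subseteq F$ such that $\mathrm{id}_R$ factors, through $k$-algebra homomorphisms, as $R\to k[x_1,\dots,x_N][1/f]\to R$ for some $N\ge 0$ and some polynomial $f$. Suppose that $\gcd(m_i,n_j\mid 1\le i\le r,\ 1\le j\le s)=1$; this holds, for example, if $\gcd(m,n)=1$. If $T_A$ and $T_B$ are stably (resp. retract) $k$-rational, then both the torus $T_A\otimes T_B$ and the norm one torus $T_{A\otimes_k B}$ are stably (resp. retract) $k$-rational. In particular, if $A$ and $B$ are fields (so $r=s=1$ and $\gcd(m,n)=1$), then $A\otimes_k B$ is a finite separable field extension of $k$ of degree $mn$, the norm one torus $T_{A\otimes_k B}$ is an algebraic $k$-torus of dimension $mn-1$, and it is stably (resp. retract) $k$-rational whenever $T_A$ and $T_B$ are. -/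

import Mathlib

open scoped TensorProduct

noncomputable section

/-! ### Rationality of fields and of affine varieties over a field -/

/-- The field extension `F` of `k` is stably `k`-rational: `F(y₁, …, y_m) ≃ k(z₁, …, z_n)` over `k`
for some `m` and `n`. -/
def IsStablyRationalField (k F : Type*) [Field k] [Field F] [Algebra k F] : Prop :=
  ∃ m n : ℕ, Nonempty
    (FractionRing (MvPolynomial (Fin m) F) ≃ₐ[k] FractionRing (MvPolynomial (Fin n) k))

/-- The field extension `F` of `k` is retract `k`-rational: it is the quotient field of a
`k`-subalgebra `R` whose identity map factors, through homomorphisms of `k`-algebras, over a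
localized polynomial ring `k[x₁, …, x_n][1/f]`. -/
def IsRetractRationalField (k F : Type*) [Field k] [Field F] [Algebra k F] : Prop :=
  ∃ R : Subalgebra k F, IsFractionRing R F ∧
    ∃ (n : ℕ) (f : MvPolynomial (Fin n) k) (φ : R →ₐ[k] Localization.Away f)
      (ψ : Localization.Away f →ₐ[k] R), ψ.comp φ = AlgHom.id k R

/-- The affine `k`-variety `Spec H` is integral and its function field is stably `k`-rational. -/
def IsStablyRational (k H : Type*) [Field k] [CommRing H] [Algebra k H] : Prop :=
  ∃ _ : IsDomain H, IsStablyRationalField k (FractionRing H)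

/-- The affine `k`-variety `Spec H` is integral and its function field is retract `k`-rational. -/
def IsRetractRational (k H : Type*) [Field k] [CommRing H] [Algebra k H] : Prop :=
  ∃ _ : IsDomain H, IsRetractRationalField k (FractionRing H)

/-! ### The norm one torus of a finite algebra -/

namespace NormOneTorus

section BaseChange

variable {k : Type*} [Field k] {A : Type*} [CommRing A] [Algebra k A] [Module.Finite k A]
  {P R : Type*} [CommRing P] [Algebra k P] [CommRing R] [Algebra k R]

lemma repr_map (φ : P →ₐ[k] R) (x : P ⊗[k] A) (i : Fin (Module.finrank k A)) :
    (Algebra.TensorProduct.basis R (Module.finBasis k A)).repr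
        (Algebra.TensorProduct.map φ (AlgHom.id k A) x) i =
      φ ((Algebra.TensorProduct.basis P (Module.finBasis k A)).repr x i) := by
  induction x with
  | zero => simp
  | add x y hx hy => simp [hx, hy]
  | tmul p a => simp

/-- The norm of a finite algebra commutes with base change. -/
lemma norm_map (φ : P →ₐ[k] R) (x : P ⊗[k] A) :
    Algebra.norm R (Algebra.TensorProduct.map φ (AlgHom.id k A) x) = φ (Algebra.norm P x) := by
  rw [Algebra.norm_eq_matrix_det (Algebra.TensorProduct.basis R (Module.finBasis k A)),
    Algebra.norm_eq_matrix_det (Algebra.TensorProduct.basis P (Module.finBasis k A)),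
    AlgHom.map_det]
  congr 1
  ext i j
  rw [Algebra.leftMulMatrix_eq_repr_mul, AlgHom.mapMatrix_apply, Matrix.map_apply,
    Algebra.leftMulMatrix_eq_repr_mul, ← repr_map,
    map_mul (Algebra.TensorProduct.map φ (AlgHom.id k A))]
  simp

lemma exists_mul_eq_one (x : R ⊗[k] A) (hx : Algebra.norm R x = 1) :
    ∃ y : R ⊗[k] A, Algebra.norm R y = 1 ∧ x * y = 1 := by
  have hu : IsUnit (LinearMap.det (Algebra.lmul R (R ⊗[k] A) x)) := by
    rw [← Algebra.norm_apply, hx]; exact isUnit_one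
  have hb := (LinearMap.isUnit_iff_isUnit_det _).mpr hu
  obtain ⟨y, hy⟩ := ((Module.End.isUnit_iff _).mp hb).2 1
  have hxy : x * y = 1 := hy
  refine ⟨y, ?_, hxy⟩
  have := congrArg (Algebra.norm R) hxy
  rwa [map_mul, hx, one_mul, map_one] at this

end BaseChange

variable (k : Type*) [Field k] (A : Type*) [CommRing A] [Algebra k A] [Module.Finite k A]

/-- The generic element `x₁ w₁ + ⋯ + x_n w_n` of `A`, for a basis `w₁, …, w_n` of `A` over `k` and
independent variables `x₁, …, x_n`. -/
def genericElement : MvPolynomial (Fin (Module.finrank k A)) k ⊗[k] A :=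
  ∑ i, MvPolynomial.X i ⊗ₜ[k] Module.finBasis k A i

/-- The norm form `N_{A/k}(x₁ w₁ + ⋯ + x_n w_n)`. -/
def normForm : MvPolynomial (Fin (Module.finrank k A)) k :=
  Algebra.norm (MvPolynomial (Fin (Module.finrank k A)) k) (genericElement k A)

end NormOneTorus

/-- The coordinate ring `k[x₁, …, x_n] / (N_{A/k}(x₁ w₁ + ⋯ + x_n w_n) - 1)` of the norm one torus
of the finite `k`-algebra `A`; it represents the functor
`R ↦ Ker (N : (R ⊗ A)ˣ → Rˣ)` on commutative `k`-algebras (see `NormOneTorus.pointsEquiv`), and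
it carries the corresponding structure of a Hopf algebra. -/
def NormOneTorus (k : Type*) [Field k] (A : Type*) [CommRing A] [Algebra k A]
    [Module.Finite k A] : Type _ :=
  MvPolynomial (Fin (Module.finrank k A)) k ⧸ Ideal.span {NormOneTorus.normForm k A - 1}

namespace NormOneTorus

variable (k : Type*) [Field k] (A : Type*) [CommRing A] [Algebra k A] [Module.Finite k A]

instance : CommRing (NormOneTorus k A) :=
  inferInstanceAs (CommRing (_ ⧸ Ideal.span {normForm k A - 1}))

instance : Algebra k (NormOneTorus k A) :=
  inferInstanceAs (Algebra k (_ ⧸ Ideal.span {normForm k A - 1}))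

/-- The quotient map from the polynomial ring. -/
def mk : MvPolynomial (Fin (Module.finrank k A)) k →ₐ[k] NormOneTorus k A :=
  Ideal.Quotient.mkₐ k (Ideal.span {normForm k A - 1})

variable {k A}

lemma mk_surjective : Function.Surjective (mk k A) := Ideal.Quotient.mk_surjective

variable {R : Type*} [CommRing R] [Algebra k R]

/-- The element of norm one of `R ⊗ A` given by an `R`-valued point of the norm one torus. -/
def eval (φ : NormOneTorus k A →ₐ[k] R) : R ⊗[k] A :=
  Algebra.TensorProduct.map (φ.comp (mk k A)) (AlgHom.id k A) (genericElement k A)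

lemma eval_comp {S : Type*} [CommRing S] [Algebra k S] (f : R →ₐ[k] S)
    (φ : NormOneTorus k A →ₐ[k] R) :
    eval (f.comp φ) = Algebra.TensorProduct.map f (AlgHom.id k A) (eval φ) := by
  simp [eval, genericElement]

lemma norm_eval (φ : NormOneTorus k A →ₐ[k] R) : Algebra.norm R (eval φ) = 1 := by
  have h : mk k A (normForm k A) = 1 := by
    rw [← sub_eq_zero, ← map_one (mk k A), ← map_sub]
    exact Ideal.Quotient.eq_zero_iff_mem.mpr (Ideal.mem_span_singleton_self _)
  rw [eval, norm_map]
  change φ (mk k A (normForm k A)) = 1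
  rw [h, map_one]

lemma repr_eval (φ : NormOneTorus k A →ₐ[k] R) (i : Fin (Module.finrank k A)) :
    (Algebra.TensorProduct.basis R (Module.finBasis k A)).repr (eval φ) i =
      φ (mk k A (MvPolynomial.X i)) := by
  rw [eval, repr_map]
  simp [genericElement, Finsupp.single_apply]

lemma eval_injective {φ ψ : NormOneTorus k A →ₐ[k] R} (h : eval φ = eval ψ) : φ = ψ := by
  have h' : φ.comp (mk k A) = ψ.comp (mk k A) := by
    ext i
    simp [← repr_eval, h]
  ext x
  obtain ⟨p, rfl⟩ := mk_surjective x
  exact congrArg (fun f => f p) h'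

lemma map_aeval_genericElement (x : R ⊗[k] A) :
    Algebra.TensorProduct.map (MvPolynomial.aeval fun i =>
      (Algebra.TensorProduct.basis R (Module.finBasis k A)).repr x i) (AlgHom.id k A)
        (genericElement k A) = x := by
  conv_rhs => rw [← (Algebra.TensorProduct.basis R (Module.finBasis k A)).sum_repr x]
  simp [genericElement, TensorProduct.smul_tmul']

/-- The `R`-valued point of the norm one torus given by an element of norm one of `R ⊗ A`. -/
def point (x : R ⊗[k] A) (hx : Algebra.norm R x = 1) : NormOneTorus k A →ₐ[k] R :=
  Ideal.Quotient.liftₐ (Ideal.span {normForm k A - 1})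
    (MvPolynomial.aeval fun i =>
      (Algebra.TensorProduct.basis R (Module.finBasis k A)).repr x i) (by
    intro a ha
    obtain ⟨b, rfl⟩ := Ideal.mem_span_singleton'.mp ha
    rw [map_mul, map_sub, normForm, ← norm_map, map_aeval_genericElement, hx, map_one, sub_self,
      mul_zero])

lemma eval_point (x : R ⊗[k] A) (hx : Algebra.norm R x = 1) : eval (point x hx) = x := by
  have h : (point x hx).comp (mk k A) = MvPolynomial.aeval fun i =>
      (Algebra.TensorProduct.basis R (Module.finBasis k A)).repr x i :=
    Ideal.Quotient.liftₐ_comp _ _ _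
  rw [eval, h, map_aeval_genericElement]

variable (k A R) in
/-- The `R`-valued points of the norm one torus are the elements of norm one of `R ⊗ A`. -/
def pointsEquiv : (NormOneTorus k A →ₐ[k] R) ≃ {x : R ⊗[k] A // Algebra.norm R x = 1} where
  toFun φ := ⟨eval φ, norm_eval φ⟩
  invFun x := point x.1 x.2
  left_inv _ := eval_injective (eval_point _ _)
  right_inv _ := Subtype.ext (eval_point _ _)

variable (k A)

/-- The comultiplication: the product of the two universal points. -/
def comulHom : NormOneTorus k A →ₐ[k] NormOneTorus k A ⊗[k] NormOneTorus k A :=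
  point (eval Algebra.TensorProduct.includeLeft * eval Algebra.TensorProduct.includeRight)
    (by rw [map_mul, norm_eval, norm_eval, one_mul])

/-- The counit: the point `1 ∈ A`. -/
def counitHom : NormOneTorus k A →ₐ[k] k := point 1 (map_one _)

/-- The antipode: the inverse of the universal point. -/
def antipodeHom : NormOneTorus k A →ₐ[k] NormOneTorus k A :=
  point _ (exists_mul_eq_one _ (norm_eval (AlgHom.id k (NormOneTorus k A)))).choose_spec.1

lemma eval_comp_comulHom (f : NormOneTorus k A ⊗[k] NormOneTorus k A →ₐ[k] R) :
    eval (f.comp (comulHom k A)) = eval (f.comp Algebra.TensorProduct.includeLeft) *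
      eval (f.comp Algebra.TensorProduct.includeRight) := by
  simp only [eval_comp, ← map_mul, comulHom, eval_point]

lemma eval_comp_counitHom (f : k →ₐ[k] R) : eval (f.comp (counitHom k A)) = 1 := by
  rw [eval_comp, counitHom, eval_point, map_one]

lemma eval_mul_eval_antipodeHom :
    eval (AlgHom.id k (NormOneTorus k A)) * eval (antipodeHom k A) = 1 := by
  rw [antipodeHom, eval_point]
  exact (exists_mul_eq_one _ (norm_eval (AlgHom.id k (NormOneTorus k A)))).choose_spec.2

instance : Bialgebra k (NormOneTorus k A) :=
  Bialgebra.ofAlgHom (comulHom k A) (counitHom k A)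
    (by
      apply eval_injective
      rw [← AlgHom.comp_assoc, eval_comp_comulHom, eval_comp_comulHom]
      have h1 : ((Algebra.TensorProduct.assoc k k k (NormOneTorus k A) (NormOneTorus k A)
          (NormOneTorus k A)).toAlgHom.comp (Algebra.TensorProduct.map (comulHom k A)
          (AlgHom.id k _))).comp Algebra.TensorProduct.includeLeft =
          ((Algebra.TensorProduct.assoc k k k (NormOneTorus k A) (NormOneTorus k A)
          (NormOneTorus k A)).toAlgHom.comp Algebra.TensorProduct.includeLeft).comp
          (comulHom k A) := by
        ext x; simp
      have h2 : (Algebra.TensorProduct.map (AlgHom.id k _) (comulHom k A)).comp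
          Algebra.TensorProduct.includeRight =
          (Algebra.TensorProduct.includeRight (R := k) (A := NormOneTorus k A)
            (B := NormOneTorus k A ⊗[k] NormOneTorus k A)).comp (comulHom k A) := by
        ext x; simp
      rw [h1, h2, eval_comp_comulHom, eval_comp_comulHom, mul_assoc]
      congr 1
      · congr 1; ext x; simp; rfl
      · congr 2; ext x; simp; rfl)
    (by
      apply eval_injective
      rw [eval_comp_comulHom]
      have h1 : (Algebra.TensorProduct.map (counitHom k A) (AlgHom.id k _)).comp
          Algebra.TensorProduct.includeLeft =
          (Algebra.TensorProduct.includeLeft (R := k) (S := k) (A := k)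
            (B := NormOneTorus k A)).comp (counitHom k A) := by
        ext x; simp
      rw [h1, eval_comp_counitHom, one_mul]
      congr 1; ext x; simp)
    (by
      apply eval_injective
      rw [eval_comp_comulHom]
      have h1 : (Algebra.TensorProduct.map (AlgHom.id k _) (counitHom k A)).comp
          Algebra.TensorProduct.includeRight =
          (Algebra.TensorProduct.includeRight (R := k) (A := NormOneTorus k A)
            (B := k)).comp (counitHom k A) := by
        ext x; simp
      rw [h1, eval_comp_counitHom, mul_one]
      congr 1; ext x; simp)

instance : HopfAlgebra k (NormOneTorus k A) :=
  HopfAlgebra.ofAlgHom (antipodeHom k A)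
    (by
      apply eval_injective
      refine (eval_comp_comulHom k A _).trans ?_
      refine Eq.trans ?_ (eval_comp_counitHom k A _).symm
      refine Eq.trans ?_ ((mul_comm _ _).trans (eval_mul_eval_antipodeHom k A))
      congr 2
      · ext x
        exact (Algebra.TensorProduct.lift_tmul _ _ (fun _ _ => Commute.all _ _) _ _).trans (by simp)
      · ext x
        exact (Algebra.TensorProduct.lift_tmul _ _ (fun _ _ => Commute.all _ _) _ _).trans (by simp))
    (by
      apply eval_injective
      refine (eval_comp_comulHom k A _).trans ?_
      refine Eq.trans ?_ (eval_comp_counitHom k A _).symm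
      refine Eq.trans ?_ (eval_mul_eval_antipodeHom k A)
      congr 2
      · ext x
        exact (Algebra.TensorProduct.lift_tmul _ _ (fun _ _ => Commute.all _ _) _ _).trans (by simp)
      · ext x
        exact (Algebra.TensorProduct.lift_tmul (AlgHom.id k (NormOneTorus k A)) (antipodeHom k A)
          (fun _ _ => Commute.all _ _) 1 x).trans (by simp))

end NormOneTorus

/-! ### Algebraic tori and their character lattices

An affine `k`-group scheme is given by its coordinate ring, a commutative Hopf algebra over `k`. -/

/-- `Spec H` is an algebraic `k`-torus of dimension `d`: over the separable closure it becomes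
isomorphic, as a group scheme, to the split torus of dimension `d`, whose coordinate ring is the
group algebra of `ℤ ^ d`. -/
def IsAlgebraicTorus (k H : Type*) [Field k] [CommRing H] [HopfAlgebra k H] (d : ℕ) : Prop :=
  Nonempty ((SeparableClosure k ⊗[k] H) ≃ₐc[SeparableClosure k]
    AddMonoidAlgebra (SeparableClosure k) (Fin d → ℤ))

section GaloisAction

variable {k : Type*} [Field k] {L : Type*} [Field L] [Algebra k L]
  {H : Type*} [CommRing H] [HopfAlgebra k H]

/-- The action `σ ⊗ id` of an automorphism `σ` of `L` over `k` on `L ⊗ H`. -/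
def galoisAct (σ : L ≃ₐ[k] L) : L ⊗[k] H →ₐ[k] L ⊗[k] H :=
  Algebra.TensorProduct.map σ.toAlgHom (AlgHom.id k H)

/-- `galoisAct` as a semilinear map. -/
def galoisActSemilinear (σ : L ≃ₐ[k] L) : L ⊗[k] H →ₛₗ[(σ : L →+* L)] L ⊗[k] H where
  toFun := galoisAct σ
  map_add' := map_add _
  map_smul' a x := by
    induction x with
    | zero => simp
    | add x y hx hy => rw [smul_add, map_add, hx, hy, map_add, smul_add]
    | tmul b h => simp [galoisAct, TensorProduct.smul_tmul']

open Coalgebra in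
lemma counit_galoisAct (σ : L ≃ₐ[k] L) (x : L ⊗[k] H) :
    counit (R := L) (galoisAct σ x) = σ (counit (R := L) x) := by
  induction x with
  | zero => simp
  | add x y hx hy => simp [hx, hy]
  | tmul a h => simp [galoisAct]

open Coalgebra in
lemma comul_galoisAct (σ : L ≃ₐ[k] L) (x : L ⊗[k] H) :
    comul (R := L) (galoisAct σ x) =
      TensorProduct.map (galoisActSemilinear σ) (galoisActSemilinear σ) (comul (R := L) x) := by
  induction x with
  | zero => simp
  | add x y hx hy => simp [hx, hy]
  | tmul a h =>
    simp only [galoisAct, Algebra.TensorProduct.map_tmul, TensorProduct.comul_tmul, AlgHom.id_apply]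
    induction comul (R := k) h with
    | zero => simp
    | add x y hx hy => simp only [TensorProduct.tmul_add, map_add, hx, hy]
    | tmul x y => simp [galoisActSemilinear, galoisAct]

lemma isGroupLikeElem_galoisAct (σ : L ≃ₐ[k] L) {x : L ⊗[k] H} (hx : IsGroupLikeElem L x) :
    IsGroupLikeElem L (galoisAct σ x) where
  counit_eq_one := by rw [counit_galoisAct, hx.counit_eq_one, map_one]
  comul_eq_tmul_self := by
    rw [comul_galoisAct, hx.comul_eq_tmul_self, TensorProduct.map_tmul]; rfl

/-- The action of an automorphism of `L` over `k` on the group-like elements of `L ⊗ H`. -/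
def galoisActGroupLike (σ : L ≃ₐ[k] L) :
    GroupLike L (L ⊗[k] H) →* GroupLike L (L ⊗[k] H) where
  toFun g := ⟨galoisAct σ g.val, isGroupLikeElem_galoisAct σ g.isGroupLikeElem_val⟩
  map_one' := GroupLike.ext (map_one (galoisAct σ))
  map_mul' g h := GroupLike.ext (map_mul (galoisAct σ) g.val h.val)

lemma galoisActGroupLike_one (g : GroupLike L (L ⊗[k] H)) :
    galoisActGroupLike (1 : L ≃ₐ[k] L) g = g := by
  refine GroupLike.ext ?_
  change Algebra.TensorProduct.map (AlgHom.id k L) (AlgHom.id k H) _ = _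
  rw [Algebra.TensorProduct.map_id]; rfl

lemma galoisActGroupLike_mul (σ τ : L ≃ₐ[k] L) (g : GroupLike L (L ⊗[k] H)) :
    galoisActGroupLike (σ * τ) g = galoisActGroupLike σ (galoisActGroupLike τ g) := by
  refine GroupLike.ext ?_
  change galoisAct (σ * τ) _ = ((galoisAct σ).comp (galoisAct τ)) _
  congr 1
  ext x <;> simp [galoisAct]

end GaloisAction

section Characters

variable (k : Type*) [Field k] (L : Type*) [Field L] [Algebra k L]
  (H : Type*) [CommRing H] [HopfAlgebra k H]

/-- The characters of `Spec H` over the extension `L` of `k`, i.e. the homomorphisms from its base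
change to `L` to the multiplicative group over `L`, written additively. A character is the same
thing as a group-like element of the Hopf algebra `L ⊗ H`. For a torus, and for `L` the separable
closure of `k`, this is the character lattice. -/
def Characters : Type _ := Additive (GroupLike L (L ⊗[k] H))

instance : AddCommGroup (Characters k L H) :=
  inferInstanceAs (AddCommGroup (Additive (GroupLike L (L ⊗[k] H))))

/-- The action of the automorphisms of `L` over `k` on the characters over `L`. -/
def characterRep : Representation ℤ (L ≃ₐ[k] L) (Characters k L H) where
  toFun σ := AddMonoidHom.toIntLinearMap
    (MonoidHom.toAdditive (galoisActGroupLike (k := k) (H := H) σ))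
  map_one' := LinearMap.ext fun g =>
    congrArg Additive.ofMul (galoisActGroupLike_one (k := k) (H := H) (Additive.toMul g))
  map_mul' σ τ := LinearMap.ext fun g =>
    congrArg Additive.ofMul (galoisActGroupLike_mul (k := k) (H := H) σ τ (Additive.toMul g))

end Characters

/-- The ring `L[M]^G`, for a group `G = Aut(L/k)` acting on a lattice `M`: here `G` acts on the
group algebra `L[M]` both through the coefficients and through `M`. When `L` is the separable
closure of `k` and the action on `M` is continuous, this is the coordinate ring of the algebraic
`k`-torus with character lattice `M`. -/
def torusOfLattice (k L : Type*) [Field k] [Field L] [Algebra k L] {M : Type*} [AddCommGroup M]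
    (ρ : Representation ℤ (L ≃ₐ[k] L) M) : Subalgebra k (AddMonoidAlgebra L M) where
  carrier := {f | ∀ σ : L ≃ₐ[k] L,
    AddMonoidAlgebra.mapDomainAlgHom k L (ρ σ).toAddMonoidHom
      (AddMonoidAlgebra.mapAlgHom M σ.toAlgHom f) = f}
  mul_mem' hf hg σ := by rw [map_mul, map_mul, hf σ, hg σ]
  add_mem' hf hg σ := by rw [map_add, map_add, hf σ, hg σ]
  algebraMap_mem' r σ := by rw [AlgHom.commutes, AlgHom.commutes]

/-- The coordinate ring of the tensor product `T₁ ⊗ T₂` of the algebraic `k`-tori `T₁ = Spec H₁` and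
`T₂ = Spec H₂`: the torus whose character lattice is the tensor product over `ℤ` of the character
lattices of `T₁` and `T₂`, with the diagonal action of the absolute Galois group. -/
abbrev TensorTorus (k : Type*) [Field k] (H₁ H₂ : Type*) [CommRing H₁] [HopfAlgebra k H₁]
    [CommRing H₂] [HopfAlgebra k H₂] : Type _ :=
  torusOfLattice k (SeparableClosure k)
    ((characterRep k (SeparableClosure k) H₁).tprod (characterRep k (SeparableClosure k) H₂))

end

/-! Let `L` be a finite Galois extension of `k` splitting both algebras, and let `X` and `Y` be the
Galois sets of homomorphisms from `A` and from `B` to `L`. The character lattice of `T_A` is `J_X =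
ℤ[X]/ℤ`, and rationality can be read off from the lattice: a torus split by `L` is stably (resp.
retract) rational exactly when its character lattice `M` sits in an exact sequence `0 → M → P → F →
0` with `P` and `F` stably permutation (resp. invertible). This is `HasResolution`, and
`IsLatticeClass` collects what the two classes of lattices have in common, so that the lattice
argument is made once for both.

From rationality to a resolution: if `Spec H` is stably rational, a polynomial ring `H[y]` and a
polynomial ring `k[z]` have a common localization `S`. After base change to `L` both are factorial.
The units of `L ⊗ k[z]` are constant, so `(L ⊗ S)ˣ/Lˣ` is the permutation lattice on the primes
inverted in passing from `k[z]` to `S`. The units of `L ⊗ H[y]` modulo constants form `M`, so the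
quotient of the same group by `M` is again a permutation lattice. In the retract case `(L ⊗ S)ˣ/Lˣ`
is only a direct summand of a permutation lattice. See `exists_unitsDivisor` and
`HasResolution.of_units`.

The lattice step: the gcd condition provides invariant integral weights on `X` and `Y` with totals
`d` and `d'` such that `d + d' = 1`. A weight of total `d` gives a section of `ℤ[X] → J_X` up to the
factor `d`. Maps into invertible lattices extend along sequences with invertible cokernel
(`IsShortExact.exists_extend`), so a surjection `M₂ → M₃` lifts to resolutions and its mapping cone
resolves the kernel, provided that the identity of `M₃` factors through `M₂` up to maps that factor
through an invertible lattice (`IsShortExact.exists_cone`). This applies to `P ⊗ J_Y → F ⊗ J_Y`,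
with kernel `J_X ⊗ J_Y`, because `1 = d + d'` splits the identity in the required way. It then
applies to the sequence from `J_{X × Y}` to `J_X ⊗ ℤ[Y] ⊕ ℤ[X] ⊗ J_Y` to `J_X ⊗ J_Y`, which splits
for the same reason.

From a resolution to rationality: in the stable case `P` and `F` may be taken to be permutation
lattices. A form of Hilbert 90 (`exists_twist`) makes the product of the torus with an affine space
birational to the torus with lattice `P`, which is open in an affine space. In the retract case `F`
may be taken permutation and `P` invertible. Specializing the extra coordinates to `1` makes the
given torus a rational retract of the torus of `P`, itself a retract of a quasi-trivial torus.

When `A` and `B` are fields, coprime degrees make their images in the separable closure linearly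
disjoint, so `A ⊗ B` is a separable field extension. -/

noncomputable section

/-! ### Permutation lattices and resolutions by them -/

namespace Representation

section PermRep

variable (G : Type*) [Group G]

/-- The permutation lattice of functions on a `G`-set with integral values. -/
def permRep (S : Type*) [MulAction G S] : Representation ℤ G (S → ℤ) where
  toFun g :=
    { toFun := fun f s => f (g⁻¹ • s)
      map_add' := fun _ _ => rfl
      map_smul' := fun _ _ => rfl }
  map_one' := by ext; simp
  map_mul' g h := by ext; simp [mul_smul]

variable {G}

@[simp]
lemma permRep_apply {S : Type*} [MulAction G S] (g : G) (f : S → ℤ) (s : S) :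
    permRep G S g f s = f (g⁻¹ • s) := rfl

lemma permRep_single {S : Type*} [MulAction G S] [DecidableEq S] (g : G) (s : S) (c : ℤ) :
    permRep G S g (Pi.single s c) = Pi.single (g • s) c := by
  ext t
  simp only [permRep_apply, Pi.single_apply, inv_smul_eq_iff]

end PermRep

variable {G : Type*} [Group G]
variable {V : Type*} [AddCommGroup V] {W : Type*} [AddCommGroup W]
variable {ρ : Representation ℤ G V} {σ : Representation ℤ G W}

/-- A homomorphism of representations given by an equivariant additive map. -/
def IntertwiningMap.ofAddHom (f : V →+ W) (hf : ∀ g v, f (ρ g v) = σ g (f v)) :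
    IntertwiningMap ρ σ :=
  ⟨f.toIntLinearMap, fun g => LinearMap.ext fun v => hf g v⟩

@[simp]
lemma IntertwiningMap.ofAddHom_apply (f : V →+ W) (hf : ∀ g v, f (ρ g v) = σ g (f v)) (v : V) :
    IntertwiningMap.ofAddHom (ρ := ρ) (σ := σ) f hf v = f v := rfl

/-- An isomorphism of representations given by an equivariant bijection. -/
def IntertwiningMap.toEquiv (f : IntertwiningMap ρ σ) (hf : Function.Bijective f) :
    ρ.Equiv σ :=
  Equiv.mk (LinearEquiv.ofBijective f.toLinearMap hf)
    fun g => LinearMap.ext fun v => IntertwiningMap.isIntertwining _ _ f g v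

/-- The homomorphism from a permutation lattice determined by an equivariant map on the basis. -/
def permLift {S : Type*} [Finite S] [MulAction G S] (v : S → V)
    (hv : ∀ (g : G) s, v (g • s) = ρ g (v s)) : IntertwiningMap (permRep G S) ρ :=
  have := Fintype.ofFinite S
  IntertwiningMap.ofAddHom
    { toFun := fun f => ∑ s, f s • v s
      map_zero' := by simp
      map_add' := fun f f' => by simp [add_smul, Finset.sum_add_distrib] }
    (fun g f => by
      simp only [AddMonoidHom.coe_mk, ZeroHom.coe_mk, map_sum, map_zsmul, permRep_apply]
      rw [← _root_.Equiv.sum_comp (MulAction.toPerm g)]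
      simp [hv])

lemma permLift_apply {S : Type*} [Fintype S] [MulAction G S] (v : S → V)
    (hv : ∀ (g : G) s, v (g • s) = ρ g (v s)) (f : S → ℤ) :
    permLift v hv f = ∑ s, f s • v s := by
  simp only [permLift, IntertwiningMap.ofAddHom_apply, AddMonoidHom.coe_mk, ZeroHom.coe_mk]
  congr!

/-- `0 → ρ → μ → ν → 0` is exact. -/
structure IsShortExact {M P F : Type*} [AddCommGroup M] [AddCommGroup P] [AddCommGroup F]
    {ρ : Representation ℤ G M} {μ : Representation ℤ G P} {ν : Representation ℤ G F}
    (i : IntertwiningMap ρ μ) (q : IntertwiningMap μ ν) : Prop where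
  injective : Function.Injective i
  surjective : Function.Surjective q
  apply_eq_zero_iff : ∀ x, q x = 0 ↔ ∃ m, i m = x

lemma IsShortExact.apply_apply {M P F : Type*} [AddCommGroup M] [AddCommGroup P] [AddCommGroup F]
    {ρ : Representation ℤ G M} {μ : Representation ℤ G P} {ν : Representation ℤ G F}
    {i : IntertwiningMap ρ μ} {q : IntertwiningMap μ ν} (h : IsShortExact i q) (m : M) :
    q (i m) = 0 := (h.apply_eq_zero_iff _).2 ⟨m, rfl⟩

/-- A homomorphism which vanishes on the kernel of a surjection factors through it. -/
lemma IntertwiningMap.exists_factor {P F U : Type*} [AddCommGroup P] [AddCommGroup F]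
    [AddCommGroup U] {μ : Representation ℤ G P} {ν : Representation ℤ G F}
    {τ : Representation ℤ G U} (q : IntertwiningMap μ ν) (hq : Function.Surjective q)
    (f : IntertwiningMap μ τ) (hf : ∀ x, q x = 0 → f x = 0) :
    ∃ f' : IntertwiningMap ν τ, ∀ x, f' (q x) = f x := by
  choose s hs using hq
  have key : ∀ x y, q x = q y → f x = f y := fun x y h => by
    rw [← sub_eq_zero, ← map_sub]
    exact hf _ (by rw [map_sub, h, sub_self])
  refine ⟨IntertwiningMap.ofAddHom
    { toFun := fun y => f (s y)
      map_zero' := hf _ (hs 0)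
      map_add' := fun y z => by
        rw [← map_add]
        exact key _ _ (by rw [map_add, hs, hs, hs]) } ?_, ?_⟩
  · intro g y
    change f (s (ν g y)) = τ g (f (s y))
    rw [← f.isIntertwining]
    exact key _ _ (by rw [q.isIntertwining, hs, hs])
  · intro x
    exact key _ _ (hs _)

/-- The lattice is a direct summand of a permutation lattice. -/
def IsInvertible (ρ : Representation ℤ G V) : Prop :=
  ∃ (S : Type) (_ : Finite S) (_ : MulAction G S) (i : IntertwiningMap ρ (permRep G S))
    (r : IntertwiningMap (permRep G S) ρ), ∀ v, r (i v) = v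

/-- The lattice becomes a permutation lattice after adding a permutation lattice. -/
def IsStablyPerm (ρ : Representation ℤ G V) : Prop :=
  ∃ (S : Type) (_ : Finite S) (_ : MulAction G S) (T : Type) (_ : Finite T) (_ : MulAction G T),
    Nonempty ((ρ.prod (permRep G S)).Equiv (permRep G T))

section Extension

variable {M P F : Type*} [AddCommGroup M] [AddCommGroup P] [AddCommGroup F]
    {ρ : Representation ℤ G M} {μ : Representation ℤ G P} {ν : Representation ℤ G F}
    {i : IntertwiningMap ρ μ} {q : IntertwiningMap μ ν}

/-- A direct summand of `ℤ^S` is projective as an abelian group, so lifting the basis vectors is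
enough. The section need not be equivariant. -/
lemma IsInvertible.exists_linear_section (hν : IsInvertible ν)
    (hq : Function.Surjective q) : ∃ s : F →ₗ[ℤ] P, ∀ x, q (s x) = x := by
  obtain ⟨S, _, _, j, r, hr⟩ := hν
  classical
  have := Fintype.ofFinite S
  choose p hp using fun t : S => hq (r (Pi.single t 1))
  let s0 : (S → ℤ) →ₗ[ℤ] P := (Pi.basisFun ℤ S).constr ℤ p
  have h0 : ∀ f, q (s0 f) = r f := by
    intro f
    have : q.toLinearMap.comp s0 = r.toLinearMap := by
      refine (Pi.basisFun ℤ S).ext fun t => ?_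
      rw [LinearMap.comp_apply, Module.Basis.constr_basis]
      simpa using hp t
    exact LinearMap.congr_fun this f
  exact ⟨s0.comp j.toLinearMap, fun x => (h0 _).trans (hr x)⟩

variable [Finite G]

/-- Equivariant maps into a permutation lattice extend along an exact sequence with invertible
cokernel. -/
lemma IsShortExact.exists_extend_perm (h : IsShortExact i q) (hν : IsInvertible ν) {T : Type*}
    [Finite T] [MulAction G T] (f : IntertwiningMap ρ (permRep G T)) :
    ∃ f' : IntertwiningMap μ (permRep G T), ∀ m, f' (i m) = f m := by
  classical
  have := Fintype.ofFinite G
  obtain ⟨s, hs⟩ := hν.exists_linear_section h.surjective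
  obtain ⟨S, _, _, j, r, hr⟩ := hν
  have := Fintype.ofFinite S
  -- a linear extension
  obtain ⟨f0, hf0⟩ : ∃ f0 : P →ₗ[ℤ] (T → ℤ), ∀ m, f0 (i m) = f m := by
    have hex : ∀ x, ∃ m, i m = x - s (q x) := fun x =>
      (h.apply_eq_zero_iff _).1 (by rw [map_sub, hs, sub_self])
    choose c hc using hex
    have hadd : ∀ x y, c (x + y) = c x + c y := fun x y => h.injective (by
      rw [hc, map_add i, hc, hc, map_add, map_add]; abel)
    let cl : P →+ M := AddMonoidHom.mk' c hadd
    refine ⟨f.toLinearMap.comp cl.toIntLinearMap, fun m => ?_⟩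
    change f (c (i m)) = f m
    congr 1
    exact h.injective (by rw [hc, h.apply_apply, map_zero, sub_zero])
  -- its average
  let n : ℤ := Fintype.card G
  have hn : n ≠ 0 := by simp [n]
  let f1 : IntertwiningMap μ (permRep G T) := IntertwiningMap.ofAddHom
    { toFun := fun x => ∑ g : G, permRep G T g (f0 (μ g⁻¹ x))
      map_zero' := by simp
      map_add' := fun x y => by simp [Finset.sum_add_distrib] }
    (fun g x => by
      simp only [AddMonoidHom.coe_mk, ZeroHom.coe_mk, map_sum]
      rw [← _root_.Equiv.sum_comp (_root_.Equiv.mulLeft g)]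
      refine Finset.sum_congr rfl fun a _ => ?_
      simp only [_root_.Equiv.coe_mulLeft, mul_inv_rev, map_mul, Module.End.mul_apply]
      congr 3
      rw [← Module.End.mul_apply (μ g⁻¹), ← map_mul, inv_mul_cancel, map_one]; rfl)
  have hf1 : ∀ m, f1 (i m) = n • f m := by
    intro m
    change ∑ g : G, permRep G T g (f0 (μ g⁻¹ (i m))) = _
    have : ∀ g : G, permRep G T g (f0 (μ g⁻¹ (i m))) = f m := by
      intro g
      rw [← i.isIntertwining, hf0, f.isIntertwining, ← Module.End.mul_apply, ← map_mul,
        mul_inv_cancel, map_one]; rfl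
    simp [this, n]
  -- On the image of `i` the averaged map equals `n • f`, so modulo `n` it depends only on the class
  -- in the cokernel.
  have hmod : ∀ x y, q x = q y → ∀ t, f1 x t % n = f1 y t % n := by
    intro x y hxy t
    obtain ⟨m, hm⟩ := (h.apply_eq_zero_iff (x - y)).1 (by rw [map_sub, hxy, sub_self])
    have : f1 x = f1 y + n • f m := by rw [← hf1, hm, map_sub]; abel
    rw [this]
    simp
  choose p hp using fun t : S => h.surjective (r (Pi.single t 1))
  -- The map modulo `n` is lifted to integers on the basis by taking residues in `[0, n)`. The group
  -- only permutes coordinates, so this choice of residues is equivariant; that is why the target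
  -- must be a permutation lattice.
  let ψ : IntertwiningMap (permRep G S) (permRep G T) :=
    permLift (fun a t => f1 (p a) t % n) (fun g a => by
      ext t
      rw [permRep_apply]
      rw [hmod (p (g • a)) (μ g (p a)), f1.isIntertwining]
      · rfl
      · rw [hp, q.isIntertwining, hp, ← r.isIntertwining, permRep_single])
  have hψ : ∀ (a : S → ℤ) (x : P), q x = r a → ∀ t, n ∣ f1 x t - ψ a t := by
    intro a x hx t
    let y : P := ∑ b, a b • p b
    have hy : q y = r a := by
      simp only [y, map_sum, map_zsmul, hp]
      simp only [← map_zsmul, ← map_sum]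
      congr 1
      ext t
      simp [Finset.sum_apply, Pi.single_apply]
    have h1 : f1 y t - ψ a t = ∑ b, a b * (f1 (p b) t - f1 (p b) t % n) := by
      simp [y, ψ, permLift_apply, mul_sub, Finset.sum_apply]
    have h2 : n ∣ f1 y t - ψ a t := by
      rw [h1]
      exact Finset.dvd_sum fun b _ => Dvd.dvd.mul_left (Int.dvd_self_sub_emod) _
    have h3 : n ∣ f1 x t - f1 y t := Int.ModEq.dvd (hmod y x (hy.trans hx.symm) t)
    have := dvd_add h3 h2
    rwa [sub_add_sub_cancel] at this
  have hdvd : ∀ x t, n ∣ (f1 x - ψ (j (q x))) t := fun x t => hψ _ _ (hr _).symm t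
  -- Subtracting the lift makes all values divisible by `n` and changes nothing on the image of `i`,
  -- where the value is `n • f`. Division by `n` then gives the extension.
  let f2 : IntertwiningMap μ (permRep G T) := f1 - (ψ.comp j).comp q
  have hf2 : ∀ x t, f2 x t = n * (f2 x t / n) := fun x t => (Int.mul_ediv_cancel' (hdvd x t)).symm
  refine ⟨IntertwiningMap.ofAddHom
    { toFun := fun x t => f2 x t / n
      map_zero' := by ext; simp
      map_add' := fun x y => by
        ext t
        rw [map_add]
        exact Int.add_ediv_of_dvd_left (hdvd x t) } ?_, ?_⟩
  · intro g x
    ext t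
    change f2 (μ g x) t / n = f2 x (g⁻¹ • t) / n
    rw [f2.isIntertwining]; rfl
  · intro m
    ext t
    change f2 (i m) t / n = f m t
    have : f2 (i m) = n • f m := by
      change f1 (i m) - ψ (j (q (i m))) = _
      rw [h.apply_apply, map_zero, map_zero, sub_zero, hf1]
    rw [this]
    simp [hn]

end Extension

end Representation

/-! ### Sums and tensor products of lattices; invertible and stably permutation lattices. -/

namespace Representation

variable {G : Type*} [Group G]
variable {V : Type*} [AddCommGroup V] {W : Type*} [AddCommGroup W]
  {V' : Type*} [AddCommGroup V'] {W' : Type*} [AddCommGroup W']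
variable {ρ : Representation ℤ G V} {σ : Representation ℤ G W}
  {ρ' : Representation ℤ G V'} {σ' : Representation ℤ G W'}

section Equivalences

/-- The product of two isomorphisms of representations. -/
def Equiv.prodCongr (e : ρ.Equiv ρ') (f : σ.Equiv σ') : (ρ.prod σ).Equiv (ρ'.prod σ') :=
  Equiv.mk (e.toLinearEquiv.prodCongr f.toLinearEquiv) fun g => LinearMap.ext fun v =>
    Prod.ext (IntertwiningMap.isIntertwining _ _ e.toIntertwiningMap g v.1)
      (IntertwiningMap.isIntertwining _ _ f.toIntertwiningMap g v.2)

variable (ρ σ ρ' σ')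

/-- Commutativity of the product of representations. -/
def Equiv.prodComm : (ρ.prod σ).Equiv (σ.prod ρ) :=
  Equiv.mk (LinearEquiv.prodComm ℤ V W) fun _ => rfl

/-- Associativity of the product of representations. -/
def Equiv.prodAssoc : ((ρ.prod σ).prod ρ').Equiv (ρ.prod (σ.prod ρ')) :=
  Equiv.mk (LinearEquiv.prodAssoc ℤ V W V') fun _ => rfl

/-- Interchange of the middle factors in a product of four representations. -/
def Equiv.prodProdProdComm : ((ρ.prod σ).prod (ρ'.prod σ')).Equiv ((ρ.prod ρ').prod (σ.prod σ')) :=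
  Equiv.mk (LinearEquiv.prodProdProdComm ℤ V W V' W') fun _ => rfl

variable {ρ σ ρ' σ'}

variable (ρ σ ρ') in
/-- The tensor product of two representations over the integers. -/
def tprodInt : Representation ℤ G (V ⊗[ℤ] W) := ρ.tprod σ

/-- The tensor product of two homomorphisms of representations over the integers. -/
def IntertwiningMap.tensorInt (f : IntertwiningMap ρ ρ') (f' : IntertwiningMap σ σ') :
    IntertwiningMap (ρ.tprodInt σ) (ρ'.tprodInt σ') :=
  IntertwiningMap.ofAddHom
    (TensorProduct.map f.toLinearMap f'.toLinearMap).toAddMonoidHom (fun g v => by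
      induction v using TensorProduct.induction_on with
      | zero => simp
      | add x y hx hy => simp only [map_add, hx, hy]
      | tmul x y =>
        change f (ρ g x) ⊗ₜ f' (σ g y) = ρ' g (f x) ⊗ₜ σ' g (f' y)
        rw [IntertwiningMap.isIntertwining, IntertwiningMap.isIntertwining])

@[simp]
lemma IntertwiningMap.tensorInt_tmul (f : IntertwiningMap ρ ρ') (f' : IntertwiningMap σ σ')
    (x : V) (y : W) : f.tensorInt f' (x ⊗ₜ y) = f x ⊗ₜ f' y := rfl

lemma IntertwiningMap.tensorInt_comp {V'' W'' : Type*} [AddCommGroup V''] [AddCommGroup W'']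
    {ρ'' : Representation ℤ G V''} {σ'' : Representation ℤ G W''}
    (f : IntertwiningMap ρ ρ') (f' : IntertwiningMap σ σ')
    (h : IntertwiningMap ρ' ρ'') (h' : IntertwiningMap σ' σ'') (v : V ⊗[ℤ] W) :
    h.tensorInt h' (f.tensorInt f' v) = (h.comp f).tensorInt (h'.comp f') v := by
  induction v using TensorProduct.induction_on with
  | zero => simp
  | add x y hx hy => simp only [map_add, hx, hy]
  | tmul x y => rfl

/-- The tensor product of two isomorphisms of representations. -/
def Equiv.tprodCongr (e : ρ.Equiv ρ') (f : σ.Equiv σ') :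
    (ρ.tprodInt σ).Equiv (ρ'.tprodInt σ') :=
  (e.toIntertwiningMap.tensorInt f.toIntertwiningMap).toEquiv
    (TensorProduct.congr e.toLinearEquiv f.toLinearEquiv).bijective

variable (ρ σ ρ')

/-- The tensor product distributes over products of representations. -/
def Equiv.prodTprod : ((ρ.prod σ).tprodInt ρ').Equiv ((ρ.tprodInt ρ').prod (σ.tprodInt ρ')) :=
  (IntertwiningMap.prod ((IntertwiningMap.fst ℤ ρ σ).tensorInt (.id ρ'))
    ((IntertwiningMap.snd ℤ ρ σ).tensorInt (.id ρ'))).toEquiv (by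
      convert (TensorProduct.prodLeft ℤ ℤ V W V').bijective using 1
      ext v
      · induction v using TensorProduct.induction_on with
        | zero => simp
        | add x y hx hy => simp only [map_add, Prod.fst_add, hx, hy]
        | tmul x y => rfl
      · induction v using TensorProduct.induction_on with
        | zero => simp
        | add x y hx hy => simp only [map_add, Prod.snd_add, hx, hy]
        | tmul x y => rfl)

/-- The tensor product distributes over products of representations. -/
def Equiv.tprodProd : (ρ'.tprodInt (ρ.prod σ)).Equiv ((ρ'.tprodInt ρ).prod (ρ'.tprodInt σ)) :=
  (IntertwiningMap.prod ((IntertwiningMap.id ρ').tensorInt (.fst ℤ ρ σ))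
    ((IntertwiningMap.id ρ').tensorInt (.snd ℤ ρ σ))).toEquiv (by
      convert (TensorProduct.prodRight ℤ ℤ V' V W).bijective using 1
      ext v
      · induction v using TensorProduct.induction_on with
        | zero => simp
        | add x y hx hy => simp only [map_add, Prod.fst_add, hx, hy]
        | tmul x y => rfl
      · induction v using TensorProduct.induction_on with
        | zero => simp
        | add x y hx hy => simp only [map_add, Prod.snd_add, hx, hy]
        | tmul x y => rfl)

end Equivalences

section Permutation

variable (G) (S T : Type*) [MulAction G S] [MulAction G T]

/-- The permutation lattice of a disjoint union. -/
def permRepSum : ((permRep G S).prod (permRep G T)).Equiv (permRep G (S ⊕ T)) :=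
  Equiv.mk (LinearEquiv.sumArrowLequivProdArrow S T ℤ ℤ).symm fun g => LinearMap.ext fun f => by
    ext (s | t) <;> rfl

/-- Isomorphic `G`-sets have isomorphic permutation lattices. -/
def permRepCongr {S T : Type*} [MulAction G S] [MulAction G T] (e : S ≃ T)
    (he : ∀ (g : G) s, e (g • s) = g • e s) : (permRep G S).Equiv (permRep G T) :=
  Equiv.mk (LinearEquiv.funCongrLeft ℤ ℤ e.symm) fun g => LinearMap.ext fun f => by
    ext t
    obtain ⟨s, rfl⟩ := e.surjective t
    change f (g⁻¹ • (e.symm (e s))) = f (e.symm (g⁻¹ • e s))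
    rw [← he, e.symm_apply_apply, e.symm_apply_apply]

variable [Finite S] [Finite T]

/-- The permutation lattice of a product. -/
def permRepProd : ((permRep G S).tprodInt (permRep G T)).Equiv (permRep G (S × T)) :=
  have := Fintype.ofFinite S
  have := Fintype.ofFinite T
  have key : ∀ (f : S → ℤ) (f' : T → ℤ) (p : S × T),
      (((Pi.basisFun ℤ S).tensorProduct (Pi.basisFun ℤ T)).equivFun) (f ⊗ₜ f') p = f p.1 * f' p.2 :=
    fun f f' p => by
      obtain ⟨s, t⟩ := p
      rw [Module.Basis.equivFun_apply, Module.Basis.tensorProduct_repr_tmul_apply]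
      simp [mul_comm]
  IntertwiningMap.toEquiv (IntertwiningMap.ofAddHom
    ((Pi.basisFun ℤ S).tensorProduct (Pi.basisFun ℤ T)).equivFun.toAddEquiv.toAddMonoidHom
    fun g v => by
      induction v using TensorProduct.induction_on with
      | zero => simp
      | add x y hx hy => simp only [map_add, hx, hy]
      | tmul f f' =>
        ext p
        change (((Pi.basisFun ℤ S).tensorProduct (Pi.basisFun ℤ T)).equivFun)
          (permRep G S g f ⊗ₜ permRep G T g f') p = (((Pi.basisFun ℤ S).tensorProduct
          (Pi.basisFun ℤ T)).equivFun) (f ⊗ₜ f') (g⁻¹ • p)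
        rw [key, key]; rfl)
    ((Pi.basisFun ℤ S).tensorProduct (Pi.basisFun ℤ T)).equivFun.bijective

lemma permRepProd_tmul (f : S → ℤ) (f' : T → ℤ) (p : S × T) :
    permRepProd G S T (f ⊗ₜ f') p = f p.1 * f' p.2 := by
  have := Fintype.ofFinite S
  have := Fintype.ofFinite T
  obtain ⟨s, t⟩ := p
  change (((Pi.basisFun ℤ S).tensorProduct (Pi.basisFun ℤ T)).equivFun) (f ⊗ₜ f') (s, t) = _
  rw [Module.Basis.equivFun_apply, Module.Basis.tensorProduct_repr_tmul_apply]
  simp [mul_comm]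

end Permutation

lemma IsInvertible.perm (S : Type) [Finite S] [MulAction G S] : IsInvertible (permRep G S) :=
  ⟨S, inferInstance, inferInstance, .id _, .id _, fun _ => rfl⟩

lemma IsInvertible.of_retract (hσ : IsInvertible σ) (i : IntertwiningMap ρ σ)
    (r : IntertwiningMap σ ρ) (h : ∀ v, r (i v) = v) : IsInvertible ρ := by
  obtain ⟨S, _, _, j, p, hp⟩ := hσ
  exact ⟨S, inferInstance, inferInstance, j.comp i, r.comp p, fun v => by simp [hp, h]⟩

lemma IsInvertible.of_equiv (hσ : IsInvertible σ) (e : ρ.Equiv σ) : IsInvertible ρ :=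
  hσ.of_retract e.toIntertwiningMap e.symm.toIntertwiningMap e.symm_apply_apply

lemma IsInvertible.tprodInt (hρ : IsInvertible ρ) (hσ : IsInvertible σ) :
    IsInvertible (ρ.tprodInt σ) := by
  obtain ⟨S, _, _, j, p, hp⟩ := hρ
  obtain ⟨S', _, _, j', p', hp'⟩ := hσ
  refine IsInvertible.of_retract ((IsInvertible.perm (S × S')).of_equiv (permRepProd G S S'))
    (j.tensorInt j') (p.tensorInt p') fun v => ?_
  induction v using TensorProduct.induction_on with
  | zero => simp
  | add x y hx hy => rw [map_add, map_add, hx, hy]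
  | tmul x y =>
    change p (j x) ⊗ₜ p' (j' y) = _
    rw [hp, hp']

lemma IsInvertible.prod (hρ : IsInvertible ρ) (hσ : IsInvertible σ) :
    IsInvertible (ρ.prod σ) := by
  obtain ⟨S, _, _, j, p, hp⟩ := hρ
  obtain ⟨S', _, _, j', p', hp'⟩ := hσ
  refine IsInvertible.of_retract ((IsInvertible.perm (S ⊕ S')).of_equiv (permRepSum G S S'))
    ((j.comp (.fst ℤ _ _)).prod (j'.comp (.snd ℤ _ _)))
    ((p.comp (.fst ℤ _ _)).prod (p'.comp (.snd ℤ _ _))) fun v => ?_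
  exact Prod.ext (hp _) (hp' _)

lemma IsInvertible.flat (hρ : IsInvertible ρ) : Module.Flat ℤ V := by
  obtain ⟨S, _, _, j, p, hp⟩ := hρ
  exact Module.Flat.of_retract j.toLinearMap p.toLinearMap (LinearMap.ext hp)

lemma IsStablyPerm.isInvertible (h : IsStablyPerm ρ) : IsInvertible ρ := by
  obtain ⟨S, _, _, T, _, _, ⟨e⟩⟩ := h
  exact ((IsInvertible.perm T).of_equiv e).of_retract (.inl ℤ _ _) (.fst ℤ _ _) fun _ => rfl

lemma IsStablyPerm.perm (S : Type) [Finite S] [MulAction G S] : IsStablyPerm (permRep G S) :=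
  ⟨S, inferInstance, inferInstance, S ⊕ S, inferInstance, inferInstance, ⟨permRepSum G S S⟩⟩

lemma IsStablyPerm.prod (hρ : IsStablyPerm ρ) (hσ : IsStablyPerm σ) :
    IsStablyPerm (ρ.prod σ) := by
  obtain ⟨S, _, _, T, _, _, ⟨e⟩⟩ := hρ
  obtain ⟨S', _, _, T', _, _, ⟨e'⟩⟩ := hσ
  exact ⟨S ⊕ S', inferInstance, inferInstance, T ⊕ T', inferInstance, inferInstance,
    ⟨(((Equiv.refl _).prodCongr (permRepSum G S S').symm).trans (Equiv.prodProdProdComm _ _ _ _)).trans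
      ((e.prodCongr e').trans (permRepSum G T T'))⟩⟩

/-- If `ρ × σ ≃ ρ'`, `σ × τ ≃ υ` and `ρ' × τ' ≃ υ'`, then `ρ × (υ × τ') ≃ υ' × τ`. -/
def Equiv.prodCancel {U U' X X' : Type*} [AddCommGroup U] [AddCommGroup U'] [AddCommGroup X]
    [AddCommGroup X'] {τ : Representation ℤ G U} {τ' : Representation ℤ G U'}
    {υ : Representation ℤ G X} {υ' : Representation ℤ G X'} (e : (ρ.prod σ).Equiv ρ')
    (f : (σ.prod τ).Equiv υ) (f' : (ρ'.prod τ').Equiv υ') :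
    (ρ.prod (υ.prod τ')).Equiv (υ'.prod τ) :=
  ((Equiv.refl ρ).prodCongr (f.symm.prodCongr (Equiv.refl τ'))).trans <|
  ((Equiv.refl ρ).prodCongr (Equiv.prodAssoc σ τ τ')).trans <|
  (Equiv.prodAssoc ρ σ (τ.prod τ')).symm.trans <|
  (e.prodCongr (Equiv.prodComm τ τ')).trans <|
  (Equiv.prodAssoc ρ' τ' τ).symm.trans <| f'.prodCongr (Equiv.refl τ)

/-- Add to `ρ` a permutation lattice `ℤ[T] ≃ σ ⊕ ℤ[S]`, so that `σ` is available to complete `ρ` to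
`ρ'`. A further permutation summand then makes `ρ'` permutation. -/
lemma IsStablyPerm.cancel (hσ : IsStablyPerm σ) (hρ' : IsStablyPerm ρ')
    (e : (ρ.prod σ).Equiv ρ') : IsStablyPerm ρ := by
  obtain ⟨S, _, _, T, _, _, ⟨f⟩⟩ := hσ
  obtain ⟨S', _, _, T', _, _, ⟨f'⟩⟩ := hρ'
  exact ⟨T ⊕ S', inferInstance, inferInstance, T' ⊕ S, inferInstance, inferInstance,
    ⟨((Equiv.refl ρ).prodCongr (permRepSum G T S').symm).trans
      ((Equiv.prodCancel e f f').trans (permRepSum G T' S))⟩⟩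

lemma IsStablyPerm.perm_tprod (hσ : IsStablyPerm σ) (S : Type) [Finite S] [MulAction G S] :
    IsStablyPerm ((permRep G S).tprodInt σ) := by
  obtain ⟨S', _, _, T, _, _, ⟨f⟩⟩ := hσ
  refine ⟨S × S', inferInstance, inferInstance, S × T, inferInstance, inferInstance, ⟨?_⟩⟩
  exact ((Equiv.refl _).prodCongr (permRepProd G S S').symm).trans
    ((Equiv.tprodProd _ _ _).symm.trans (((Equiv.refl _).tprodCongr f).trans (permRepProd G S T)))

/-- Tensoring `ρ ⊕ ℤ[S] ≃ ℤ[T]` with `σ` exhibits `ρ ⊗ σ` as the complement of `ℤ[S] ⊗ σ` in `ℤ[T] ⊗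
σ`. Both of these are stably permutation, so cancellation applies. -/
lemma IsStablyPerm.tprodInt (hρ : IsStablyPerm ρ) (hσ : IsStablyPerm σ) :
    IsStablyPerm (ρ.tprodInt σ) := by
  obtain ⟨S, _, _, T, _, _, ⟨f⟩⟩ := hρ
  exact (hσ.perm_tprod S).cancel (hσ.perm_tprod T)
    ((Equiv.prodTprod _ _ _).symm.trans (f.tprodCongr (Equiv.refl _)))

/-- A class of invertible lattices which contains the permutation lattices and is closed under
products, tensor products and complements. -/
structure IsLatticeClass (C : ∀ (V : Type) [AddCommGroup V], Representation ℤ G V → Prop) :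
    Prop where
  isInvertible : ∀ {V : Type} [AddCommGroup V] {ρ : Representation ℤ G V}, C V ρ → IsInvertible ρ
  perm : ∀ (S : Type) [Finite S] [MulAction G S], C _ (permRep G S)
  prod : ∀ {V W : Type} [AddCommGroup V] [AddCommGroup W] {ρ : Representation ℤ G V}
    {σ : Representation ℤ G W}, C V ρ → C W σ → C _ (ρ.prod σ)
  tprod : ∀ {V W : Type} [AddCommGroup V] [AddCommGroup W] {ρ : Representation ℤ G V}
    {σ : Representation ℤ G W}, C V ρ → C W σ → C _ (ρ.tprodInt σ)
  cancel : ∀ {V W V' : Type} [AddCommGroup V] [AddCommGroup W] [AddCommGroup V']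
    {ρ : Representation ℤ G V} {σ : Representation ℤ G W} {ρ' : Representation ℤ G V'},
    C W σ → C V' ρ' → (ρ.prod σ).Equiv ρ' → C V ρ

lemma isLatticeClass_isInvertible :
    IsLatticeClass (fun _ _ (ρ : Representation ℤ G _) => IsInvertible ρ) where
  isInvertible h := h
  perm S := IsInvertible.perm S
  prod h h' := h.prod h'
  tprod h h' := h.tprodInt h'
  cancel _ h e := (h.of_equiv e).of_retract (.inl ℤ _ _) (.fst ℤ _ _) fun _ => rfl

lemma isLatticeClass_isStablyPerm :
    IsLatticeClass (fun _ _ (ρ : Representation ℤ G _) => IsStablyPerm ρ) where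
  isInvertible h := h.isInvertible
  perm S := IsStablyPerm.perm S
  prod h h' := h.prod h'
  tprod h h' := h.tprodInt h'
  cancel h h' e := h.cancel h' e

/-- There is an exact sequence `0 → ρ → μ → ν → 0` with `μ` and `ν` in the class `C`. -/
def HasResolution (C : ∀ (V : Type) [AddCommGroup V], Representation ℤ G V → Prop)
    (ρ : Representation ℤ G V) : Prop :=
  ∃ (P F : Type) (_ : AddCommGroup P) (_ : AddCommGroup F) (μ : Representation ℤ G P)
    (ν : Representation ℤ G F) (i : IntertwiningMap ρ μ) (q : IntertwiningMap μ ν),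
    IsShortExact i q ∧ C P μ ∧ C F ν

lemma HasResolution.of_equiv {C : ∀ (V : Type) [AddCommGroup V], Representation ℤ G V → Prop}
    (h : HasResolution C σ) (e : ρ.Equiv σ) : HasResolution C ρ := by
  obtain ⟨P, F, _, _, μ, ν, i, q, hiq, hμ, hν⟩ := h
  refine ⟨P, F, _, _, μ, ν, i.comp e.toIntertwiningMap, q, ⟨?_, hiq.surjective, fun x => ?_⟩, hμ, hν⟩
  · exact hiq.injective.comp e.toLinearEquiv.injective
  · rw [hiq.apply_eq_zero_iff]
    exact ⟨fun ⟨m, hm⟩ => ⟨e.symm m, by simpa using hm⟩, fun ⟨m, hm⟩ => ⟨e m, hm⟩⟩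

/-! ### Mapping cones of resolutions. -/

section Cone

variable [Finite G] {M P F : Type*} [AddCommGroup M] [AddCommGroup P] [AddCommGroup F]

/-- Equivariant maps into an invertible lattice extend along an exact sequence with invertible
cokernel. -/
lemma IsShortExact.exists_extend {ρ : Representation ℤ G M} {μ : Representation ℤ G P}
    {ν : Representation ℤ G F} {i : IntertwiningMap ρ μ} {q : IntertwiningMap μ ν}
    (h : IsShortExact i q) (hν : IsInvertible ν) (hσ : IsInvertible σ) (f : IntertwiningMap ρ σ) :
    ∃ f' : IntertwiningMap μ σ, ∀ m, f' (i m) = f m := by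
  obtain ⟨T, _, _, j, r, hr⟩ := hσ
  obtain ⟨f', hf'⟩ := h.exists_extend_perm hν (j.comp f)
  exact ⟨r.comp f', fun m => by simp [hf', hr]⟩

variable {M₁ M₂ M₃ P₂ F₂ P₃ F₃ : Type*} [AddCommGroup M₁] [AddCommGroup M₂] [AddCommGroup M₃]
  [AddCommGroup P₂] [AddCommGroup F₂] [AddCommGroup P₃] [AddCommGroup F₃]
  {ρ₁ : Representation ℤ G M₁} {ρ₂ : Representation ℤ G M₂} {ρ₃ : Representation ℤ G M₃}
  {μ₂ : Representation ℤ G P₂} {ν₂ : Representation ℤ G F₂}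
  {μ₃ : Representation ℤ G P₃} {ν₃ : Representation ℤ G F₃}

/-- The mapping cone of a map of resolutions lifting a surjection `g : ρ₂ → ρ₃`, when the identity
of `ρ₃` is the sum of a map which factors through `g` and a map which factors through an invertible
lattice. -/
lemma IsShortExact.exists_cone {a : IntertwiningMap ρ₁ ρ₂} {g : IntertwiningMap ρ₂ ρ₃}
    (h : IsShortExact a g)
    {i₂ : IntertwiningMap ρ₂ μ₂} {q₂ : IntertwiningMap μ₂ ν₂} (h₂ : IsShortExact i₂ q₂)
    {i₃ : IntertwiningMap ρ₃ μ₃} {q₃ : IntertwiningMap μ₃ ν₃} (h₃ : IsShortExact i₃ q₃)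
    (hμ₂ : IsInvertible μ₂) (hν₂ : IsInvertible ν₂) (hμ₃ : IsInvertible μ₃) (hν₃ : IsInvertible ν₃)
    (hσ : IsInvertible σ) (s : IntertwiningMap ρ₃ ρ₂) (α : IntertwiningMap ρ₃ σ)
    (β : IntertwiningMap σ ρ₃) (hid : ∀ x, g (s x) + β (α x) = x) :
    ∃ (κ : Subrepresentation (ν₂.prod μ₃)) (i : IntertwiningMap ρ₁ μ₂)
      (q : IntertwiningMap μ₂ κ.toRepresentation), IsShortExact i q ∧
      Nonempty ((κ.toRepresentation.prod ν₃).Equiv (ν₂.prod μ₃)) := by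
  -- The maps `g`, `s` and `α` extend to the middle terms of the resolutions; the extensions of `g`
  -- and `s` induce maps `gb` and `sb` between the cokernels.
  obtain ⟨g', hg'⟩ := h₂.exists_extend hν₂ hμ₃ (i₃.comp g)
  obtain ⟨s', hs'⟩ := h₃.exists_extend hν₃ hμ₂ (i₂.comp s)
  obtain ⟨α', hα'⟩ := h₃.exists_extend hν₃ hσ α
  simp only [IntertwiningMap.comp_apply] at hg' hs' hα'
  obtain ⟨gb, hgb⟩ := q₂.exists_factor h₂.surjective (q₃.comp g') (fun x hx => by
    obtain ⟨m, rfl⟩ := (h₂.apply_eq_zero_iff x).1 hx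
    simp [hg', h₃.apply_apply])
  obtain ⟨sb, hsb⟩ := q₃.exists_factor h₃.surjective (q₂.comp s') (fun x hx => by
    obtain ⟨m, rfl⟩ := (h₃.apply_eq_zero_iff x).1 hx
    simp [hs', h₂.apply_apply])
  -- The hypothesis `hid` says that `1 - g' s' - i₃ β α'` vanishes on the image of `ρ₃`. It
  -- therefore factors through `ν₃`, and `t` plays the role of a contracting homotopy.
  obtain ⟨t, ht⟩ := q₃.exists_factor h₃.surjective
    (.id μ₃ - g'.comp s' - (i₃.comp β).comp α') (fun x hx => by
    obtain ⟨m, rfl⟩ := (h₃.apply_eq_zero_iff x).1 hx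
    have : i₃ m = i₃ (g (s m)) + i₃ (β (α m)) := by rw [← map_add, hid]
    simp only [IntertwiningMap.coe_sub, Pi.sub_apply, IntertwiningMap.id_apply,
      IntertwiningMap.comp_apply, hs', hg', hα']
    rw [sub_sub, ← this, sub_self])
  simp only [IntertwiningMap.comp_apply] at hgb hsb
  -- This is the last differential of the cone; its kernel is the new cokernel `κ`. Composing with
  -- `q₃` kills the term `i₃ β α'`, so `(sb, -t)` is an honest section of `d`, and `κ ⊕ ν₃ ≃ ν₂ ⊕
  -- μ₃`.
  let d : IntertwiningMap (ν₂.prod μ₃) ν₃ := gb.comp (.fst ℤ _ _) - q₃.comp (.snd ℤ _ _)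
  have hd : ∀ f p, d (f, p) = gb f - q₃ p := fun f p => rfl
  let sec : IntertwiningMap ν₃ (ν₂.prod μ₃) := sb.prod (-t)
  have hsec : ∀ y, d (sec y) = y := by
    intro y
    obtain ⟨p, rfl⟩ := h₃.surjective y
    change gb (sb (q₃ p)) - q₃ (-(t (q₃ p))) = _
    rw [hsb, hgb, ht, map_neg, sub_neg_eq_add, ← map_add]
    have : g' (s' p) + ((.id μ₃ - g'.comp s' - (i₃.comp β).comp α' : IntertwiningMap μ₃ μ₃)) p =
        p - i₃ (β (α' p)) := by simp; abel
    rw [this, map_sub, h₃.apply_apply, sub_zero]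
  have hmem : ∀ x, x ∈ d.ker.toSubmodule ↔ d x = 0 := fun x => Iff.rfl
  refine ⟨d.ker, i₂.comp a, IntertwiningMap.ofAddHom
    { toFun := fun x => ⟨(q₂ x, g' x), by rw [hmem, hd, hgb, sub_self]⟩
      map_zero' := by ext <;> simp
      map_add' := fun x y => by ext <;> simp } ?_, ⟨?_, ?_, ?_⟩, ⟨?_⟩⟩
  · intro c x
    refine Subtype.ext (Prod.ext ?_ ?_)
    · exact IntertwiningMap.isIntertwining _ _ q₂ c x
    · exact IntertwiningMap.isIntertwining _ _ g' c x
  · exact h₂.injective.comp h.injective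
  · rintro ⟨⟨f, p⟩, hfp⟩
    rw [hmem, hd, sub_eq_zero] at hfp
    obtain ⟨x, rfl⟩ := h₂.surjective f
    -- A preimage `x` of the first component is off in the second by an element of `ρ₃`.
    -- Surjectivity of `g` lifts it to `ρ₂`, whose elements do not affect the first component.
    obtain ⟨z, hz⟩ := (h₃.apply_eq_zero_iff (p - g' x)).1 (by rw [map_sub, ← hfp, hgb, sub_self])
    obtain ⟨m, rfl⟩ := h.surjective z
    refine ⟨x + i₂ m, Subtype.ext (Prod.ext ?_ ?_)⟩
    · change q₂ (x + i₂ m) = q₂ x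
      rw [map_add, h₂.apply_apply, add_zero]
    · change g' (x + i₂ m) = p
      rw [map_add, hg', hz, add_sub_cancel]
  · intro x
    constructor
    · intro hx
      have h1 : q₂ x = 0 := congrArg (fun y => y.1.1) hx
      have h2 : g' x = 0 := congrArg (fun y => y.1.2) hx
      obtain ⟨m, rfl⟩ := (h₂.apply_eq_zero_iff x).1 h1
      rw [hg', ← map_zero i₃] at h2
      obtain ⟨n, rfl⟩ := (h.apply_eq_zero_iff m).1 (h₃.injective h2)
      exact ⟨n, rfl⟩
    · rintro ⟨m, rfl⟩
      refine Subtype.ext (Prod.ext ?_ ?_)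
      · exact h₂.apply_apply _
      · change g' (i₂ (a m)) = 0
        rw [hg', h.apply_apply, map_zero]
  · refine IntertwiningMap.toEquiv (IntertwiningMap.ofAddHom
      { toFun := fun x => x.1.1 + sec x.2
        map_zero' := by simp
        map_add' := fun x y => by
          rw [Prod.fst_add, Prod.snd_add, map_add, Submodule.coe_add]; abel } ?_) ⟨?_, ?_⟩
    · intro c x
      change (ν₂.prod μ₃ c) x.1.1 + sec (ν₃ c x.2) = (ν₂.prod μ₃ c) (x.1.1 + sec x.2)
      rw [map_add]
      congr 1
      exact IntertwiningMap.isIntertwining _ _ sec c _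
    · rw [injective_iff_map_eq_zero]
      rintro ⟨⟨x, hx⟩, y⟩ hxy
      change x + sec y = 0 at hxy
      have hy : y = 0 := by
        have := congrArg d hxy
        rwa [map_add, (hmem x).1 hx, hsec, zero_add, map_zero] at this
      subst hy
      rw [map_zero, add_zero] at hxy
      subst hxy
      rfl
    · intro x
      refine ⟨(⟨x - sec (d x), by rw [hmem, map_sub, hsec, sub_self]⟩, d x), ?_⟩
      change x - sec (d x) + sec (d x) = x
      exact sub_add_cancel _ _

/-- The new cokernel is a complement of `ν₃` in `ν₂ ⊕ μ₃`, so it lies in the class by cancellation;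
the new middle term is that of `ρ₂`. -/
lemma HasResolution.cone {C : ∀ (V : Type) [AddCommGroup V], Representation ℤ G V → Prop}
    (hC : IsLatticeClass C) (h₂ : HasResolution C ρ₂) (h₃ : HasResolution C ρ₃)
    {a : IntertwiningMap ρ₁ ρ₂} {g : IntertwiningMap ρ₂ ρ₃} (h : IsShortExact a g)
    (hσ : IsInvertible σ) (s : IntertwiningMap ρ₃ ρ₂) (α : IntertwiningMap ρ₃ σ)
    (β : IntertwiningMap σ ρ₃) (hid : ∀ x, g (s x) + β (α x) = x) : HasResolution C ρ₁ := by
  obtain ⟨P₂, F₂, _, _, μ₂, ν₂, i₂, q₂, e₂, hμ₂, hν₂⟩ := h₂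
  obtain ⟨P₃, F₃, _, _, μ₃, ν₃, i₃, q₃, e₃, hμ₃, hν₃⟩ := h₃
  obtain ⟨κ, i, q, e, ⟨f⟩⟩ := h.exists_cone e₂ e₃ (hC.isInvertible hμ₂) (hC.isInvertible hν₂)
    (hC.isInvertible hμ₃) (hC.isInvertible hν₃) hσ s α β hid
  exact ⟨P₂, _, _, inferInstance, μ₂, κ.toRepresentation, i, q, e, hμ₂,
    hC.cancel hν₃ (hC.prod hν₂ hμ₃) f⟩

end Cone

end Representation

/-! ### Tensor products and the lattices of norm one tori. -/

namespace Representation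

variable {G : Type*} [Group G]
variable {V : Type*} [AddCommGroup V] {W : Type*} [AddCommGroup W]
  {ρ : Representation ℤ G V} {σ : Representation ℤ G W}

lemma HasResolution.flat {C : ∀ (V : Type) [AddCommGroup V], Representation ℤ G V → Prop}
    (hC : IsLatticeClass C) (h : HasResolution C ρ) : Module.Flat ℤ V := by
  obtain ⟨P, F, _, _, μ, ν, i, q, hiq, hμ, hν⟩ := h
  have := (hC.isInvertible hμ).flat
  have : Module.IsTorsionFree ℤ V :=
    Function.Injective.moduleIsTorsionFree i hiq.injective fun _ _ => map_smul i _ _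
  infer_instance

lemma IsShortExact.tensor_left {M P F : Type*} [AddCommGroup M] [AddCommGroup P] [AddCommGroup F]
    {ρ : Representation ℤ G M} {μ : Representation ℤ G P} {ν : Representation ℤ G F}
    {i : IntertwiningMap ρ μ} {q : IntertwiningMap μ ν} (h : IsShortExact i q)
    [hV : Module.Flat ℤ W] :
    IsShortExact ((IntertwiningMap.id σ).tensorInt i) ((IntertwiningMap.id σ).tensorInt q) where
  injective := Module.Flat.lTensor_preserves_injective_linearMap i.toLinearMap h.injective
  surjective := LinearMap.lTensor_surjective W (g := q.toLinearMap) h.surjective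
  apply_eq_zero_iff x := lTensor_exact W (f := i.toLinearMap) (g := q.toLinearMap)
    h.apply_eq_zero_iff h.surjective x

lemma IsShortExact.tensor_right {M P F : Type*} [AddCommGroup M] [AddCommGroup P] [AddCommGroup F]
    {ρ : Representation ℤ G M} {μ : Representation ℤ G P} {ν : Representation ℤ G F}
    {i : IntertwiningMap ρ μ} {q : IntertwiningMap μ ν} (h : IsShortExact i q)
    [hV : Module.Flat ℤ W] :
    IsShortExact (i.tensorInt (.id σ)) (q.tensorInt (.id σ)) where
  injective := Module.Flat.rTensor_preserves_injective_linearMap i.toLinearMap h.injective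
  surjective := LinearMap.rTensor_surjective W (g := q.toLinearMap) h.surjective
  apply_eq_zero_iff x := rTensor_exact W (f := i.toLinearMap) (g := q.toLinearMap)
    h.apply_eq_zero_iff h.surjective x

lemma HasResolution.tensor_left {C : ∀ (V : Type) [AddCommGroup V], Representation ℤ G V → Prop}
    (hC : IsLatticeClass C) (h : HasResolution C ρ) {U : Type} [AddCommGroup U]
    {τ : Representation ℤ G U} (hτ : C U τ) : HasResolution C (τ.tprodInt ρ) := by
  obtain ⟨P, F, _, _, μ, ν, i, q, hiq, hμ, hν⟩ := h
  have := (hC.isInvertible hτ).flat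
  exact ⟨_, _, _, _, τ.tprodInt μ, τ.tprodInt ν, _, _, hiq.tensor_left, hC.tprod hτ hμ,
    hC.tprod hτ hν⟩

lemma HasResolution.prod {C : ∀ (V : Type) [AddCommGroup V], Representation ℤ G V → Prop}
    (hC : IsLatticeClass C) (h : HasResolution C ρ) (h' : HasResolution C σ) :
    HasResolution C (ρ.prod σ) := by
  obtain ⟨P, F, _, _, μ, ν, i, q, hiq, hμ, hν⟩ := h
  obtain ⟨P', F', _, _, μ', ν', i', q', hiq', hμ', hν'⟩ := h'
  refine ⟨_, _, _, _, μ.prod μ', ν.prod ν', (i.comp (.fst ℤ _ _)).prod (i'.comp (.snd ℤ _ _)),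
    (q.comp (.fst ℤ _ _)).prod (q'.comp (.snd ℤ _ _)), ⟨?_, ?_, ?_⟩, hC.prod hμ hμ',
    hC.prod hν hν'⟩
  · exact hiq.injective.prodMap hiq'.injective
  · exact hiq.surjective.prodMap hiq'.surjective
  · rintro ⟨x, y⟩
    constructor
    · intro hxy
      obtain ⟨m, rfl⟩ := (hiq.apply_eq_zero_iff x).1 (congrArg Prod.fst hxy)
      obtain ⟨n, rfl⟩ := (hiq'.apply_eq_zero_iff y).1 (congrArg Prod.snd hxy)
      exact ⟨(m, n), rfl⟩
    · rintro ⟨⟨m, n⟩, hmn⟩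
      rw [← hmn]
      exact Prod.ext (hiq.apply_apply m) (hiq'.apply_apply n)

/-- `π` is the quotient map of the permutation lattice of `X` by the constant functions; the target
is the character lattice of a norm one torus. -/
structure IsNormOneQuotient {X : Type*} [MulAction G X] (π : IntertwiningMap (permRep G X) ρ) :
    Prop where
  surjective : Function.Surjective π
  apply_eq_zero_iff : ∀ f, π f = 0 ↔ ∃ c, ∀ x, f x = c

section NormOne

variable {X : Type*} [Finite X] [MulAction G X] {π : IntertwiningMap (permRep G X) ρ}

/-- An invariant weight `w` on `X` gives a section up to the factor `∑ w` of the quotient map. -/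
lemma IsNormOneQuotient.exists_section (hπ : IsNormOneQuotient π) (w : X → ℤ)
    (hw : ∀ (g : G) x, w (g • x) = w x) :
    ∃ s : IntertwiningMap ρ (permRep G X), ∀ v, π (s v) = (∑ᶠ x, w x) • v := by
  have := Fintype.ofFinite X
  let d : ℤ := ∑ x, w x
  -- The map `ε` sends `f` to the constant function with value `∑ w x * f x`. Thus `d • id - ε`
  -- kills constants and descends to the quotient, while `π` kills `ε`, which leaves multiplication
  -- by `d`.
  let ε : IntertwiningMap (permRep G X) (permRep G X) := IntertwiningMap.ofAddHom
    { toFun := fun f _ => ∑ x, w x * f x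
      map_zero' := by ext; simp
      map_add' := fun f f' => by ext; simp [mul_add, Finset.sum_add_distrib] } fun g f => by
        ext x
        change ∑ x, w x * f (g⁻¹ • x) = ∑ x, w x * f x
        rw [← _root_.Equiv.sum_comp (MulAction.toPerm g)]
        simp [hw]
  have hε : ∀ f x, ε f x = ∑ x, w x * f x := fun _ _ => rfl
  obtain ⟨s, hs⟩ := π.exists_factor hπ.surjective (d • .id _ - ε) (fun f hf => by
    obtain ⟨c, hc⟩ := (hπ.apply_eq_zero_iff f).1 hf
    ext x
    change d • f x - ε f x = 0
    rw [hε]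
    simp [hc, d, Finset.sum_mul])
  refine ⟨s, fun v => ?_⟩
  obtain ⟨f, rfl⟩ := hπ.surjective v
  rw [hs]
  change π (d • f - ε f) = _
  rw [map_sub, map_zsmul, (hπ.apply_eq_zero_iff (ε f)).2 ⟨_, hε f⟩, sub_zero,
    finsum_eq_sum_of_fintype]

variable {Y : Type*} [Finite Y] [MulAction G Y] {π' : IntertwiningMap (permRep G Y) σ}

/-- Invertibility asks for a `G`-set in `Type`; reindexing by `Fin n` brings sets from other
universes there. -/
lemma isInvertible_permRep (X : Type*) [Finite X] [MulAction G X] :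
    IsInvertible (permRep G X) := by
  obtain ⟨n, ⟨e⟩⟩ := Finite.exists_equiv_fin X
  let : MulAction G (Fin n) := e.symm.mulAction G
  refine (IsInvertible.perm (Fin n)).of_equiv (permRepCongr G e fun g s => ?_)
  change _ = e (g • e.symm (e s))
  rw [e.symm_apply_apply]

lemma IsLatticeClass.exists_equiv_perm
    {C : ∀ (V : Type) [AddCommGroup V], Representation ℤ G V → Prop}
    (hC : IsLatticeClass C) (X : Type*) [Finite X] [MulAction G X] :
    ∃ (V : Type) (_ : AddCommGroup V) (τ : Representation ℤ G V), C V τ ∧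
      Nonempty ((permRep G X).Equiv τ) := by
  obtain ⟨n, ⟨e⟩⟩ := Finite.exists_equiv_fin X
  let : MulAction G (Fin n) := e.symm.mulAction G
  refine ⟨_, _, permRep G (Fin n), hC.perm _, ⟨permRepCongr G e fun g s => ?_⟩⟩
  change _ = e (g • e.symm (e s))
  rw [e.symm_apply_apply]

lemma HasResolution.perm_tensor {C : ∀ (V : Type) [AddCommGroup V], Representation ℤ G V → Prop}
    (hC : IsLatticeClass C) (h : HasResolution C ρ) (X : Type*) [Finite X] [MulAction G X] :
    HasResolution C ((permRep G X).tprodInt ρ) := by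
  obtain ⟨V, _, τ, hτ, ⟨e⟩⟩ := hC.exists_equiv_perm (G := G) X
  exact (h.tensor_left hC hτ).of_equiv (e.tprodCongr (Equiv.refl _))

/-- Commutativity of the tensor product of representations. -/
def Equiv.tprodComm (ρ : Representation ℤ G V) (σ : Representation ℤ G W) :
    (ρ.tprodInt σ).Equiv (σ.tprodInt ρ) :=
  IntertwiningMap.toEquiv (IntertwiningMap.ofAddHom
    (_root_.TensorProduct.comm ℤ V W).toAddEquiv.toAddMonoidHom fun g v => by
      induction v using TensorProduct.induction_on with
      | zero => simp
      | add x y hx hy => simp only [map_add, hx, hy]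
      | tmul f f' => rfl) (_root_.TensorProduct.comm ℤ V W).bijective

lemma IntertwiningMap.tensorInt_smul_id (c : ℤ) (v : V ⊗[ℤ] W) :
    (c • IntertwiningMap.id ρ).tensorInt (.id σ) v = c • v := by
  induction v using TensorProduct.induction_on with
  | zero => simp
  | add x y hx hy => simp only [map_add, hx, hy, smul_add]
  | tmul x y => exact TensorProduct.smul_tmul' c x y

lemma IntertwiningMap.tensorInt_id_smul (c : ℤ) (v : V ⊗[ℤ] W) :
    (IntertwiningMap.id ρ).tensorInt (c • .id σ) v = c • v := by
  induction v using TensorProduct.induction_on with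
  | zero => simp
  | add x y hx hy => simp only [map_add, hx, hy, smul_add]
  | tmul x y => exact TensorProduct.tmul_smul c x y

/-- The character lattice of the tensor product of two norm one tori of coprime type. -/
theorem HasResolution.tensor [Finite G] {C : ∀ (V : Type) [AddCommGroup V], Representation ℤ G V → Prop}
    (hC : IsLatticeClass C) (hπ : IsNormOneQuotient π) (hπ' : IsNormOneQuotient π')
    (w : X → ℤ) (hw : ∀ (g : G) x, w (g • x) = w x)
    (w' : Y → ℤ) (hw' : ∀ (g : G) x, w' (g • x) = w' x) (hww' : ∑ᶠ x, w x + ∑ᶠ y, w' y = 1)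
    (h : HasResolution C ρ) (h' : HasResolution C σ) : HasResolution C (ρ.tprodInt σ) := by
  have := h'.flat hC
  obtain ⟨s, hs⟩ := hπ.exists_section w hw
  obtain ⟨s', hs'⟩ := hπ'.exists_section w' hw'
  obtain ⟨P, F, _, _, μ, ν, i, q, hiq, hμ, hν⟩ := h
  -- The section up to a factor is moved from `π` to `q`. Extend `s` to `e` on `μ`; since `π s` is
  -- multiplication by `d = ∑ w`, the map `d - i π e` vanishes on `ρ` and induces `t : ν → μ` with
  -- `q t = d`.
  obtain ⟨e, he⟩ := hiq.exists_extend (hC.isInvertible hν) (isInvertible_permRep X) s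
  obtain ⟨t, ht⟩ := q.exists_factor hiq.surjective ((∑ᶠ x, w x) • .id _ - (i.comp π).comp e)
    (fun x hx => by
      obtain ⟨m, rfl⟩ := (hiq.apply_eq_zero_iff x).1 hx
      change (∑ᶠ x, w x) • i m - i (π (e (i m))) = 0
      rw [he, hs, map_zsmul, sub_self])
  have hqt : ∀ y, q (t y) = (∑ᶠ x, w x) • y := by
    intro y
    obtain ⟨p, rfl⟩ := hiq.surjective y
    rw [ht]
    change q ((∑ᶠ x, w x) • p - i (π (e p))) = _
    rw [map_sub, hiq.apply_apply, sub_zero, map_zsmul]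
  -- The sequence is the given resolution of `ρ` tensored with `σ`. On `ν ⊗ σ` the multiple `∑ w` of
  -- the identity factors through `μ ⊗ σ` by `t`, and the multiple `∑ w'` factors through the
  -- invertible lattice `ν ⊗ ℤ[Y]` by `s'`.
  refine HasResolution.cone hC (h'.tensor_left hC hμ) (h'.tensor_left hC hν)
    (hiq.tensor_right (σ := σ)) ((hC.isInvertible hν).tprodInt (isInvertible_permRep (G := G) Y))
    (t.tensorInt (.id σ)) ((IntertwiningMap.id ν).tensorInt s')
    ((IntertwiningMap.id ν).tensorInt π') fun x => ?_
  have e₁ : q.comp t = (∑ᶠ x, w x) • .id ν := IntertwiningMap.ext (LinearMap.ext hqt)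
  have e₂ : π'.comp s' = (∑ᶠ x, w' x) • .id σ := IntertwiningMap.ext (LinearMap.ext hs')
  rw [IntertwiningMap.tensorInt_comp, IntertwiningMap.tensorInt_comp, e₁, e₂]
  change (((∑ᶠ x, w x) • IntertwiningMap.id ν).tensorInt (.id σ)) x +
    ((IntertwiningMap.id ν).tensorInt ((∑ᶠ x, w' x) • .id σ)) x = x
  rw [IntertwiningMap.tensorInt_smul_id, IntertwiningMap.tensorInt_id_smul, ← add_smul, hww',
    one_smul]

/-- Under `V ⊗ ℤ^Y ≃ V^Y` the map `π ⊗ 1` applies `π` separately to each function `x ↦ z (x, y)`. -/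
lemma IsNormOneQuotient.tensor_apply_eq_zero_iff (hπ : IsNormOneQuotient π)
    (z : (X → ℤ) ⊗[ℤ] (Y → ℤ)) : π.tensorInt (.id (permRep G Y)) z = 0 ↔
      ∀ y, ∃ c, ∀ x, permRepProd G X Y z (x, y) = c := by
  classical
  have := Fintype.ofFinite Y
  have key : ∀ y, TensorProduct.piScalarRight ℤ ℤ V Y (π.tensorInt (.id (permRep G Y)) z) y =
      π (fun x => permRepProd G X Y z (x, y)) := by
    intro y
    induction z using TensorProduct.induction_on with
    | zero => simp; exact (map_zero π).symm
    | add a b ha hb =>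
      rw [map_add, map_add, Pi.add_apply, ha, hb, ← map_add]
      congr 1
      ext x
      simp
    | tmul f f' =>
      rw [IntertwiningMap.tensorInt_tmul]
      simp only [TensorProduct.piScalarRight_apply, TensorProduct.piScalarRightHom_tmul,
        permRepProd_tmul]
      rw [IntertwiningMap.id_apply, ← map_zsmul]
      congr 1
      ext x
      simp [mul_comm]
  rw [← (TensorProduct.piScalarRight ℤ ℤ V Y).map_eq_zero_iff, funext_iff]
  refine forall_congr' fun y => ?_
  rw [key, Pi.zero_apply, hπ.apply_eq_zero_iff]

lemma permRepProd_comm (z : (X → ℤ) ⊗[ℤ] (Y → ℤ)) (x : X) (y : Y) :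
    permRepProd G Y X (_root_.TensorProduct.comm ℤ _ _ z) (y, x) = permRepProd G X Y z (x, y) := by
  induction z using TensorProduct.induction_on with
  | zero => simp
  | add a b ha hb => simp only [map_add, Pi.add_apply, ha, hb]
  | tmul f f' => rw [TensorProduct.comm_tmul, permRepProd_tmul, permRepProd_tmul, mul_comm]

lemma IsNormOneQuotient.tensor_apply_eq_zero_iff' (hπ' : IsNormOneQuotient π')
    (z : (X → ℤ) ⊗[ℤ] (Y → ℤ)) : (IntertwiningMap.id (permRep G X)).tensorInt π' z = 0 ↔
      ∀ x, ∃ c, ∀ y, permRepProd G X Y z (x, y) = c := by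
  have h := hπ'.tensor_apply_eq_zero_iff (Y := X) (_root_.TensorProduct.comm ℤ _ _ z)
  simp only [permRepProd_comm] at h
  rw [← h, ← (_root_.TensorProduct.comm ℤ _ _).map_eq_zero_iff]
  refine Eq.congr ?_ rfl
  clear h
  induction z using TensorProduct.induction_on with
  | zero => simp
  | add a b ha hb => simp only [map_add, ha, hb]
  | tmul f f' => rfl

/-- The character lattice of the norm one torus of a tensor product of étale algebras of coprime
type. -/
theorem HasResolution.normOne_prod [Finite G]
    {C : ∀ (V : Type) [AddCommGroup V], Representation ℤ G V → Prop}
    (hC : IsLatticeClass C) (hπ : IsNormOneQuotient π) (hπ' : IsNormOneQuotient π')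
    (w : X → ℤ) (hw : ∀ (g : G) x, w (g • x) = w x)
    (w' : Y → ℤ) (hw' : ∀ (g : G) x, w' (g • x) = w' x) (hww' : ∑ᶠ x, w x + ∑ᶠ y, w' y = 1)
    (h : HasResolution C ρ) (h' : HasResolution C σ) {U : Type*} [AddCommGroup U]
    {τ : Representation ℤ G U} {π₂ : IntertwiningMap (permRep G (X × Y)) τ}
    (hπ₂ : IsNormOneQuotient π₂) : HasResolution C τ := by
  have h₃ := h.tensor hC hπ hπ' w hw w' hw' hww' h'
  have h₂ : HasResolution C ((ρ.tprodInt (permRep G Y)).prod ((permRep G X).tprodInt σ)) :=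
    HasResolution.prod hC ((h.perm_tensor hC Y).of_equiv (Equiv.tprodComm _ _))
      (h'.perm_tensor hC X)
  obtain ⟨s, hs⟩ := hπ.exists_section w hw
  obtain ⟨s', hs'⟩ := hπ'.exists_section w' hw'
  let p₁ := π.tensorInt (.id (permRep G Y))
  let p₂ := (IntertwiningMap.id (permRep G X)).tensorInt π'
  let q₁ := (IntertwiningMap.id ρ).tensorInt π'
  let q₂ := π.tensorInt (.id σ)
  have hpq : ∀ z, q₁ (p₁ z) = q₂ (p₂ z) := fun z => by
    rw [IntertwiningMap.tensorInt_comp, IntertwiningMap.tensorInt_comp]; rfl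
  have hp₁ : Function.Surjective p₁ := LinearMap.rTensor_surjective _ (g := π.toLinearMap)
    hπ.surjective
  have hp₂ : Function.Surjective p₂ := LinearMap.lTensor_surjective _ (g := π'.toLinearMap)
    hπ'.surjective
  let b : IntertwiningMap ((permRep G X).tprodInt (permRep G Y)) _ := p₁.prod p₂
  have hb : ∀ z, b z = (p₁ z, p₂ z) := fun _ => rfl
  let θ := permRepProd G X Y
  -- A function on `X × Y` that is constant along rows and along columns is constant. Hence `b`
  -- factors through an injection of the quotient by constants.
  have hbθ : ∀ z, b z = 0 ↔ π₂ (θ z) = 0 := by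
    intro z
    rw [hb, Prod.mk_eq_zero, hπ.tensor_apply_eq_zero_iff, hπ'.tensor_apply_eq_zero_iff',
      hπ₂.apply_eq_zero_iff]
    constructor
    · rintro ⟨hx, hy⟩
      choose c hc using hx
      choose d hd using hy
      -- A base point names the constant; if the product is empty any constant will do.
      by_cases hne : Nonempty (X × Y)
      · obtain ⟨x₀, y₀⟩ := hne
        exact ⟨c y₀, fun ⟨x, y⟩ => (hd x y).trans ((hd x y₀).symm.trans (hc y₀ x))⟩
      · exact ⟨0, fun x => (hne ⟨x⟩).elim⟩
    · rintro ⟨c, hc⟩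
      exact ⟨fun y => ⟨c, fun x => hc _⟩, fun x => ⟨c, fun y => hc _⟩⟩
  obtain ⟨a, ha⟩ := (π₂.comp θ.toIntertwiningMap).exists_factor
    (hπ₂.surjective.comp θ.toLinearEquiv.surjective) b (fun z hz => (hbθ z).2 hz)
  have ha' : ∀ z, a (π₂ (θ z)) = b z := ha
  let g : IntertwiningMap ((ρ.tprodInt (permRep G Y)).prod ((permRep G X).tprodInt σ))
      (ρ.tprodInt σ) := q₁.comp (.fst ℤ _ _) - q₂.comp (.snd ℤ _ _)
  have hg : ∀ u v, g (u, v) = q₁ u - q₂ v := fun _ _ => rfl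
  -- Composed with `g`, the first component gives multiplication by `∑ w'` and the second
  -- multiplication by `∑ w`, the sign cancelling the one in `g`. Their sum is the identity.
  let r : IntertwiningMap (ρ.tprodInt σ)
      ((ρ.tprodInt (permRep G Y)).prod ((permRep G X).tprodInt σ)) :=
    ((IntertwiningMap.id ρ).tensorInt s').prod (-(s.tensorInt (.id σ)))
  have hgr : ∀ x, g (r x) = x := by
    intro x
    change q₁ ((IntertwiningMap.id ρ).tensorInt s' x) - q₂ (-(s.tensorInt (.id σ) x)) = x
    have e₁ : π.comp s = (∑ᶠ x, w x) • .id ρ := IntertwiningMap.ext (LinearMap.ext hs)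
    have e₂ : π'.comp s' = (∑ᶠ x, w' x) • .id σ := IntertwiningMap.ext (LinearMap.ext hs')
    rw [map_neg, sub_neg_eq_add, IntertwiningMap.tensorInt_comp, IntertwiningMap.tensorInt_comp,
      e₁, e₂]
    change ((IntertwiningMap.id ρ).tensorInt ((∑ᶠ x, w' x) • .id σ)) x +
      (((∑ᶠ x, w x) • IntertwiningMap.id ρ).tensorInt (.id σ)) x = x
    rw [IntertwiningMap.tensorInt_smul_id, IntertwiningMap.tensorInt_id_smul, ← add_smul,
      add_comm, hww', one_smul]
  have hex : IsShortExact a g := by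
    refine ⟨?_, fun x => ⟨r x, hgr x⟩, ?_⟩
    · rw [injective_iff_map_eq_zero]
      intro x hx
      obtain ⟨f, rfl⟩ := hπ₂.surjective x
      obtain ⟨z, rfl⟩ := θ.toLinearEquiv.surjective f
      exact (hbθ z).1 ((ha' z).symm.trans hx)
    · rintro ⟨u, v⟩
      constructor
      · intro huv
        rw [hg, sub_eq_zero] at huv
        obtain ⟨z₁, rfl⟩ := hp₁ u
        obtain ⟨z₂, rfl⟩ := hp₂ v
        rw [← hpq, ← sub_eq_zero, ← map_sub, ← map_sub] at huv
        -- Exactness in the middle: `p₁ (z₁ - z₂)` dies in `ρ ⊗ σ`, so it comes from `ρ ⊗ ker π'`. A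
        -- lift `k` to `ℤ[X] ⊗ ker π'` is killed by `p₂`, so `z₂ + k` has the components wanted in
        -- both factors.
        have hex' : Function.Exact (LinearMap.ker π'.toLinearMap).subtype π'.toLinearMap :=
          fun y => by simp
        obtain ⟨y, hy⟩ := (lTensor_exact V hex' hπ'.surjective (p₁ (z₁ - z₂))).1 huv
        obtain ⟨y', rfl⟩ := LinearMap.rTensor_surjective _ (g := π.toLinearMap) hπ.surjective y
        let k := (LinearMap.ker π'.toLinearMap).subtype.lTensor (X → ℤ) y'
        have hk₁ : p₁ k = p₁ (z₁ - z₂) := by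
          rw [← hy]
          change (π.toLinearMap.rTensor _) (LinearMap.lTensor _ _ y') = _
          rw [← LinearMap.comp_apply, ← LinearMap.comp_apply, LinearMap.rTensor_comp_lTensor,
            LinearMap.lTensor_comp_rTensor]
        have hk₂ : p₂ k = 0 := by
          change (π'.toLinearMap.lTensor _) (LinearMap.lTensor _ _ y') = _
          rw [← LinearMap.comp_apply, ← LinearMap.lTensor_comp, hex'.linearMap_comp_eq_zero]
          simp
        refine ⟨π₂ (θ (z₂ + k)), ?_⟩
        rw [ha', hb, map_add, map_add, hk₁, hk₂, map_sub, add_sub_cancel, add_zero]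
      · rintro ⟨x, hx⟩
        obtain ⟨f, rfl⟩ := hπ₂.surjective x
        obtain ⟨z, rfl⟩ := θ.toLinearEquiv.surjective f
        rw [← hx]
        change g (a (π₂ (θ z))) = 0
        rw [ha', hb, hg, hpq, sub_self]
  -- The sequence is split by `r`, so the part through an invertible lattice may be zero.
  exact HasResolution.cone hC h₂ h₃ hex (isInvertible_permRep (G := G) Y) r 0 0 fun x => by
    rw [hgr]; simp

end NormOne

end Representation

/-! ### Localizations of domains inside a field -/

section CommonLocalization

variable {k : Type*} [Field k] {E : Type*} [Field E] [Algebra k E]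
  {R : Type*} [CommRing R] [Algebra k R] {R' : Type*} [CommRing R'] [Algebra k R']

/-- `f : R → S` is the localization of a ring at the powers of the non-zero-divisor `r`. -/
structure IsAwayExtension {S : Type*} [CommRing S] [Algebra k S] (f : R →ₐ[k] S) (r : R) :
    Prop where
  injective : Function.Injective f
  isUnit : IsUnit (f r)
  exists_mul_pow_eq : ∀ x, ∃ (n : ℕ) (d : R), x * f r ^ n = f d

/-- The subalgebra `R[1/a]` of a field containing the image of `R`. -/
def awaySubalgebra (g : R →ₐ[k] E) (a : R) : Subalgebra k E where
  carrier := {x | ∃ (n : ℕ) (d : R), x * g a ^ n = g d}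
  mul_mem' := by
    rintro x y ⟨n, d, h⟩ ⟨n', d', h'⟩
    exact ⟨n + n', d * d', by rw [map_mul, ← h, ← h']; ring⟩
  add_mem' := by
    rintro x y ⟨n, d, h⟩ ⟨n', d', h'⟩
    exact ⟨n + n', d * a ^ n' + d' * a ^ n, by
      rw [map_add, map_mul, map_mul, map_pow, map_pow, ← h, ← h']; ring⟩
  algebraMap_mem' c := ⟨0, algebraMap k R c, by simp⟩

lemma range_le_awaySubalgebra (g : R →ₐ[k] E) (a : R) : g.range ≤ awaySubalgebra g a := by
  rintro _ ⟨d, rfl⟩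
  exact ⟨0, d, by simp⟩

lemma inv_mem_awaySubalgebra (g : R →ₐ[k] E) {a b : R} (ha : g a ≠ 0) (h : b ∣ a) :
    (g b)⁻¹ ∈ awaySubalgebra g a := by
  obtain ⟨c, rfl⟩ := h
  rw [map_mul, mul_ne_zero_iff] at ha
  refine ⟨1, c, ?_⟩
  rw [map_mul, pow_one, inv_mul_cancel_left₀ ha.1]

lemma awaySubalgebra_mono (g : R →ₐ[k] E) {a b : R} (h : b ∣ a) :
    awaySubalgebra g b ≤ awaySubalgebra g a := by
  obtain ⟨c, rfl⟩ := h
  rintro x ⟨n, d, h⟩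
  exact ⟨n, d * c ^ n, by rw [map_mul, map_mul, mul_pow, map_pow, ← h]; ring⟩

lemma awaySubalgebra_le (g : R →ₐ[k] E) {a : R} (ha : g a ≠ 0) {A : Subalgebra k E}
    (h : g.range ≤ A) (h' : (g a)⁻¹ ∈ A) : awaySubalgebra g a ≤ A := by
  rintro x ⟨n, d, hd⟩
  have : x = g d * (g a)⁻¹ ^ n := by
    rw [← hd, inv_pow, mul_inv_cancel_right₀ (pow_ne_zero n ha)]
  rw [this]
  exact mul_mem (h ⟨d, rfl⟩) (pow_mem h' n)

/-- The inclusion of `R` into `R[1/a]`. -/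
def toAwaySubalgebra (g : R →ₐ[k] E) (a : R) : R →ₐ[k] awaySubalgebra g a :=
  g.codRestrict _ fun d => range_le_awaySubalgebra g a ⟨d, rfl⟩

lemma isAwayExtension_toAwaySubalgebra {g : R →ₐ[k] E} (hg : Function.Injective g) {a : R}
    (ha : a ≠ 0) : IsAwayExtension (toAwaySubalgebra g a) a where
  injective x y h := hg (congrArg Subtype.val h)
  isUnit := by
    have ha' : g a ≠ 0 := (map_ne_zero_iff g hg).2 ha
    exact IsUnit.of_mul_eq_one ⟨_, inv_mem_awaySubalgebra g ha' dvd_rfl⟩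
      (Subtype.ext (mul_inv_cancel₀ ha'))
  exists_mul_pow_eq := by
    rintro ⟨x, n, d, h⟩
    exact ⟨n, d, Subtype.ext h⟩

/-- A product of denominators of finitely many generators of `R'` suffices. -/
lemma exists_range_le_awaySubalgebra [Algebra.FiniteType k R'] {g : R →ₐ[k] E} [IsDomain R]
    (hE : ∀ x, ∃ a b : R, b ≠ 0 ∧ x * g b = g a) (g' : R' →ₐ[k] E) :
    ∃ a : R, a ≠ 0 ∧ g'.range ≤ awaySubalgebra g a := by
  classical
  obtain ⟨s, hs⟩ := Algebra.FiniteType.out (R := k) (A := R')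
  choose p b hb hpb using fun y : R' => hE (g' y)
  refine ⟨∏ y ∈ s, b y, Finset.prod_ne_zero_iff.2 fun y _ => hb y, ?_⟩
  have h1 : Algebra.adjoin k (s : Set R') ≤ (awaySubalgebra g (∏ y ∈ s, b y)).comap g' := by
    refine Algebra.adjoin_le fun y hy => ?_
    exact awaySubalgebra_mono g (Finset.dvd_prod_of_mem b hy)
      ⟨1, p y, by rw [pow_one]; exact hpb y⟩
  rintro _ ⟨y, rfl⟩
  exact h1 (hs ▸ Algebra.mem_top)

/-- Two finitely generated domains with the same field of fractions have a common localization. -/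
lemma exists_awaySubalgebra_eq [Algebra.FiniteType k R] [Algebra.FiniteType k R'] [IsDomain R]
    [IsDomain R'] {g : R →ₐ[k] E} {g' : R' →ₐ[k] E} (hg : Function.Injective g)
    (hg' : Function.Injective g') (hE : ∀ x, ∃ a b : R, b ≠ 0 ∧ x * g b = g a)
    (hE' : ∀ x, ∃ a b : R', b ≠ 0 ∧ x * g' b = g' a) :
    ∃ (r : R) (r' : R'), r ≠ 0 ∧ r' ≠ 0 ∧ awaySubalgebra g r = awaySubalgebra g' r' := by
  -- Each ring lies in a localization of the other, at `a` and at `b`. Write `b = b'/aⁿ` and `a =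
  -- a'/bᵐ`; inverting `a * b'` in `R`, or `b * a'` in `R'`, makes both `a` and `b` invertible, and
  -- the two rings coincide.
  obtain ⟨a, ha, h1⟩ := exists_range_le_awaySubalgebra hE g'
  obtain ⟨b, hb, h2⟩ := exists_range_le_awaySubalgebra hE' g
  obtain ⟨n, b', hb'⟩ := h1 ⟨b, rfl⟩
  obtain ⟨m, a', ha'⟩ := h2 ⟨a, rfl⟩
  change g' b * g a ^ n = g b' at hb'
  change g a * g' b ^ m = g' a' at ha'
  have ga : g a ≠ 0 := (map_ne_zero_iff g hg).2 ha
  have gb : g' b ≠ 0 := (map_ne_zero_iff g' hg').2 hb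
  have gb' : g b' ≠ 0 := hb' ▸ mul_ne_zero gb (pow_ne_zero n ga)
  have ga' : g' a' ≠ 0 := ha' ▸ mul_ne_zero ga (pow_ne_zero m gb)
  have gab : g (a * b') ≠ 0 := by rw [map_mul]; exact mul_ne_zero ga gb'
  have gba : g' (b * a') ≠ 0 := by rw [map_mul]; exact mul_ne_zero gb ga'
  refine ⟨a * b', b * a', fun h => gab (by rw [h, map_zero]), fun h => gba (by rw [h, map_zero]),
    le_antisymm ?_ ?_⟩
  · refine awaySubalgebra_le g gab (h2.trans (awaySubalgebra_mono g' (Dvd.intro _ rfl))) ?_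
    have ib : (g' b)⁻¹ ∈ awaySubalgebra g' (b * a') :=
      inv_mem_awaySubalgebra g' gba (Dvd.intro _ rfl)
    have ia : (g a)⁻¹ ∈ awaySubalgebra g' (b * a') := by
      have : (g a)⁻¹ = g' b ^ m * (g' a')⁻¹ := by rw [← ha']; field_simp
      rw [this]
      exact mul_mem (pow_mem (range_le_awaySubalgebra g' _ ⟨b, rfl⟩) m)
        (inv_mem_awaySubalgebra g' gba (Dvd.intro_left _ rfl))
    have : (g (a * b'))⁻¹ = (g a)⁻¹ * ((g' b)⁻¹ * (g a)⁻¹ ^ n) := by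
      rw [map_mul, ← hb', mul_inv, mul_inv, inv_pow]
    rw [this]
    exact mul_mem ia (mul_mem ib (pow_mem ia n))
  · refine awaySubalgebra_le g' gba (h1.trans (awaySubalgebra_mono g (Dvd.intro _ rfl))) ?_
    have ia : (g a)⁻¹ ∈ awaySubalgebra g (a * b') :=
      inv_mem_awaySubalgebra g gab (Dvd.intro _ rfl)
    have ib : (g' b)⁻¹ ∈ awaySubalgebra g (a * b') := by
      have : (g' b)⁻¹ = g a ^ n * (g b')⁻¹ := by rw [← hb']; field_simp
      rw [this]
      exact mul_mem (pow_mem (range_le_awaySubalgebra g _ ⟨a, rfl⟩) n)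
        (inv_mem_awaySubalgebra g gab (Dvd.intro_left _ rfl))
    have : (g' (b * a'))⁻¹ = (g' b)⁻¹ * ((g a)⁻¹ * (g' b)⁻¹ ^ m) := by
      rw [map_mul, ← ha', mul_inv, mul_inv, inv_pow]
    rw [this]
    exact mul_mem ib (mul_mem ia (pow_mem ib m))

end CommonLocalization

/-! ### Units of localizations of factorial rings -/

section Units

variable {G : Type*} [Group G] {D : Type*} [CommRing D]

/-- The action on the classes of associated elements induced by an action on a ring. -/
@[reducible] def associatesAction (a : G →* (D ≃+* D)) : MulAction G (Associates D) where
  smul g := Quotient.map (a g) fun _ _ h => h.map (a g)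
  one_smul := by
    rintro ⟨x⟩
    change Associates.mk (a 1 x) = Associates.mk x
    rw [map_one]; rfl
  mul_smul g h := by
    rintro ⟨x⟩
    change Associates.mk (a (g * h) x) = Associates.mk (a g (a h x))
    rw [map_mul]; rfl

open Classical in
/-- The exponent of the class `P` of a prime element in the factorization of `d`. -/
def associatesCount [IsDomain D] [UniqueFactorizationMonoid D] (P : Associates D) (d : D) : ℤ :=
  (P.count (Associates.mk d).factors : ℕ)

section Count

variable [IsDomain D] [UniqueFactorizationMonoid D] {P : Associates D} (hP : Irreducible P)

include hP

lemma associatesCount_mul {d d' : D} (hd : d ≠ 0) (hd' : d' ≠ 0) :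
    associatesCount P (d * d') = associatesCount P d + associatesCount P d' := by
  classical
  rw [associatesCount, ← Associates.mk_mul_mk, Associates.count_mul (Associates.mk_ne_zero.2 hd)
    (Associates.mk_ne_zero.2 hd') hP]
  simp [associatesCount]

lemma associatesCount_unit (u : Dˣ) : associatesCount P (u : D) = 0 := by
  classical
  rw [associatesCount, Associates.mk_eq_one.2 u.isUnit, Associates.factors_one,
    Associates.count_zero hP]
  rfl

lemma associatesCount_pow {d : D} (hd : d ≠ 0) (n : ℕ) :
    associatesCount P (d ^ n) = n * associatesCount P d := by
  induction n with
  | zero => simpa using associatesCount_unit hP 1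
  | succ n ih =>
    rw [pow_succ, associatesCount_mul hP (pow_ne_zero n hd) hd, ih]
    push_cast
    ring

lemma associatesCount_eq_zero {d : D} (hd : d ≠ 0) (h : ¬ P ∣ Associates.mk d) :
    associatesCount P d = 0 := by
  classical
  by_contra hne
  exact h (Associates.le_of_count_ne_zero (Associates.mk_ne_zero.2 hd) hP
    fun h0 => hne (by rw [associatesCount, h0]; rfl))

lemma associatesCount_mk {p : D} (hp : Irreducible (Associates.mk p)) [Decidable (P = Associates.mk p)] :
    associatesCount P p = if P = Associates.mk p then 1 else 0 := by
  classical
  split_ifs with h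
  · subst h
    rw [associatesCount, Associates.count_self hp]; rfl
  · rw [associatesCount, Associates.count_eq_zero_of_ne hP hp h]; rfl

lemma le_associatesCount_iff {p d : D} (hpP : P = Associates.mk p) (hd : d ≠ 0) (n : ℕ) :
    (n : ℤ) ≤ associatesCount P d ↔ p ^ n ∣ d := by
  classical
  subst hpP
  rw [associatesCount, Nat.cast_le, ← Associates.prime_pow_dvd_iff_le (Associates.mk_ne_zero.2 hd)
    hP, ← Associates.mk_pow, Associates.mk_le_mk_iff_dvd]

end Count

/-- The exponent of `p` in `d` is the largest `n` with `p ^ n ∣ d`, a condition that automorphisms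
preserve. -/
lemma associatesCount_map [IsDomain D] [UniqueFactorizationMonoid D] (e : D ≃+* D) {p d : D}
    (hp : Irreducible (Associates.mk p)) (hd : d ≠ 0) :
    associatesCount (Associates.mk (e p)) (e d) = associatesCount (Associates.mk p) d := by
  have hp' : Irreducible (Associates.mk (e p)) := by
    rw [Associates.irreducible_mk] at hp ⊢
    exact (MulEquiv.irreducible_iff e).2 hp
  have key : ∀ n : ℕ, (n : ℤ) ≤ associatesCount (Associates.mk (e p)) (e d) ↔
      (n : ℤ) ≤ associatesCount (Associates.mk p) d := fun n => by
    rw [le_associatesCount_iff hp' rfl ((map_ne_zero_iff e e.injective).2 hd),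
      le_associatesCount_iff hp rfl hd, ← map_pow, map_dvd_iff]
  exact le_antisymm ((key _).1 le_rfl) ((key _).2 le_rfl)

open Classical in
/-- The units of a localization `D' = D[1/r]` of a factorial ring modulo the units of `D` form a
permutation lattice on the prime divisors of `r`. -/
lemma exists_unitsDivisor [IsDomain D] [UniqueFactorizationMonoid D] {D' : Type*} [CommRing D']
    (f : D →+* D') (hf : Function.Injective f)
    (r : D) (hr : r ≠ 0) (hu : IsUnit (f r)) (hs : ∀ x, ∃ (n : ℕ) (d : D), x * f r ^ n = f d)
    (a : G →* (D ≃+* D)) (a' : G →* (D' ≃+* D')) (ha : ∀ g d, f (a g d) = a' g (f d))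
    (har : ∀ g, a g r = r) :
    ∃ (T : Type) (_ : Finite T) (_ : MulAction G T) (v : Additive D'ˣ →+ (T → ℤ)),
      Function.Surjective v ∧
      (∀ x : D'ˣ, v (.ofMul x) = 0 ↔ ∃ u : Dˣ, x = Units.map (f : D →* D') u) ∧
      ∀ (g : G) (x : D'ˣ) (t : T), v (.ofMul (Units.map (a' g : D' →* D') x)) t =
        v (.ofMul x) (g⁻¹ • t) := by
  have hnt : Nontrivial D' := hf.nontrivial
  -- The basis of the lattice: the classes of primes that become invertible. The group permutes them
  -- because it fixes `r`.
  let T := {P : Associates D // Irreducible P ∧ P ∣ Associates.mk r}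
  have hT : Finite T := by
    have : {P : Associates D | Irreducible P ∧ P ∣ Associates.mk r} ⊆
        Associates.mk '' {p | p ∈ UniqueFactorizationMonoid.factors r} := by
      rintro ⟨p⟩ ⟨hp, hpr⟩
      change Irreducible (Associates.mk p) at hp
      change Associates.mk p ∣ _ at hpr
      rw [Associates.irreducible_mk] at hp
      rw [Associates.mk_dvd_mk] at hpr
      obtain ⟨q, hq, hpq⟩ := UniqueFactorizationMonoid.exists_mem_factors_of_dvd hr hp hpr
      exact ⟨q, hq, Associates.mk_eq_mk_iff_associated.2 hpq.symm⟩
    exact ((Multiset.finite_toSet _).image _).subset this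
  let := associatesAction a
  have smul_mk : ∀ (g : G) (p : D), g • Associates.mk p = Associates.mk (a g p) := fun _ _ => rfl
  let actT : MulAction G T :=
    { smul := fun g P => ⟨g • P.1, by
        obtain ⟨⟨p⟩, hp, hpr⟩ := P
        change Irreducible (Associates.mk p) at hp
        change Associates.mk p ∣ _ at hpr
        change Irreducible (Associates.mk (a g p)) ∧ Associates.mk (a g p) ∣ _
        rw [Associates.irreducible_mk] at hp ⊢
        rw [Associates.mk_dvd_mk] at hpr ⊢
        exact ⟨(MulEquiv.irreducible_iff (a g)).2 hp, har g ▸ map_dvd (a g) hpr⟩⟩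
      one_smul := fun P => Subtype.ext (one_smul G P.1)
      mul_smul := fun g h P => Subtype.ext (mul_smul g h P.1) }
  choose n d hnd using hs
  have hd : ∀ x : D'ˣ, d x ≠ 0 := by
    intro x h0
    have h := hnd x
    rw [h0, map_zero] at h
    exact (x.isUnit.mul (hu.pow _)).ne_zero h
  -- the divisor of a unit can be computed from any presentation as a fraction
  let w : D'ˣ → T → ℤ := fun x P => associatesCount P.1 (d x) - n x * associatesCount P.1 r
  have hw : ∀ (x : D'ˣ) (m : ℕ) (e : D), (x : D') * f r ^ m = f e → ∀ P : T,
      w x P = associatesCount P.1 e - m * associatesCount P.1 r := by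
    intro x m e h P
    have he : e ≠ 0 := by
      rintro rfl
      rw [map_zero] at h
      exact (x.isUnit.mul (hu.pow _)).ne_zero h
    have h1 : d x * r ^ m = e * r ^ n x := hf (by
      rw [map_mul, map_mul, ← h, ← hnd, map_pow, map_pow]; ring)
    have h2 := congrArg (associatesCount P.1) h1
    rw [associatesCount_mul P.2.1 (hd x) (pow_ne_zero _ hr),
      associatesCount_mul P.2.1 he (pow_ne_zero _ hr), associatesCount_pow P.2.1 hr,
      associatesCount_pow P.2.1 hr] at h2
    simp only [w]
    linarith
  have hw_mul : ∀ x y, w (x * y) = w x + w y := by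
    intro x y
    ext P
    rw [hw (x * y) (n x + n y) (d x * d y) (by
      rw [map_mul, ← hnd, ← hnd, Units.val_mul]; ring), associatesCount_mul P.2.1 (hd x) (hd y)]
    simp only [w, Pi.add_apply]
    push_cast
    ring
  let v : Additive D'ˣ →+ (T → ℤ) := AddMonoidHom.mk' (fun x => w x.toMul) fun x y =>
    hw_mul x.toMul y.toMul
  have hv : ∀ x : D'ˣ, v (.ofMul x) = w x := fun _ => rfl
  have hcount : ∀ (x : D'ˣ) (e : D), (x : D') = f e → ∀ P : T, w x P = associatesCount P.1 e := by
    intro x e h P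
    rw [hw x 0 e (by rw [pow_zero, mul_one, h])]
    simp
  have hsurj : Function.Surjective v := by
    have := Fintype.ofFinite T
    have hbasis : ∀ P : T, ∃ x, v x = Pi.single P 1 := by
      rintro ⟨⟨p⟩, hp, hpr⟩
      change Irreducible (Associates.mk p) at hp
      have hpr' : p ∣ r := Associates.mk_dvd_mk.1 hpr
      have hpu : IsUnit (f p) := isUnit_of_dvd_unit (map_dvd f hpr') hu
      refine ⟨.ofMul hpu.unit, ?_⟩
      ext P
      rw [hv, hcount _ p rfl, associatesCount_mk P.2.1 hp, Pi.single_apply]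
      exact if_congr ⟨fun h => Subtype.ext h, fun h => congrArg Subtype.val h⟩ rfl rfl
    choose b hb using hbasis
    intro c
    refine ⟨∑ P, c P • b P, ?_⟩
    rw [map_sum]
    simp only [map_zsmul, hb]
    ext P
    rw [Finset.sum_apply, Finset.sum_eq_single P] <;> simp +contextual [eq_comm]
  have hker : ∀ x : D'ˣ, v (.ofMul x) = 0 ↔ ∃ u : Dˣ, x = Units.map (f : D →* D') u := by
    intro x
    rw [hv]
    constructor
    · intro hx
      -- The numerators of `x` and `x⁻¹` multiply to a power of `r`, so no prime outside `r` divides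
      -- them. With trivial divisor, the numerator is therefore associated to the denominator.
      have hdiv : ∀ P : Associates D, Irreducible P → P ∣ Associates.mk (d x) →
          P ∣ Associates.mk r := by
        intro P hP h
        have h1 : d x * d x⁻¹.1 = r ^ (n x + n x⁻¹.1) := hf (by
          rw [map_mul, ← hnd, ← hnd, map_pow, pow_add, mul_mul_mul_comm, Units.mul_inv, one_mul])
        have h2 : P ∣ Associates.mk r ^ (n x + n x⁻¹.1) := by
          rw [← Associates.mk_pow, ← h1, ← Associates.mk_mul_mk]
          exact Dvd.dvd.mul_right h _
        exact hP.prime.dvd_of_dvd_pow h2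
      have h3 : Associates.mk (d x) = Associates.mk (r ^ n x) := by
        refine Associates.eq_of_eq_counts (Associates.mk_ne_zero.2 (hd x))
          (Associates.mk_ne_zero.2 (pow_ne_zero _ hr)) fun P hP => ?_
        have : associatesCount P (d x) = associatesCount P (r ^ n x) := by
          by_cases hPr : P ∣ Associates.mk r
          · have := congrFun hx ⟨P, hP, hPr⟩
            rw [associatesCount_pow hP hr]
            simp only [w, Pi.zero_apply] at this
            linarith
          · rw [associatesCount_eq_zero hP (hd x) (fun h => hPr (hdiv P hP h)),
              associatesCount_pow hP hr, associatesCount_eq_zero hP hr hPr, mul_zero]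
        simpa [associatesCount] using this
      obtain ⟨u, hu'⟩ := Associates.mk_eq_mk_iff_associated.1 h3.symm
      refine ⟨u, Units.ext ?_⟩
      have h4 := hnd x
      rw [← hu', map_mul, map_pow, mul_comm] at h4
      exact (hu.pow _).mul_left_cancel h4
    · rintro ⟨u, rfl⟩
      ext P
      rw [hcount _ u rfl, associatesCount_unit P.2.1]
      rfl
  have hequiv : ∀ (g : G) (x : D'ˣ) (t : T), v (.ofMul (Units.map (a' g : D' →* D') x)) t =
      v (.ofMul x) (g⁻¹ • t) := by
    intro g x P
    rw [hv, hv, hw _ (n x) (a g (d x)) (by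
      rw [ha, ← hnd, map_mul, map_pow, ← ha, har]; rfl)]
    obtain ⟨P', rfl⟩ : ∃ P', g • P' = P := ⟨g⁻¹ • P, smul_inv_smul g P⟩
    rw [inv_smul_smul]
    obtain ⟨⟨p⟩, hp, hpr⟩ := P'
    change associatesCount (Associates.mk (a g p)) (a g (d x)) -
      n x * associatesCount (Associates.mk (a g p)) r = associatesCount (Associates.mk p) (d x) -
      n x * associatesCount (Associates.mk p) r
    rw [associatesCount_map _ hp (hd x)]
    conv_lhs => rw [← har g, associatesCount_map _ hp hr]
  -- The prime classes live in the universe of `D`; reindexing gives a `G`-set in `Type`.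
  obtain ⟨m, ⟨e⟩⟩ := Finite.exists_equiv_fin T
  let : MulAction G (Fin m) := e.symm.mulAction G
  refine ⟨Fin m, inferInstance, inferInstance,
    (LinearEquiv.funCongrLeft ℤ ℤ e.symm).toAddEquiv.toAddMonoidHom.comp v,
    (LinearEquiv.funCongrLeft ℤ ℤ e.symm).surjective.comp hsurj, fun x => ?_, fun g x t => ?_⟩
  · rw [← hker]
    change LinearEquiv.funCongrLeft ℤ ℤ e.symm (v (.ofMul x)) = 0 ↔ _
    exact (LinearEquiv.funCongrLeft ℤ ℤ e.symm).map_eq_zero_iff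
  · change v (.ofMul (Units.map (a' g : D' →* D') x)) (e.symm t) =
      v (.ofMul x) (e.symm (e (g⁻¹ • e.symm t)))
    rw [e.symm_apply_apply, hequiv]

end Units

/-! ### Resolutions from groups of units. -/

namespace Representation

section UnitsResolution

variable {G : Type*} [Group G]

/-- The image of a homomorphism of representations, as a representation. -/
def rangeRep {V W : Type*} [AddCommGroup V] [AddCommGroup W] {μ : Representation ℤ G V}
    {ν : Representation ℤ G W} (j : IntertwiningMap μ ν) :
    Representation ℤ G j.toLinearMap.toAddMonoidHom.range where
  toFun g := AddMonoidHom.toIntLinearMap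
    { toFun := fun x => ⟨ν g x.1, by
        obtain ⟨_, x, rfl⟩ := x
        exact ⟨μ g x, IntertwiningMap.isIntertwining _ _ j g x⟩⟩
      map_zero' := Subtype.ext (map_zero _)
      map_add' := fun x y => Subtype.ext (map_add _ _ _) }
  map_one' := LinearMap.ext fun x => Subtype.ext (by
    change ν 1 x.1 = x.1
    rw [map_one]; rfl)
  map_mul' g h := LinearMap.ext fun x => Subtype.ext (by
    change ν (g * h) x.1 = ν g (ν h x.1)
    rw [map_mul]; rfl)

variable {M W W' : Type*} [AddCommGroup M] [AddCommGroup W] [AddCommGroup W']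
  {ρ : Representation ℤ G M} {μ : Representation ℤ G W} {ν : Representation ℤ G W'}
  {S T : Type} [Finite S] [MulAction G S] [Finite T] [MulAction G T]
  {φ : IntertwiningMap μ ν} {ψ : IntertwiningMap ν μ} {m : IntertwiningMap ρ μ}
  {v : IntertwiningMap μ (permRep G S)} {v' : IntertwiningMap ν (permRep G T)}
  {K : AddSubgroup W} {K' : AddSubgroup W'}

/-- In the application `μ` and `ν` are unit groups of two localized rings and `K`, `K'` are their
constants. Then `ν/K' ≃ ℤ[T]`, and the retraction makes `μ/K` a direct summand of it, or all of it
when `φ` is surjective. The sequence `0 → ρ → μ/K → ℤ[S] → 0` is the resolution. -/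
lemma HasResolution.of_units (hψφ : ∀ x, ψ (φ x) = x) (hφ : ∀ x ∈ K, φ x ∈ K')
    (hψ : ∀ x ∈ K', ψ x ∈ K) (hvs : Function.Surjective v) (hvs' : Function.Surjective v')
    (hv' : ∀ x, v' x = 0 ↔ x ∈ K') (hv : ∀ x, v x = 0 ↔ ∃ y, x - m y ∈ K)
    (hm : ∀ y, m y ∈ K → y = 0) :
    HasResolution (fun _ _ (ρ : Representation ℤ G _) => IsInvertible ρ) ρ ∧
      (Function.Surjective φ →
        HasResolution (fun _ _ (ρ : Representation ℤ G _) => IsStablyPerm ρ) ρ) := by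
  let j := v'.comp φ
  have hj : ∀ x, j x = v' (φ x) := fun _ => rfl
  have hj0 : ∀ x, j x = 0 ↔ x ∈ K := fun x => by
    rw [hj, hv']
    exact ⟨fun h => hψφ x ▸ hψ _ h, hφ x⟩
  -- The endomorphism `φ ψ` descends to `ℤ[T]` as a projection `e` onto the image of `j`, which is a
  -- copy of `μ/K`.
  obtain ⟨e, he⟩ := IntertwiningMap.exists_factor v' hvs' (j.comp ψ) fun x hx =>
    (hj0 _).2 (hψ _ ((hv' x).1 hx))
  have hej : ∀ x, e (j x) = j x := fun x => by
    rw [hj, he]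
    change j (ψ (φ x)) = _
    rw [hψφ, hj]
  let jr : IntertwiningMap μ (rangeRep j) := IntertwiningMap.ofAddHom
    j.toLinearMap.toAddMonoidHom.rangeRestrict fun g x =>
      Subtype.ext (IntertwiningMap.isIntertwining _ _ j g x)
  have hjr : ∀ x, (jr x).1 = j x := fun _ => rfl
  have hjrs : Function.Surjective jr := by
    rintro ⟨_, x, rfl⟩
    exact ⟨x, rfl⟩
  have hjr0 : ∀ x, jr x = 0 ↔ x ∈ K := fun x => by
    rw [← hj0, ← hjr]
    exact ⟨fun h => by rw [h]; rfl, fun h => Subtype.ext h⟩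
  have hvK : ∀ x ∈ K, v x = 0 := fun x hx => (hv x).2 ⟨0, by rwa [map_zero, sub_zero]⟩
  -- For any model of `μ/K`, the classes of units coming from `ρ` are exactly the kernel of the
  -- divisor map `v`.
  have exact_of : ∀ {U : Type} [AddCommGroup U] {τ : Representation ℤ G U}
      (f : IntertwiningMap μ τ), Function.Surjective f → (∀ x, f x = 0 ↔ x ∈ K) →
      ∃ (i : IntertwiningMap ρ τ) (q : IntertwiningMap τ (permRep G S)), IsShortExact i q := by
    intro U _ τ f hf hf0
    obtain ⟨q, hq⟩ := IntertwiningMap.exists_factor f hf v fun x hx => hvK x ((hf0 x).1 hx)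
    refine ⟨f.comp m, q, ?_, ?_, ?_⟩
    · rw [injective_iff_map_eq_zero]
      intro y hy
      exact hm y ((hf0 _).1 hy)
    · intro s
      obtain ⟨x, rfl⟩ := hvs s
      exact ⟨f x, hq x⟩
    · intro u
      obtain ⟨x, rfl⟩ := hf u
      rw [hq, hv]
      refine exists_congr fun y => ?_
      rw [← hf0, map_sub, sub_eq_zero, eq_comm]
      rfl
  constructor
  · obtain ⟨i, q, hiq⟩ := exact_of jr hjrs hjr0
    refine ⟨_, _, _, _, _, _, i, q, hiq, ?_, IsInvertible.perm S⟩
    refine ⟨T, inferInstance, inferInstance, IntertwiningMap.ofAddHom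
      (AddSubgroup.subtype _) fun g x => rfl, IntertwiningMap.ofAddHom
      (AddMonoidHom.codRestrict e.toLinearMap.toAddMonoidHom _ fun t => ?_) fun g t =>
        Subtype.ext (IntertwiningMap.isIntertwining _ _ e g t), ?_⟩
    · obtain ⟨x, rfl⟩ := hvs' t
      exact ⟨ψ x, (he x).symm⟩
    · rintro ⟨_, x, rfl⟩
      exact Subtype.ext (hej x)
  · intro hφs
    obtain ⟨i, q, hiq⟩ := exact_of j (hvs'.comp hφs) hj0
    exact ⟨_, _, _, _, _, _, i, q, hiq, IsStablyPerm.perm T, IsStablyPerm.perm S⟩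

/-- The units of a ring with an action of a group, as a representation. -/
def unitsRep {D : Type*} [CommRing D] (a : G →* (D ≃+* D)) :
    Representation ℤ G (Additive Dˣ) where
  toFun g := (MonoidHom.toAdditive (Units.map (a g : D →* D))).toIntLinearMap
  map_one' := LinearMap.ext fun x => Units.ext (by
    change a 1 x.toMul.1 = x.toMul.1
    rw [map_one]; rfl)
  map_mul' g h := LinearMap.ext fun x => Units.ext (by
    change a (g * h) x.toMul.1 = a g (a h x.toMul.1)
    rw [map_mul]; rfl)

variable {D D' : Type*} [CommRing D] [CommRing D']

/-- The homomorphism between the units of two rings induced by an equivariant homomorphism. -/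
def unitsRepMap {a : G →* (D ≃+* D)} {a' : G →* (D' ≃+* D')} (f : D →+* D')
    (hf : ∀ g d, f (a g d) = a' g (f d)) : IntertwiningMap (unitsRep a) (unitsRep a') :=
  IntertwiningMap.ofAddHom (MonoidHom.toAdditive (Units.map (f : D →* D')))
    fun g x => Units.ext (hf g x.toMul.1)

end UnitsResolution

end Representation

/-! ### The Galois action on units after base change. -/

section GaloisTensor

variable {k : Type*} [Field k] (L : Type*) [Field L] [Algebra k L]

/-- The action of the automorphisms of `L` on the first factor of `L ⊗ R`. -/
def galoisTensor (R : Type*) [CommRing R] [Algebra k R] : (L ≃ₐ[k] L) →* (L ⊗[k] R ≃+* L ⊗[k] R) where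
  toFun σ := (Algebra.TensorProduct.congr σ (AlgEquiv.refl (R := k) (A₁ := R))).toRingEquiv
  map_one' := by
    ext x
    change Algebra.TensorProduct.map (AlgHom.id k L) (AlgHom.id k R) x = x
    rw [Algebra.TensorProduct.map_id]; rfl
  map_mul' σ τ := by
    ext x
    induction x using TensorProduct.induction_on with
    | zero => simp
    | add x y hx hy => rw [map_add, map_add, hx, hy]
    | tmul a r => simp

variable {R S C : Type*} [CommRing R] [Algebra k R] [CommRing S] [Algebra k S]
  [CommRing C] [Algebra k C]

@[simp]
lemma galoisTensor_tmul (σ : L ≃ₐ[k] L) (a : L) (r : R) :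
    galoisTensor L R σ (a ⊗ₜ r) = σ a ⊗ₜ r := rfl

lemma map_galoisTensor (f : R →ₐ[k] S) (σ : L ≃ₐ[k] L) (x : L ⊗[k] R) :
    Algebra.TensorProduct.map (AlgHom.id L L) f (galoisTensor L R σ x) =
      galoisTensor L S σ (Algebra.TensorProduct.map (AlgHom.id L L) f x) := by
  induction x using TensorProduct.induction_on with
  | zero => simp
  | add x y hx hy => simp only [map_add, hx, hy]
  | tmul a r => simp

/-- The constant units of `L ⊗ R`. -/
def constUnits (R : Type*) [CommRing R] [Algebra k R] : Lˣ →* (L ⊗[k] R)ˣ :=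
  Units.map (Algebra.TensorProduct.includeLeft (R := k) (S := k) (A := L) (B := R) : L →* L ⊗[k] R)

lemma map_constUnits (f : R →ₐ[k] S) (c : Lˣ) :
    Units.map (Algebra.TensorProduct.map (AlgHom.id L L) f : L ⊗[k] R →* L ⊗[k] S)
      (constUnits L R c) = constUnits L S c :=
  Units.ext (by simp [constUnits])

lemma map_id_injective {f : R →ₐ[k] S} (hf : Function.Injective f) :
    Function.Injective (Algebra.TensorProduct.map (AlgHom.id L L) f) :=
  Module.Flat.lTensor_preserves_injective_linearMap (M := L) f.toLinearMap hf

-- Base change turns `S` into the localization of `L ⊗ R` at `1 ⊗ r`, which the Galois group fixes,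
-- so the divisor map is equivariant. An element of `L ⊗ S` has finitely many terms and hence a
-- common denominator.
open Representation in
lemma IsAwayExtension.exists_unitsDivisor {f : R →ₐ[k] S} {r : R} (hf : IsAwayExtension f r)
    (hr : r ≠ 0) [IsDomain (L ⊗[k] R)] [UniqueFactorizationMonoid (L ⊗[k] R)] :
    ∃ (T : Type) (_ : Finite T) (_ : MulAction (L ≃ₐ[k] L) T)
      (v : IntertwiningMap (unitsRep (galoisTensor L S)) (permRep (L ≃ₐ[k] L) T)),
      Function.Surjective v ∧ ∀ x : (L ⊗[k] S)ˣ, v (.ofMul x) = 0 ↔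
        ∃ u, x = Units.map (Algebra.TensorProduct.map (AlgHom.id L L) f : L ⊗[k] R →* L ⊗[k] S) u := by
  have hone : ∀ x : R, Algebra.TensorProduct.map (AlgHom.id L L) f (1 ⊗ₜ x) = 1 ⊗ₜ f x := by simp
  obtain ⟨T, hT, aT, v, hv, hv0, hvg⟩ := _root_.exists_unitsDivisor
    (Algebra.TensorProduct.map (AlgHom.id L L) f : L ⊗[k] R →+* L ⊗[k] S)
    (map_id_injective L hf.injective) (1 ⊗ₜ r)
    (fun h => hr (Algebra.TensorProduct.includeRight_injective (R := k) (A := L) (B := R)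
      (algebraMap k L).injective (by simpa using h)))
    (by
      change IsUnit (Algebra.TensorProduct.map (AlgHom.id L L) f (1 ⊗ₜ r))
      rw [hone]
      exact hf.isUnit.map (Algebra.TensorProduct.includeRight : S →ₐ[k] L ⊗[k] S))
    (by
      change ∀ x, ∃ (n : ℕ) (d : L ⊗[k] R), x * Algebra.TensorProduct.map (AlgHom.id L L) f (1 ⊗ₜ r) ^ n =
        Algebra.TensorProduct.map (AlgHom.id L L) f d
      intro x
      induction x using TensorProduct.induction_on with
      | zero => exact ⟨0, 0, by simp⟩
      | tmul a s =>
        obtain ⟨n, d, hd⟩ := hf.exists_mul_pow_eq s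
        exact ⟨n, a ⊗ₜ d, by simp [hd]⟩
      | add x y hx hy =>
        obtain ⟨n, d, hd⟩ := hx
        obtain ⟨n', d', hd'⟩ := hy
        refine ⟨n + n', d * (1 ⊗ₜ r) ^ n' + d' * (1 ⊗ₜ r) ^ n, ?_⟩
        rw [map_add, map_mul, map_mul, map_pow, map_pow, ← hd, ← hd']
        ring)
    (galoisTensor L R) (galoisTensor L S) (map_galoisTensor L f) (fun σ => by simp)
  exact ⟨T, hT, aT, IntertwiningMap.ofAddHom v fun g x => funext fun t => hvg g x.toMul t, hv, hv0⟩

open Representation in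
/-- A torus whose coordinate ring is, up to localizations and polynomial rings, a retract of a
polynomial ring has a resolution of its character lattice. -/
lemma Representation.HasResolution.of_isAwayExtension {R₁ R₂ : Type*} [CommRing R₁] [Algebra k R₁]
    [CommRing R₂] [Algebra k R₂] [IsDomain (L ⊗[k] R₁)] [UniqueFactorizationMonoid (L ⊗[k] R₁)]
    [IsDomain (L ⊗[k] R₂)] [UniqueFactorizationMonoid (L ⊗[k] R₂)]
    {f₁ : R₁ →ₐ[k] S} {r₁ : R₁} (h₁ : IsAwayExtension f₁ r₁) (hr₁ : r₁ ≠ 0)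
    {f₂ : R₂ →ₐ[k] C} {r₂ : R₂} (h₂ : IsAwayExtension f₂ r₂) (hr₂ : r₂ ≠ 0)
    (φ : S →ₐ[k] C) (ψ : C →ₐ[k] S) (hψφ : ∀ x, ψ (φ x) = x)
    {M : Type*} [AddCommGroup M] {ρ : Representation ℤ (L ≃ₐ[k] L) M}
    (m : IntertwiningMap ρ (unitsRep (galoisTensor L R₁)))
    (hm : ∀ u : (L ⊗[k] R₁)ˣ, ∃ y c, u = (m y).toMul * constUnits L R₁ c)
    (hm' : ∀ y c, m y = .ofMul (constUnits L R₁ c) → y = 0)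
    (hu : ∀ u : (L ⊗[k] R₂)ˣ, ∃ c, u = constUnits L R₂ c) :
    HasResolution (fun _ _ (ρ : Representation ℤ (L ≃ₐ[k] L) _) => IsInvertible ρ) ρ ∧
      (Function.Surjective φ →
        HasResolution (fun _ _ (ρ : Representation ℤ (L ≃ₐ[k] L) _) => IsStablyPerm ρ) ρ) := by
  obtain ⟨T₁, _, _, v₁, hv₁, hv₁'⟩ := h₁.exists_unitsDivisor L hr₁
  obtain ⟨T₂, _, _, v₂, hv₂, hv₂'⟩ := h₂.exists_unitsDivisor L hr₂
  have hmap : ∀ x, Algebra.TensorProduct.map (AlgHom.id L L) ψ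
      (Algebra.TensorProduct.map (AlgHom.id L L) φ x) = x := fun x => by
    induction x using TensorProduct.induction_on with
    | zero => simp
    | add x y hx hy => simp only [map_add, hx, hy]
    | tmul a r => simp [hψφ]
  have h := HasResolution.of_units (ρ := ρ)
    (φ := unitsRepMap (Algebra.TensorProduct.map (AlgHom.id L L) φ : L ⊗[k] S →+* L ⊗[k] C)
      (map_galoisTensor L φ))
    (ψ := unitsRepMap (Algebra.TensorProduct.map (AlgHom.id L L) ψ : L ⊗[k] C →+* L ⊗[k] S)
      (map_galoisTensor L ψ))
    (m := (unitsRepMap (Algebra.TensorProduct.map (AlgHom.id L L) f₁ : L ⊗[k] R₁ →+* L ⊗[k] S)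
      (map_galoisTensor L f₁)).comp m) (v := v₁) (v' := v₂)
    (K := (MonoidHom.toAdditive (constUnits L S)).range)
    (K' := (MonoidHom.toAdditive (constUnits L C)).range)
    (fun x => Units.ext (hmap x.toMul.1))
    (by
      rintro _ ⟨c, rfl⟩
      exact ⟨c, (map_constUnits L φ c.toMul).symm⟩)
    (by
      rintro _ ⟨c, rfl⟩
      exact ⟨c, (map_constUnits L ψ c.toMul).symm⟩)
    hv₁ hv₂
    (by
      intro x
      refine (hv₂' x.toMul).trans ⟨?_, ?_⟩
      · rintro ⟨u, hu'⟩
        obtain ⟨c, rfl⟩ := hu u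
        exact ⟨.ofMul c, ((hu'.trans (map_constUnits L f₂ c))).symm⟩
      · rintro ⟨c, rfl⟩
        exact ⟨constUnits L R₂ c.toMul, (map_constUnits L f₂ c.toMul).symm⟩)
    (by
      intro x
      refine (hv₁' x.toMul).trans ⟨?_, ?_⟩
      · rintro ⟨u, hu'⟩
        obtain ⟨y, c, rfl⟩ := hm u
        refine ⟨y, .ofMul c, ?_⟩
        rw [eq_sub_iff_add_eq, add_comm]
        change _ = Additive.ofMul x.toMul
        rw [hu', map_mul, map_constUnits]
        rfl
      · rintro ⟨y, c, h⟩
        refine ⟨(m y).toMul * constUnits L R₁ c.toMul, ?_⟩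
        rw [eq_sub_iff_add_eq, add_comm] at h
        rw [map_mul, map_constUnits, ← h]
        rfl)
    (by
      rintro y ⟨c, h⟩
      refine hm' y c.toMul (Units.ext (map_id_injective L h₁.injective ?_))
      have h1 := congrArg Units.val (map_constUnits L f₁ c.toMul)
      exact (congrArg (fun z => (Additive.toMul z).1) h).symm.trans h1.symm)
  refine ⟨h.1, fun hφ => h.2 ?_⟩
  have hmap' : ∀ x, Algebra.TensorProduct.map (AlgHom.id L L) φ
      (Algebra.TensorProduct.map (AlgHom.id L L) ψ x) = x := fun x => by
    induction x using TensorProduct.induction_on with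
    | zero => simp
    | add x y hx hy => simp only [map_add, hx, hy]
    | tmul a r =>
      obtain ⟨s, rfl⟩ := hφ r
      simp [hψφ]
  intro x
  exact ⟨.ofMul (Units.map (Algebra.TensorProduct.map (AlgHom.id L L) ψ : L ⊗[k] C →* L ⊗[k] S)
    x.toMul), Units.ext (hmap' x.toMul.1)⟩

end GaloisTensor

/-! ### Group algebras of lattices -/

namespace AddMonoidAlgebra

variable {L : Type*} [Field L] {M : Type*} [AddCommGroup M]

/-- If `x * y = 1` and the supports are not both single points, two distinct pairs of exponents have
sums that arise only once. No cancellation happens there, so both sums must be the exponent `0` of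
`1`, contradicting uniqueness. -/
lemma exists_eq_single_of_isUnit [TwoUniqueSums M] {x : AddMonoidAlgebra L M} (hx : IsUnit x) :
    ∃ m c, c ≠ 0 ∧ x = single m c := by
  classical
  obtain ⟨y, hxy⟩ := hx.exists_right_inv
  have hx0 : x.coeff.support.Nonempty := by
    rw [Finsupp.support_nonempty_iff]
    intro h
    have h0 : x = 0 := AddMonoidAlgebra.ext (by simp [h])
    rw [h0, zero_mul] at hxy
    exact zero_ne_one hxy
  have hy0 : y.coeff.support.Nonempty := by
    rw [Finsupp.support_nonempty_iff]
    intro h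
    have h0 : y = 0 := AddMonoidAlgebra.ext (by simp [h])
    rw [h0, mul_zero] at hxy
    exact zero_ne_one hxy
  have key : ∀ p ∈ x.coeff.support ×ˢ y.coeff.support,
      UniqueAdd x.coeff.support y.coeff.support p.1 p.2 → p.1 + p.2 = 0 := by
    intro p hp hu
    have h := coeff_mul_add_of_uniqueAdd hu
    rw [hxy, one_def, coeff_single] at h
    rw [Finset.mem_product, Finsupp.mem_support_iff, Finsupp.mem_support_iff] at hp
    by_contra hne
    rw [Finsupp.single_eq_of_ne hne] at h
    exact mul_ne_zero hp.1 hp.2 h.symm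
  have hcard : x.coeff.support.card * y.coeff.support.card ≤ 1 := by
    by_contra! h
    obtain ⟨p, hp, q, hq, hne, hpu, hqu⟩ := TwoUniqueSums.uniqueAdd_of_one_lt_card h
    rw [Finset.mem_product] at hp hq
    have h1 := key p (Finset.mem_product.2 hp) hpu
    have h2 := key q (Finset.mem_product.2 hq) hqu
    have h3 := hpu hq.1 hq.2 (h2.trans h1.symm)
    exact hne (Prod.ext h3.1.symm h3.2.symm)
  have h1 : x.coeff.support.card = 1 := by
    have := hx0.card_pos
    have := hy0.card_pos
    nlinarith
  obtain ⟨m, hm, h⟩ := Finsupp.card_support_eq_one.1 h1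
  exact ⟨m, x.coeff m, hm, AddMonoidAlgebra.ext (by rw [coeff_single]; exact h)⟩

variable (M) in
lemma twoUniqueSums_of_free [Module.Free ℤ M] [Module.Finite ℤ M] : TwoUniqueSums M :=
  ((Module.Free.chooseBasis ℤ M).equivFun.toAddEquiv).twoUniqueSums_iff.2 inferInstance

variable (L M) in
lemma isDomain_of_free [Module.Free ℤ M] [Module.Finite ℤ M] : IsDomain (AddMonoidAlgebra L M) := by
  have := twoUniqueSums_of_free M
  have : NoZeroDivisors (AddMonoidAlgebra L M) := inferInstance
  exact NoZeroDivisors.to_isDomain _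

/-- The inclusion of exponents of monomials into exponents of Laurent monomials. -/
def exponentHom (d : Type*) : (d →₀ ℕ) →+ (d → ℤ) where
  toFun n i := n i
  map_zero' := rfl
  map_add' _ _ := funext fun _ => Nat.cast_add _ _

/-- The inclusion of polynomials into Laurent polynomials. -/
def laurentMap (L : Type*) [Field L] (d : Type*) :
    MvPolynomial d L →ₐ[L] AddMonoidAlgebra L (d → ℤ) := mapDomainAlgHom L L (exponentHom d)

lemma laurentMap_injective (d : Type*) : Function.Injective (laurentMap L d) :=
  mapDomain_injective fun _ _ h => Finsupp.ext fun i => Nat.cast_injective (R := ℤ) (congrFun h i)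

lemma laurentMap_monomial {d : Type*} (n : d →₀ ℕ) (c : L) :
    laurentMap L d (MvPolynomial.monomial n c) = single (exponentHom d n) c := mapDomain_single

lemma laurentMap_X {d : Type*} [DecidableEq d] (i : d) :
    laurentMap L d (MvPolynomial.X i) = single (Pi.single i 1) 1 := by
  refine (laurentMap_monomial _ _).trans ?_
  congr 1
  ext j
  simp [exponentHom, Finsupp.single_apply, Pi.single_apply, eq_comm]

lemma laurentMap_prod_X (d : Type*) [Fintype d] :
    laurentMap L d (∏ i, MvPolynomial.X i) = single (fun _ => 1) 1 := by
  classical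
  have h : (∏ i, MvPolynomial.X i : MvPolynomial d L) =
      MvPolynomial.monomial (Finsupp.equivFunOnFinite.symm fun _ => 1) 1 := by
    rw [MvPolynomial.monomial_eq]
    simp [Finsupp.prod_fintype]
  rw [h, laurentMap_monomial]
  rfl

lemma exists_mul_pow_eq_laurentMap {d : Type*} [Fintype d] (x : AddMonoidAlgebra L (d → ℤ)) :
    ∃ (N : ℕ) (p : MvPolynomial d L), x * single (fun _ => 1) 1 ^ N = laurentMap L d p := by
  induction x using induction_linear with
  | zero => exact ⟨0, 0, by rw [zero_mul, map_zero]⟩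
  | add x y hx hy =>
    obtain ⟨n, p, h⟩ := hx
    obtain ⟨n', p', h'⟩ := hy
    refine ⟨n + n', p * (∏ i, MvPolynomial.X i) ^ n' + p' * (∏ i, MvPolynomial.X i) ^ n, ?_⟩
    rw [map_add, map_mul, map_mul, map_pow, map_pow, laurentMap_prod_X, ← h, ← h']
    ring
  | single m c =>
    -- The sum of the negative parts bounds each of them, so adding `N` to every exponent makes all
    -- of them nonnegative.
    let N := ∑ i, (-m i).toNat
    refine ⟨N, MvPolynomial.monomial
      (Finsupp.equivFunOnFinite.symm fun i => (m i + N).toNat) c, ?_⟩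
    rw [laurentMap_monomial, single_pow, single_mul_single, one_pow, mul_one]
    congr 1
    ext i
    have h : (-m i).toNat ≤ N :=
      Finset.single_le_sum (f := fun i => (-m i).toNat) (fun _ _ => Nat.zero_le _)
        (Finset.mem_univ i)
    change m i + (N • fun _ => (1 : ℤ)) i = ((m i + N).toNat : ℤ)
    rw [Pi.smul_apply, nsmul_eq_mul, mul_one]
    omega

/-- Laurent polynomials are a localization of polynomials. -/
lemma uniqueFactorizationMonoid_pi (L : Type*) [Field L] (d : Type*) [Fintype d] :
    UniqueFactorizationMonoid (AddMonoidAlgebra L (d → ℤ)) := by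
  let : Algebra (MvPolynomial d L) (AddMonoidAlgebra L (d → ℤ)) := (laurentMap L d).toAlgebra
  have h0 : ∀ n, algebraMap (MvPolynomial d L) (AddMonoidAlgebra L (d → ℤ))
      ((∏ i, MvPolynomial.X i) ^ n) = single (fun _ => 1) 1 ^ n := fun n => by
    rw [map_pow]
    exact congrArg (· ^ n) (laurentMap_prod_X d)
  have hloc : IsLocalization (Submonoid.powers (∏ i, MvPolynomial.X i : MvPolynomial d L))
      (AddMonoidAlgebra L (d → ℤ)) :=
    { map_units := by
        rintro ⟨_, n, rfl⟩
        change IsUnit (algebraMap _ _ ((∏ i, MvPolynomial.X i) ^ n))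
        rw [h0]
        refine (IsUnit.of_mul_eq_one (single (-fun _ => 1) 1) ?_).pow n
        rw [single_mul_single, add_neg_cancel, one_mul, one_def]
      surj := fun x => by
        obtain ⟨n, p, h⟩ := exists_mul_pow_eq_laurentMap x
        exact ⟨(p, ⟨_, n, rfl⟩), by rw [← h0] at h; exact h⟩
      exists_of_eq := fun {x y} h => ⟨1, by rw [laurentMap_injective d h]⟩ }
  exact UniqueFactorizationMonoid.of_isLocalization
    (Submonoid.powers (∏ i, MvPolynomial.X i : MvPolynomial d L)) _

variable (L M) in
lemma uniqueFactorizationMonoid_of_free [Module.Free ℤ M] [Module.Finite ℤ M] :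
    UniqueFactorizationMonoid (AddMonoidAlgebra L M) :=
  (domCongr L L (Module.Free.chooseBasis ℤ M).equivFun.toAddEquiv).symm.toMulEquiv
    |>.uniqueFactorizationMonoid (uniqueFactorizationMonoid_pi L _)

/-- The action on `L[M]` given by an automorphism of `L` and an endomorphism of `M`. -/
def semilinearMap (k : Type*) [Field k] [Algebra k L] (σ : L ≃ₐ[k] L) (f : M →ₗ[ℤ] M) :
    AddMonoidAlgebra L M →ₐ[k] AddMonoidAlgebra L M :=
  (mapDomainAlgHom k L f.toAddMonoidHom).comp (mapAlgHom M σ.toAlgHom)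

lemma semilinearMap_single {k : Type*} [Field k] [Algebra k L] (σ : L ≃ₐ[k] L) (f : M →ₗ[ℤ] M)
    (m : M) (c : L) : semilinearMap k σ f (single m c) = single (f m) (σ c) := by
  rw [semilinearMap, AlgHom.comp_apply, mapAlgHom_single]
  exact mapDomain_single

end AddMonoidAlgebra

/-! ### The character lattice of a rational torus -/

section Rational

variable {k : Type*} [Field k] {L : Type*} [Field L] [Algebra k L]

lemma constUnits_eq (R : Type*) [CommRing R] [Algebra k R] (c : Lˣ) :
    ((constUnits L R c : (L ⊗[k] R)ˣ) : L ⊗[k] R) = algebraMap L (L ⊗[k] R) c := rfl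

/-- The units of polynomial rings over a field are constant. -/
lemma exists_eq_constUnits (b : ℕ) (u : (L ⊗[k] MvPolynomial (Fin b) k)ˣ) :
    ∃ c, u = constUnits L (MvPolynomial (Fin b) k) c := by
  have h := u.isUnit.map (MvPolynomial.algebraTensorAlgEquiv (σ := Fin b) k L)
  rw [MvPolynomial.isUnit_iff_eq_C_of_isReduced] at h
  obtain ⟨c, hc, h⟩ := h
  refine ⟨hc.unit, Units.ext ((MvPolynomial.algebraTensorAlgEquiv (σ := Fin b) k L).injective ?_)⟩
  rw [h, constUnits_eq, AlgEquiv.commutes]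
  rfl


variable {M : Type*} [AddCommGroup M] {H : Type*} [CommRing H] [Algebra k H]

open AddMonoidAlgebra Representation

/-- The monomials of the group algebra as units of an algebra split by `L`. -/
def monomialUnits {ρ : Representation ℤ (L ≃ₐ[k] L) M} (e : (L ⊗[k] H) ≃ₐ[L] AddMonoidAlgebra L M)
    (he : ∀ σ x, e (galoisTensor L H σ x) = semilinearMap k σ (ρ σ) (e x)) :
    IntertwiningMap ρ (unitsRep (galoisTensor L H)) :=
  IntertwiningMap.ofAddHom
    { toFun := fun y => .ofMul
        { val := e.symm (single y 1)
          inv := e.symm (single (-y) 1)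
          val_inv := by
            rw [← map_mul, single_mul_single, add_neg_cancel, one_mul, ← one_def, map_one]
          inv_val := by
            rw [← map_mul, single_mul_single, neg_add_cancel, one_mul, ← one_def, map_one] }
      map_zero' := Units.ext (by
        change e.symm (single 0 1) = 1
        rw [← one_def, map_one])
      map_add' := fun x y => Units.ext (by
        change e.symm (single (x + y) 1) = e.symm (single x 1) * e.symm (single y 1)
        rw [← map_mul, single_mul_single, one_mul]) }
    fun σ y => Units.ext (by
      change e.symm (single (ρ σ y) 1) = galoisTensor L H σ (e.symm (single y 1))
      rw [e.symm_apply_eq, he, e.apply_symm_apply, semilinearMap_single, map_one])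

/-- A polynomial ring over an algebra split by `L`, after base change to `L`. -/
def tensorPolynomialEquiv (a : ℕ) (e : (L ⊗[k] H) ≃ₐ[L] AddMonoidAlgebra L M) :
    (L ⊗[k] MvPolynomial (Fin a) H) ≃ₐ[L] MvPolynomial (Fin a) (AddMonoidAlgebra L M) :=
  MvPolynomial.rTensorAlgEquiv.trans (MvPolynomial.mapAlgEquiv (Fin a) e)

lemma tensorPolynomialEquiv_C (a : ℕ) (e : (L ⊗[k] H) ≃ₐ[L] AddMonoidAlgebra L M) (x : L ⊗[k] H) :
    tensorPolynomialEquiv a e (Algebra.TensorProduct.map (AlgHom.id L L)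
      (IsScalarTower.toAlgHom k H (MvPolynomial (Fin a) H)) x) = MvPolynomial.C (e x) := by
  induction x using TensorProduct.induction_on with
  | zero => simp
  | add x y hx hy => simp only [map_add, hx, hy]
  | tmul c h =>
    have : MvPolynomial.rTensorAlgEquiv (σ := Fin a) (c ⊗ₜ[k] MvPolynomial.C h) =
        MvPolynomial.C (c ⊗ₜ[k] h) := by
      ext d
      rw [MvPolynomial.coeff_rTensorAlgEquiv_tmul, MvPolynomial.coeff_C, MvPolynomial.coeff_C]
      split_ifs <;> simp
    simp [tensorPolynomialEquiv, this]

variable {R : Type*} [CommRing R] [Algebra k R]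

/-- The monomials of the group algebra as units of an algebra over an algebra split by `L`. -/
def mapMonomialUnits (ι : H →ₐ[k] R) {ρ : Representation ℤ (L ≃ₐ[k] L) M}
    (e : (L ⊗[k] H) ≃ₐ[L] AddMonoidAlgebra L M)
    (he : ∀ σ x, e (galoisTensor L H σ x) = semilinearMap k σ (ρ σ) (e x)) :
    IntertwiningMap ρ (unitsRep (galoisTensor L R)) :=
  (unitsRepMap (Algebra.TensorProduct.map (AlgHom.id L L) ι : L ⊗[k] H →+* L ⊗[k] R)
    (map_galoisTensor L ι)).comp (monomialUnits e he)

lemma apply_mapMonomialUnits {a : ℕ} {ι : H →ₐ[k] R} {ρ : Representation ℤ (L ≃ₐ[k] L) M}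
    {e : (L ⊗[k] H) ≃ₐ[L] AddMonoidAlgebra L M}
    (he : ∀ σ x, e (galoisTensor L H σ x) = semilinearMap k σ (ρ σ) (e x))
    {E : (L ⊗[k] R) ≃ₐ[L] MvPolynomial (Fin a) (AddMonoidAlgebra L M)}
    (hE : ∀ x, E (Algebra.TensorProduct.map (AlgHom.id L L) ι x) = MvPolynomial.C (e x)) (y : M) :
    E (mapMonomialUnits ι e he y).toMul.1 = MvPolynomial.C (single y 1) := by
  exact (hE _).trans (congrArg MvPolynomial.C (e.apply_symm_apply _))

lemma apply_constUnits {a : ℕ} (E : (L ⊗[k] R) ≃ₐ[L] MvPolynomial (Fin a) (AddMonoidAlgebra L M))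
    (c : Lˣ) : E (constUnits L R c : (L ⊗[k] R)ˣ) = MvPolynomial.C (single 0 c.1) := by
  rw [constUnits_eq, AlgEquiv.commutes]
  rfl

/-- Over a domain the units of a polynomial ring are the units of the coefficients, and those of
`L[M]` are nonzero multiples of monomials. Thus units modulo constants recover the character
lattice. -/
lemma exists_eq_mapMonomialUnits [Module.Free ℤ M] [Module.Finite ℤ M] {a : ℕ} {ι : H →ₐ[k] R}
    {ρ : Representation ℤ (L ≃ₐ[k] L) M} {e : (L ⊗[k] H) ≃ₐ[L] AddMonoidAlgebra L M}
    (he : ∀ σ x, e (galoisTensor L H σ x) = semilinearMap k σ (ρ σ) (e x))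
    {E : (L ⊗[k] R) ≃ₐ[L] MvPolynomial (Fin a) (AddMonoidAlgebra L M)}
    (hE : ∀ x, E (Algebra.TensorProduct.map (AlgHom.id L L) ι x) = MvPolynomial.C (e x))
    (u : (L ⊗[k] R)ˣ) : ∃ y c, u = (mapMonomialUnits ι e he y).toMul * constUnits L R c := by
  have := twoUniqueSums_of_free M
  have := isDomain_of_free L M
  have hu := u.isUnit.map E
  rw [MvPolynomial.isUnit_iff_eq_C_of_isReduced] at hu
  obtain ⟨x, hx, h⟩ := hu
  obtain ⟨y, c, hc, rfl⟩ := exists_eq_single_of_isUnit hx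
  refine ⟨y, Units.mk0 c hc, Units.ext (E.injective ?_)⟩
  rw [Units.val_mul, map_mul, apply_mapMonomialUnits he hE, apply_constUnits, h, ← map_mul,
    single_mul_single, add_zero, one_mul, Units.val_mk0]

lemma eq_zero_of_mapMonomialUnits_eq {a : ℕ} {ι : H →ₐ[k] R}
    {ρ : Representation ℤ (L ≃ₐ[k] L) M} {e : (L ⊗[k] H) ≃ₐ[L] AddMonoidAlgebra L M}
    (he : ∀ σ x, e (galoisTensor L H σ x) = semilinearMap k σ (ρ σ) (e x))
    {E : (L ⊗[k] R) ≃ₐ[L] MvPolynomial (Fin a) (AddMonoidAlgebra L M)}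
    (hE : ∀ x, E (Algebra.TensorProduct.map (AlgHom.id L L) ι x) = MvPolynomial.C (e x))
    (y : M) (c : Lˣ) (h : mapMonomialUnits ι e he y = .ofMul (constUnits L R c)) : y = 0 := by
  have h1 := apply_mapMonomialUnits he hE y
  rw [h, toMul_ofMul, apply_constUnits] at h1
  have h2 := congrArg coeff (MvPolynomial.C_injective _ _ h1)
  rw [coeff_single, coeff_single, Finsupp.single_eq_single_iff] at h2
  rcases h2 with h2 | h2
  · exact h2.1.symm
  · exact absurd h2.1 c.ne_zero

/-- The resolution of the character lattice `M` of a torus `Spec H` attached to a retraction of a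
localization of a polynomial ring over `H` from a localization of a polynomial ring over `k`. -/
lemma Representation.HasResolution.of_retraction [Module.Free ℤ M] [Module.Finite ℤ M]
    {ρ : Representation ℤ (L ≃ₐ[k] L) M} {e : (L ⊗[k] H) ≃ₐ[L] AddMonoidAlgebra L M}
    (he : ∀ σ x, e (galoisTensor L H σ x) = semilinearMap k σ (ρ σ) (e x))
    {a b : ℕ} {ι : H →ₐ[k] R} {E : (L ⊗[k] R) ≃ₐ[L] MvPolynomial (Fin a) (AddMonoidAlgebra L M)}
    (hE : ∀ x, E (Algebra.TensorProduct.map (AlgHom.id L L) ι x) = MvPolynomial.C (e x))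
    {S C : Type*} [CommRing S] [Algebra k S] [CommRing C] [Algebra k C]
    {f₁ : R →ₐ[k] S} {r₁ : R} (h₁ : IsAwayExtension f₁ r₁) (hr₁ : r₁ ≠ 0)
    {f₂ : MvPolynomial (Fin b) k →ₐ[k] C} {r₂ : MvPolynomial (Fin b) k}
    (h₂ : IsAwayExtension f₂ r₂) (hr₂ : r₂ ≠ 0)
    (φ : S →ₐ[k] C) (ψ : C →ₐ[k] S) (hψφ : ∀ x, ψ (φ x) = x) :
    HasResolution (fun _ _ (ρ : Representation ℤ (L ≃ₐ[k] L) _) => IsInvertible ρ) ρ ∧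
      (Function.Surjective φ →
        HasResolution (fun _ _ (ρ : Representation ℤ (L ≃ₐ[k] L) _) => IsStablyPerm ρ) ρ) := by
  have := isDomain_of_free L M
  have := uniqueFactorizationMonoid_of_free L M
  have := E.toMulEquiv.isDomain _
  have := E.symm.toMulEquiv.uniqueFactorizationMonoid inferInstance
  let E' := MvPolynomial.algebraTensorAlgEquiv (σ := Fin b) k L
  have := E'.toMulEquiv.isDomain _
  have := E'.symm.toMulEquiv.uniqueFactorizationMonoid inferInstance
  exact HasResolution.of_isAwayExtension L h₁ hr₁ h₂ hr₂ φ ψ hψφ (mapMonomialUnits ι e he)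
    (exists_eq_mapMonomialUnits he hE) (eq_zero_of_mapMonomialUnits_eq he hE)
    (exists_eq_constUnits b)

end Rational

/-! ### Localizations at one element. -/

section AwayExtension

variable {k : Type*} [Field k] {R S C : Type*} [CommRing R] [Algebra k R] [CommRing S] [Algebra k S]
  [CommRing C] [Algebra k C]

lemma IsAwayExtension.exists_lift {f : R →ₐ[k] S} {r : R} (hf : IsAwayExtension f r)
    (g : R →ₐ[k] C) (hg : IsUnit (g r)) : ∃ h : S →ₐ[k] C, ∀ x, h (f x) = g x := by
  let : Algebra R S := f.toRingHom.toAlgebra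
  have hf' : ∀ x, algebraMap R S x = f x := fun _ => rfl
  have : IsScalarTower k R S := IsScalarTower.of_algebraMap_eq fun x => (f.commutes x).symm
  have : IsLocalization.Away r S :=
    { map_units := by
        rintro ⟨_, n, rfl⟩
        change IsUnit (f (r ^ n))
        rw [map_pow]
        exact hf.isUnit.pow n
      surj := fun x => by
        obtain ⟨n, d, h⟩ := hf.exists_mul_pow_eq x
        exact ⟨(d, ⟨_, n, rfl⟩), by
          change x * f (r ^ n) = f d
          rw [map_pow, h]⟩
      exists_of_eq := fun {x y} h => ⟨1, by rw [hf.injective h]⟩ }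
  refine ⟨IsLocalization.liftAlgHom (M := Submonoid.powers r) (f := g) ?_, fun x => ?_⟩
  · rintro ⟨_, n, rfl⟩
    change IsUnit (g (r ^ n))
    rw [map_pow]
    exact hg.pow n
  · exact IsLocalization.lift_eq _ x

lemma IsAwayExtension.apply_eq {f : R →ₐ[k] S} {r : R} (hf : IsAwayExtension f r)
    {g g' : S →ₐ[k] C} (h : ∀ x, g (f x) = g' (f x)) (x : S) : g x = g' x := by
  obtain ⟨n, d, hd⟩ := hf.exists_mul_pow_eq x
  have h1 := congrArg g hd
  have h2 := congrArg g' hd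
  rw [map_mul, map_pow] at h1 h2
  rw [← h] at h2
  refine ((hf.isUnit.map g).pow n).mul_right_cancel ?_
  rw [h1, h d, ← h2, h]

/-- In the intermediate ring `s` is `c / r ^ N`, so inverting first `r` and then `s` is the same as
inverting `r * c`. -/
lemma IsAwayExtension.comp {f : R →ₐ[k] S} {r : R} (hf : IsAwayExtension f r) {g : S →ₐ[k] C}
    {s : S} (hg : IsAwayExtension g s) {N : ℕ} {c : R} (hc : s * f r ^ N = f c) :
    IsAwayExtension (g.comp f) (r * c) where
  injective := hg.injective.comp hf.injective
  isUnit := by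
    change IsUnit (g (f (r * c)))
    rw [map_mul, ← hc, map_mul, map_mul, map_pow]
    exact (hf.isUnit.map g).mul (hg.isUnit.mul ((hf.isUnit.map g).pow N))
  exists_mul_pow_eq x := by
    obtain ⟨a, y, hy⟩ := hg.exists_mul_pow_eq x
    obtain ⟨b, d, hd⟩ := hf.exists_mul_pow_eq y
    refine ⟨a + b, d * r ^ (N * a) * r ^ a * c ^ b, ?_⟩
    change x * g (f (r * c)) ^ (a + b) = g (f _)
    have h1 : x * g (f c) ^ a = g y * g (f r) ^ (N * a) := by
      rw [← hc, map_mul, map_pow, mul_pow, ← hy]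
      ring
    rw [map_mul, map_mul, map_mul, map_mul, map_mul, map_mul, map_mul, map_mul, ← hd, map_mul]
    simp only [map_pow]
    linear_combination g (f r) ^ (a + b) * g (f c) ^ b * h1

lemma isAwayExtension_localizationAway [IsDomain R] {r : R} (hr : r ≠ 0) :
    IsAwayExtension (IsScalarTower.toAlgHom k R (Localization.Away r)) r where
  injective := IsLocalization.injective (Localization.Away r) (powers_le_nonZeroDivisors_of_noZeroDivisors hr)
  isUnit := IsLocalization.Away.algebraMap_isUnit r
  exists_mul_pow_eq x := by
    obtain ⟨⟨d, ⟨_, n, rfl⟩⟩, h⟩ := IsLocalization.surj (Submonoid.powers r) x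
    refine ⟨n, d, ?_⟩
    change x * algebraMap _ _ r ^ n = algebraMap _ _ d
    rw [← map_pow]
    exact h

end AwayExtension

/-! ### From rationality to resolutions of the character lattice. -/

section RationalTorus

open AddMonoidAlgebra Representation

variable {k : Type*} [Field k] {L : Type*} [Field L] [Algebra k L]
  {M : Type*} [AddCommGroup M] [Module.Free ℤ M] [Module.Finite ℤ M]
  {H : Type*} [CommRing H] [Algebra k H] [Algebra.FiniteType k H]
  {ρ : Representation ℤ (L ≃ₐ[k] L) M} {e : (L ⊗[k] H) ≃ₐ[L] AddMonoidAlgebra L M}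

lemma exists_mul_map_eq (H : Type*) [CommRing H] [IsDomain H] (a : ℕ)
    (p : MvPolynomial (Fin a) (FractionRing H)) :
    ∃ (c : H) (q : MvPolynomial (Fin a) H), c ≠ 0 ∧
      p * MvPolynomial.map (algebraMap H (FractionRing H)) (MvPolynomial.C c) =
        MvPolynomial.map (algebraMap H (FractionRing H)) q := by
  induction p using MvPolynomial.induction_on with
  | C x =>
    obtain ⟨c, d, hd, rfl⟩ := IsFractionRing.div_surjective (A := H) x
    have hd0 : d ≠ 0 := nonZeroDivisors.ne_zero hd
    refine ⟨d, MvPolynomial.C c, hd0, ?_⟩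
    rw [MvPolynomial.map_C, MvPolynomial.map_C, ← map_mul, div_mul_cancel₀]
    exact (map_ne_zero_iff _ (IsFractionRing.injective H (FractionRing H))).2 hd0
  | add p p' h h' =>
    obtain ⟨c, q, hc, h⟩ := h
    obtain ⟨c', q', hc', h'⟩ := h'
    refine ⟨c * c', q * MvPolynomial.C c' + q' * MvPolynomial.C c, mul_ne_zero hc hc', ?_⟩
    rw [map_add, map_mul (MvPolynomial.map _) q, map_mul (MvPolynomial.map _) q', ← h, ← h',
      map_mul MvPolynomial.C, map_mul]
    ring
  | mul_X p i h =>
    obtain ⟨c, q, hc, h⟩ := h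
    refine ⟨c, q * MvPolynomial.X i, hc, ?_⟩
    rw [map_mul (MvPolynomial.map _) q, ← h, MvPolynomial.map_X]
    ring

/-- The character lattice of a stably rational torus has a resolution by stably permutation
lattices. -/
theorem IsStablyRational.hasResolution (h : IsStablyRational k H)
    (he : ∀ σ x, e (galoisTensor L H σ x) = semilinearMap k σ (ρ σ) (e x)) :
    HasResolution (fun _ _ (ρ : Representation ℤ (L ≃ₐ[k] L) _) => IsStablyPerm ρ) ρ := by
  obtain ⟨_, a, b, ⟨g⟩⟩ := h
  let E := FractionRing (MvPolynomial (Fin b) k)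
  let g₂ : MvPolynomial (Fin b) k →ₐ[k] E := IsScalarTower.toAlgHom k _ _
  let u : MvPolynomial (Fin a) H →ₐ[k] MvPolynomial (Fin a) (FractionRing H) :=
    MvPolynomial.mapAlgHom (IsScalarTower.toAlgHom k H (FractionRing H))
  have hu : ∀ p, u p = MvPolynomial.map (algebraMap H (FractionRing H)) p := fun _ => rfl
  let w : MvPolynomial (Fin a) (FractionRing H) →ₐ[k]
    FractionRing (MvPolynomial (Fin a) (FractionRing H)) := IsScalarTower.toAlgHom k _ _
  have hw : Function.Injective w := IsFractionRing.injective _ _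
  have hui : Function.Injective u :=
    MvPolynomial.map_injective _ (IsFractionRing.injective H (FractionRing H))
  let g₁ : MvPolynomial (Fin a) H →ₐ[k] E := (g.toAlgHom.comp w).comp u
  have hg₁ : ∀ p, g₁ p = g (w (u p)) := fun _ => rfl
  have hg₂i : Function.Injective g₂ := IsFractionRing.injective _ _
  have hg₁i : Function.Injective g₁ := g.injective.comp (hw.comp hui)
  -- Polynomials over `H` and over `k` embed in the same field `E` and both have it as fraction
  -- field, so they share a localization. To write an element of `E` as a fraction over `H[y]`, the
  -- denominators of the coefficients are cleared.
  obtain ⟨r, r', hr, hr', hrr⟩ := exists_awaySubalgebra_eq hg₁i hg₂i (fun x => by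
      obtain ⟨x, rfl⟩ := g.surjective x
      obtain ⟨p, q, hq, rfl⟩ := IsFractionRing.div_surjective
        (A := MvPolynomial (Fin a) (FractionRing H)) x
      have hq0 : q ≠ 0 := nonZeroDivisors.ne_zero hq
      obtain ⟨c, p', hc, hp⟩ := exists_mul_map_eq H a p
      obtain ⟨c', q', hc', hq'⟩ := exists_mul_map_eq H a q
      rw [← hu, ← hu] at hp hq'
      have hC : ∀ c : H, c ≠ 0 → u (MvPolynomial.C c) ≠ 0 := fun c hc =>
        (map_ne_zero_iff u hui).2 (MvPolynomial.C_ne_zero.2 hc)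
      have hq'0 : q' ≠ 0 := by
        rintro rfl
        rw [map_zero] at hq'
        exact mul_ne_zero hq0 (hC c' hc') hq'
      refine ⟨p' * MvPolynomial.C c', q' * MvPolynomial.C c,
        mul_ne_zero hq'0 (MvPolynomial.C_ne_zero.2 hc), ?_⟩
      rw [hg₁, hg₁, ← map_mul, map_mul u, map_mul u, ← hp, ← hq']
      congr 1
      change w p / w q * _ = _
      have hwq : w q ≠ 0 := (map_ne_zero_iff w hw).2 hq0
      simp only [map_mul]
      field_simp)
    (fun x => by
      obtain ⟨p, q, hq, rfl⟩ := IsFractionRing.div_surjective (A := MvPolynomial (Fin b) k) x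
      have hq0 : q ≠ 0 := nonZeroDivisors.ne_zero hq
      exact ⟨p, q, hq0, div_mul_cancel₀ _ ((map_ne_zero_iff g₂ hg₂i).2 hq0)⟩)
  let φ := Subalgebra.equivOfEq _ _ hrr
  exact (HasResolution.of_retraction he (tensorPolynomialEquiv_C a e)
    (isAwayExtension_toAwaySubalgebra hg₁i hr) hr (isAwayExtension_toAwaySubalgebra hg₂i hr') hr'
    φ.toAlgHom φ.symm.toAlgHom φ.symm_apply_apply).2 φ.surjective

/-- The character lattice of a retract rational torus has a resolution by invertible lattices. -/
theorem IsRetractRational.hasResolution (h : IsRetractRational k H)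
    (he : ∀ σ x, e (galoisTensor L H σ x) = semilinearMap k σ (ρ σ) (e x)) :
    HasResolution (fun _ _ (ρ : Representation ℤ (L ≃ₐ[k] L) _) => IsInvertible ρ) ρ := by
  obtain ⟨_, R, hR, n, f, φ₀, ψ₀, hψφ⟩ := h
  have hψφ' : ∀ x, ψ₀ (φ₀ x) = x := fun x => congrArg (fun F => F x) hψφ
  have hnt : Nontrivial (Localization.Away f) := ψ₀.toRingHom.domain_nontrivial
  have hf : f ≠ 0 := by
    intro hf
    have h := IsLocalization.Away.algebraMap_isUnit (S := Localization.Away f) f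
    exact h.ne_zero ((congrArg (algebraMap _ (Localization.Away f)) hf).trans (map_zero _))
  have : IsDomain (Localization.Away f) :=
    IsLocalization.isDomain_localization (powers_le_nonZeroDivisors_of_noZeroDivisors hf)
  have : Algebra.FiniteType k R := .of_surjective ψ₀ fun x => ⟨_, hψφ' x⟩
  -- No auxiliary variables are needed here; `H` is regarded as a polynomial ring in zero variables
  -- to fit the general statement.
  let u : MvPolynomial (Fin 0) H ≃ₐ[k] H := (MvPolynomial.isEmptyAlgEquiv H (Fin 0)).restrictScalars k
  let w : H →ₐ[k] FractionRing H := IsScalarTower.toAlgHom k _ _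
  have hw : Function.Injective w := IsFractionRing.injective _ _
  have hwu : Function.Injective (w.comp u.toAlgHom) := fun x y h => u.injective (hw h)
  -- The retract `R` is finitely generated as a quotient of a localized polynomial ring, and has the
  -- same fraction field as `H`. A common localization replaces it by one of `H`.
  obtain ⟨r, r', hr, hr', hrr⟩ := exists_awaySubalgebra_eq (g := w.comp u.toAlgHom) (g' := R.val)
    hwu Subtype.val_injective
    (fun x => by
      obtain ⟨p, q, hq, rfl⟩ := IsFractionRing.div_surjective (A := H) x
      have hq0 : q ≠ 0 := nonZeroDivisors.ne_zero hq
      refine ⟨u.symm p, u.symm q, (map_ne_zero_iff _ u.symm.injective).2 hq0, ?_⟩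
      change w p / w q * w (u (u.symm q)) = w (u (u.symm p))
      rw [u.apply_symm_apply, u.apply_symm_apply,
        div_mul_cancel₀ _ ((map_ne_zero_iff w hw).2 hq0)])
    (fun x => by
      obtain ⟨p, q, hq, rfl⟩ := IsFractionRing.div_surjective (A := R) x
      have hq0 : q ≠ 0 := nonZeroDivisors.ne_zero hq
      exact ⟨p, q, hq0, div_mul_cancel₀ _ fun h => hq0 (Subtype.ext h)⟩)
  obtain ⟨f₁, hf₁⟩ : ∃ f₁ : MvPolynomial (Fin 0) H →ₐ[k] awaySubalgebra R.val r',
      IsAwayExtension f₁ r :=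
    hrr ▸ ⟨_, isAwayExtension_toAwaySubalgebra hwu hr⟩
  have hs := isAwayExtension_toAwaySubalgebra (g := R.val) Subtype.val_injective hr'
  have hφr : φ₀ r' ≠ 0 := fun h => hr' (by rw [← hψφ' r', h, map_zero])
  have hl := isAwayExtension_localizationAway (k := k) hf
  have hl' := isAwayExtension_localizationAway (k := k) hφr
  obtain ⟨N, c, hc⟩ := hl.exists_mul_pow_eq (φ₀ r')
  have hc0 : c ≠ 0 := by
    rintro rfl
    rw [map_zero] at hc
    exact mul_ne_zero hφr (pow_ne_zero N hl.isUnit.ne_zero) hc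
  -- Inverting `r'` in `R` and `φ₀ r'` in the localized polynomial ring keeps the retraction,
  -- because `ψ₀ (φ₀ r') = r'`. The new target is again the localization of a polynomial ring at one
  -- element, namely `f * c`.
  obtain ⟨φ, hφ⟩ := hs.exists_lift ((IsScalarTower.toAlgHom k _ (Localization.Away (φ₀ r'))).comp φ₀)
    hl'.isUnit
  obtain ⟨ψ, hψ⟩ := hl'.exists_lift ((toAwaySubalgebra R.val r').comp ψ₀) (by
    change IsUnit (toAwaySubalgebra R.val r' (ψ₀ (φ₀ r')))
    rw [hψφ']
    exact hs.isUnit)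
  refine (HasResolution.of_retraction he (tensorPolynomialEquiv_C 0 e) hf₁ hr (hl.comp hl' hc)
    (mul_ne_zero hf hc0) φ ψ fun x => ?_).1
  refine hs.apply_eq (g := ψ.comp φ) (g' := AlgHom.id k _) (fun x => ?_) x
  change ψ (φ _) = _
  rw [hφ]
  exact (hψ _).trans (congrArg (toAwaySubalgebra R.val r') (hψφ' x))

end RationalTorus

/-! ### Linear substitutions in polynomial rings -/

namespace MvPolynomial

variable {T : Type*} [Fintype T] {D D' : Type*} [CommRing D] [CommRing D']

/-- The substitution of linear forms for the variables. -/
def linearSubst (B : Matrix T T D) : MvPolynomial T D →ₐ[D] MvPolynomial T D :=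
  aeval fun l => ∑ j, C (B l j) * X j

lemma eval₂Hom_linear (ι : D →+* D') (B : Matrix T T D) (z : T → D') (p : MvPolynomial T D) :
    eval₂Hom ι (fun l => ∑ j, ι (B l j) * z j) p = eval₂Hom ι z (linearSubst B p) := by
  have : eval₂Hom ι (fun l => ∑ j, ι (B l j) * z j) =
      (eval₂Hom ι z).comp (linearSubst B).toRingHom := by
    ext <;> simp [linearSubst]
  exact congrArg (fun f => f p) this

lemma linearSubst_linearSubst [DecidableEq T] {B B' : Matrix T T D} (h : B' * B = 1)
    (p : MvPolynomial T D) : linearSubst B (linearSubst B' p) = p := by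
  have : (linearSubst B).comp (linearSubst B') = AlgHom.id D _ := by
    ext1 j
    simp only [linearSubst, AlgHom.comp_apply, aeval_X, map_sum, map_mul, AlgHom.id_apply,
      ← algebraMap_eq, AlgHom.commutes, Finset.mul_sum]
    rw [Finset.sum_comm]
    simp only [← mul_assoc, ← map_mul, ← Finset.sum_mul, ← map_sum]
    have h' : ∀ j', ∑ l, B' j l * B l j' = (1 : Matrix T T D) j j' := fun j' => by
      rw [← h, Matrix.mul_apply]
    simp [h', Matrix.one_apply]
  exact congrArg (fun f => f p) this

omit [Fintype T] in
lemma coeff_aeval_smul_X (g : T → D) (p : MvPolynomial T D) (d : T →₀ ℕ) :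
    coeff d (aeval (R := D) (fun j => C (g j) * X j : T → MvPolynomial T D) p) =
      (d.prod fun j n => g j ^ n) * coeff d p := by
  classical
  induction p using MvPolynomial.induction_on' with
  | monomial d' c =>
    have : aeval (R := D) (fun j => C (g j) * X j : T → MvPolynomial T D) (monomial d' c) =
        monomial d' ((d'.prod fun j n => g j ^ n) * c) := by
      rw [aeval_monomial, monomial_eq, map_mul, Finsupp.prod, Finsupp.prod, Finsupp.prod, map_prod]
      simp only [mul_pow, Finset.prod_mul_distrib, map_pow, algebraMap_eq]
      ring
    rw [this, coeff_monomial, coeff_monomial]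
    split_ifs with h
    · rw [h]
    · rw [mul_zero]
  | add p p' h h' => simp only [map_add, coeff_add, h, h', mul_add]

-- Rescaling the variables multiplies each coefficient by a monomial in the `g j`, which is nonzero
-- in a domain.
omit [Fintype T] in
lemma eval₂Hom_mul_injective [IsDomain D] {ι : D →+* D'} {x : T → D'}
    (hx : Function.Injective (eval₂Hom ι x)) {g : T → D} (hg : ∀ j, g j ≠ 0) :
    Function.Injective (eval₂Hom ι fun j => ι (g j) * x j) := by
  have h : eval₂Hom ι (fun j => ι (g j) * x j) = (eval₂Hom ι x).comp
      (aeval (R := D) (fun j => C (g j) * X j : T → MvPolynomial T D)).toRingHom := by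
    ext <;> simp
  rw [h]
  refine hx.comp ((injective_iff_map_eq_zero _).2 fun p hp => ?_)
  ext d
  have h1 := coeff_aeval_smul_X g p d
  rw [show aeval (R := D) (fun j => C (g j) * X j : T → MvPolynomial T D) p = 0 from hp,
    coeff_zero] at h1
  rw [coeff_zero]
  exact (mul_eq_zero.1 h1.symm).resolve_left
    (Finset.prod_ne_zero_iff.2 fun j _ => pow_ne_zero _ (hg j))

omit [Fintype T] in
lemma eval₂Hom_map {ι : D →+* D'} {v : T → D'} {a : D →+* D} {a' : D' →+* D'}
    (h : ∀ d, a' (ι d) = ι (a d)) (hv : ∀ l, a' (v l) = v l) (p : MvPolynomial T D) :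
    a' (eval₂Hom ι v p) = eval₂Hom ι v (map a p) := by
  have : a'.comp (eval₂Hom ι v) = (eval₂Hom ι v).comp (map a) := by
    ext <;> simp [h, hv]
  exact congrArg (fun f => f p) this

end MvPolynomial

/-! ### Galois descent -/

section Descent

variable {k : Type*} [Field k] {L : Type*} [Field L] [Algebra k L] [FiniteDimensional k L]
  [IsGalois k L]

omit [IsGalois k L] in
variable (k L) in
/-- The space of functions on a finite set with an action of the Galois group has a basis of
invariant functions. -/
lemma exists_invariant_matrix (T : Type*) [Fintype T] [DecidableEq T] [MulAction (L ≃ₐ[k] L) T] :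
    ∃ B B' : Matrix T T L, B * B' = 1 ∧ B' * B = 1 ∧
      ∀ (σ : L ≃ₐ[k] L) l j, σ (B l j) = B l (σ • j) := by
  let s : Set (T → L) := {b | ∀ (σ : L ≃ₐ[k] L) j, σ (b j) = b (σ • j)}
  -- If the invariant functions did not span, a nonzero functional `f` would kill them. It kills the
  -- traces `∑ σ(a) e_{σ j₀}` for all `a`, and Dedekind's independence of automorphisms forces `f`
  -- to vanish on each `e_{j₀}`.
  have hs : Submodule.span L s = ⊤ := by
    by_contra hne
    obtain ⟨f, hf, hsf⟩ := Submodule.exists_le_ker_of_lt_top _ (lt_top_iff_ne_top.2 hne)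
    refine hf (LinearMap.pi_ext' fun j₀ => LinearMap.ext_ring ?_)
    have hind := (linearIndependent_toLinearMap k L L).comp
      (fun σ : L ≃ₐ[k] L => σ.toAlgHom) fun σ τ h => AlgEquiv.ext fun x => DFunLike.congr_fun h x
    rw [Fintype.linearIndependent_iff] at hind
    have h0 := hind (fun σ => f (Pi.single (σ • j₀) 1)) (LinearMap.ext fun a => by
      let b : T → L := ∑ σ : L ≃ₐ[k] L, σ a • Pi.single (σ • j₀) 1
      have hb : b ∈ s := by
        intro τ j
        simp only [b, Finset.sum_apply, Pi.smul_apply, map_sum, smul_eq_mul, map_mul]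
        rw [← Equiv.sum_comp (Equiv.mulLeft τ) fun σ : L ≃ₐ[k] L =>
          σ a * (Pi.single (σ • j₀) 1 : T → L) (τ • j)]
        refine Finset.sum_congr rfl fun σ _ => ?_
        simp only [Equiv.coe_mulLeft, AlgEquiv.mul_apply, mul_smul, Pi.single_apply,
          smul_left_cancel_iff]
        split_ifs <;> simp
      have h1 : f b = 0 := hsf (Submodule.subset_span hb)
      simp only [b, map_sum, map_smul, smul_eq_mul] at h1
      simp only [LinearMap.sum_apply, LinearMap.smul_apply, Function.comp_apply, smul_eq_mul,
        LinearMap.zero_apply]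
      rw [← h1]
      exact Finset.sum_congr rfl fun σ _ => mul_comm _ _) 1
    rw [one_smul] at h0
    exact h0
  obtain ⟨b, hbs, hspan, hli⟩ := exists_linearIndependent L s
  let bas : Module.Basis b L (T → L) := Module.Basis.mk hli (by
    rw [Subtype.range_coe, hspan, hs])
  let ε : T ≃ b := (Pi.basisFun L T).indexEquiv bas
  let bas' := bas.reindex ε.symm
  have hbas : ∀ l, bas' l = (ε l).1 := fun l => by simp [bas', bas]
  let B : Matrix T T L := .of fun l j => bas' l j
  let B' : Matrix T T L := .of fun j l => bas'.repr (Pi.single j 1) l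
  have h1 : B' * B = 1 := by
    ext j j'
    rw [Matrix.mul_apply, Matrix.one_apply]
    have := congrFun (bas'.sum_repr (Pi.single j 1)) j'
    simp only [Finset.sum_apply, Pi.smul_apply, smul_eq_mul] at this
    simp only [B, B', Matrix.of_apply]
    rw [this, Pi.single_apply]
    exact if_congr eq_comm rfl rfl
  refine ⟨B, B', mul_eq_one_comm.1 h1, h1, fun σ l j => ?_⟩
  simp only [B, Matrix.of_apply, hbas]
  exact hbs (ε l).2 σ j

end Descent

end

noncomputable section

open AddMonoidAlgebra Representation

/-! ### Homomorphisms of tori from homomorphisms of lattices. -/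

section TorusMap

variable {k : Type*} [Field k] {L : Type*} [Field L] [Algebra k L]
  {M N : Type*} [AddCommGroup M] [AddCommGroup N]
  {ρ : Representation ℤ (L ≃ₐ[k] L) M} {τ : Representation ℤ (L ≃ₐ[k] L) N}

lemma mem_torusOfLattice {f : AddMonoidAlgebra L M} :
    f ∈ torusOfLattice k L ρ ↔ ∀ σ, semilinearMap k σ (ρ σ) f = f := Iff.rfl

/-- The homomorphism of group algebras induced by a homomorphism of lattices. -/
def latticeMap (i : IntertwiningMap ρ τ) : AddMonoidAlgebra L M →ₐ[L] AddMonoidAlgebra L N :=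
  mapDomainAlgHom L L i.toLinearMap.toAddMonoidHom

lemma latticeMap_single (i : IntertwiningMap ρ τ) (m : M) (c : L) :
    latticeMap i (single m c) = single (i m) c := mapDomain_single

lemma semilinearMap_latticeMap (i : IntertwiningMap ρ τ) (σ : L ≃ₐ[k] L)
    (x : AddMonoidAlgebra L M) : semilinearMap k σ (τ σ) (latticeMap i x) =
      latticeMap i (semilinearMap k σ (ρ σ) x) := by
  induction x using induction_linear with
  | zero => simp
  | add x y hx hy => simp only [map_add, hx, hy]
  | single m c =>
    simp only [latticeMap_single, semilinearMap_single, i.isIntertwining]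

lemma latticeMap_injective {i : IntertwiningMap ρ τ} (hi : Function.Injective i) :
    Function.Injective (latticeMap i) := mapDomain_injective hi

lemma semilinearMap_algebraMap (σ : L ≃ₐ[k] L) (f : M →ₗ[ℤ] M) (c : L) :
    semilinearMap k σ f (algebraMap L _ c) = algebraMap L _ (σ c) := by
  refine (semilinearMap_single σ f 0 c).trans ?_
  rw [map_zero]
  rfl

lemma semilinearMap_mul (σ τ : L ≃ₐ[k] L) (x : AddMonoidAlgebra L M) :
    semilinearMap k (σ * τ) (ρ (σ * τ)) x =
      semilinearMap k σ (ρ σ) (semilinearMap k τ (ρ τ) x) := by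
  induction x using induction_linear with
  | zero => simp
  | add x y hx hy => simp only [map_add, hx, hy]
  | single m c => simp [semilinearMap_single]

lemma semilinearMap_one (x : AddMonoidAlgebra L M) :
    semilinearMap k (1 : L ≃ₐ[k] L) (ρ 1) x = x := by
  induction x using induction_linear with
  | zero => simp
  | add x y hx hy => simp only [map_add, hx, hy]
  | single m c => simp [semilinearMap_single]

/-- The homomorphism of coordinate rings of tori induced by a homomorphism of lattices. -/
def torusOfLatticeMap (i : IntertwiningMap ρ τ) : torusOfLattice k L ρ →ₐ[k] torusOfLattice k L τ :=
  (((latticeMap i).restrictScalars k).comp (torusOfLattice k L ρ).val).codRestrict _ fun x =>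
    mem_torusOfLattice.2 fun σ =>
      (semilinearMap_latticeMap i σ x.1).trans (congrArg _ (mem_torusOfLattice.1 x.2 σ))

/-- The product of the conjugates of an element is invariant. -/
lemma prod_semilinearMap_mem [FiniteDimensional k L] (x : AddMonoidAlgebra L M) :
    ∏ σ : L ≃ₐ[k] L, semilinearMap k σ (ρ σ) x ∈ torusOfLattice k L ρ :=
  mem_torusOfLattice.2 fun σ => by
    rw [map_prod, ← Equiv.prod_comp (Equiv.mulLeft σ) fun τ => semilinearMap k τ (ρ τ) x]
    exact Finset.prod_congr rfl fun τ _ => (semilinearMap_mul σ τ x).symm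

lemma dvd_prod_semilinearMap [FiniteDimensional k L] (x : AddMonoidAlgebra L M) :
    x ∣ ∏ σ : L ≃ₐ[k] L, semilinearMap k σ (ρ σ) x := by
  have h := Finset.dvd_prod_of_mem (fun σ => semilinearMap k σ (ρ σ) x)
    (Finset.mem_univ (1 : L ≃ₐ[k] L))
  rwa [semilinearMap_one] at h

lemma semilinearMap_injective (σ : L ≃ₐ[k] L) :
    Function.Injective (semilinearMap k σ (ρ σ)) := by
  intro x y h
  have := congrArg (semilinearMap k σ⁻¹ (ρ σ⁻¹)) h
  rwa [← semilinearMap_mul, ← semilinearMap_mul, inv_mul_cancel, semilinearMap_one,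
    semilinearMap_one] at this

end TorusMap

lemma AddMonoidAlgebra.single_sum {L N T : Type*} [Field L] [AddCommGroup N] (s : Finset T)
    (f : T → N) : (single (∑ j ∈ s, f j) 1 : AddMonoidAlgebra L N) = ∏ j ∈ s, single (f j) 1 := by
  classical
  induction s using Finset.induction_on with
  | empty => simp [one_def]
  | insert a s ha ih => rw [Finset.sum_insert ha, Finset.prod_insert ha, ← ih, single_mul_single,
      one_mul]

/-! ### Permuted lifts of the basis of a permutation quotient. -/

section NoName

variable {k : Type*} [Field k] {L : Type*} [Field L] [Algebra k L]
  {M N : Type*} [AddCommGroup M] [AddCommGroup N]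
  {ρ : Representation ℤ (L ≃ₐ[k] L) M} {τ : Representation ℤ (L ≃ₐ[k] L) N}
  {T : Type*} [Fintype T] [DecidableEq T] [MulAction (L ≃ₐ[k] L) T]
  {i : IntertwiningMap ρ τ} {q : IntertwiningMap τ (permRep (L ≃ₐ[k] L) T)}
  {t : T → N}

/-- The elements `t j` split `q`, so the exponents `i m + ∑ d j • t j` are distinct for distinct
pairs `(m, d)`. Distinct monomials of the polynomial ring over `L[M]` therefore go to distinct group
elements. -/
lemma eval₂Hom_latticeMap_injective (hi : Function.Injective i) (hqi : ∀ m, q (i m) = 0)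
    (ht : ∀ j, q (t j) = Pi.single j 1) :
    Function.Injective (MvPolynomial.eval₂Hom (latticeMap i : AddMonoidAlgebra L M →+* _)
      fun j => (single (t j) 1 : AddMonoidAlgebra L N)) := by
  set Φ := MvPolynomial.eval₂Hom (latticeMap i : AddMonoidAlgebra L M →+* _)
      fun j => (single (t j) 1 : AddMonoidAlgebra L N) with hΦ
  let e : M × (T →₀ ℕ) → N := fun x => i x.1 + ∑ j, x.2 j • t j
  have he : Function.Injective e := by
    rintro ⟨m, d⟩ ⟨m', d'⟩ h
    have hq : ∀ (m : M) (d : T →₀ ℕ) (j : T), q (e (m, d)) j = d j := fun m d j => by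
      simp [e, hqi, ht, Pi.single_apply]
    obtain rfl : d = d' := Finsupp.ext fun j => by
      have := hq m d j
      rw [h, hq] at this
      exact_mod_cast this.symm
    exact Prod.ext (hi (add_right_cancel h)) rfl
  have hmon : ∀ (d : T →₀ ℕ) (m : M) (c : L),
      Φ (MvPolynomial.monomial d (single m c)) = single (e (m, d)) c := fun d m c => by
    rw [hΦ, MvPolynomial.coe_eval₂Hom, MvPolynomial.eval₂_monomial, Finsupp.prod_fintype _ _ (by simp)]
    simp only [single_pow, one_pow]
    rw [← single_sum]
    change latticeMap i (single m c) * _ = _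
    rw [latticeMap_single, single_mul_single, mul_one]
  have key : ∀ (p : MvPolynomial T (AddMonoidAlgebra L M)) (m : M) (d : T →₀ ℕ),
      (Φ p).coeff (e (m, d)) = (MvPolynomial.coeff d p).coeff m := by
    intro p m d
    classical
    induction p using MvPolynomial.induction_on' with
    | monomial d' c =>
      induction c using induction_linear with
      | zero => simp
      | add x y hx hy => simp only [map_add, MvPolynomial.coeff_add, coeff_add, Finsupp.add_apply,
          hx, hy]
      | single m' c =>
        rw [hmon, MvPolynomial.coeff_monomial, coeff_single, Finsupp.single_apply]
        rcases eq_or_ne d' d with rfl | hd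
        · rw [if_pos rfl, coeff_single, Finsupp.single_apply]
          exact if_congr ⟨fun h => congrArg Prod.fst (he h), fun h => by rw [h]⟩ rfl rfl
        · rw [if_neg hd, if_neg fun h => hd (congrArg Prod.snd (he h))]
          rfl
    | add p p' h h' => simp only [map_add, MvPolynomial.coeff_add, coeff_add, Finsupp.add_apply,
        h, h']
  refine (injective_iff_map_eq_zero _).2 fun p hp => ?_
  ext d : 1
  refine AddMonoidAlgebra.ext (Finsupp.ext fun m => ?_)
  rw [← key, hp]
  rfl

variable [FiniteDimensional k L] [IsGalois k L]

omit [Fintype T] in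
/-- Hilbert 90 for a torus: the lifts of the basis of a permutation lattice can be multiplied by
elements of `L[M]` so that they are permuted. -/
lemma exists_twist (hiq : IsShortExact i q) (ht : ∀ j, q (t j) = Pi.single j 1) :
    ∃ g : T → AddMonoidAlgebra L M, (∀ j, g j ≠ 0) ∧ ∀ (σ : L ≃ₐ[k] L) j,
      semilinearMap k σ (τ σ) (latticeMap i (g j) * single (t j) 1) =
        latticeMap i (g (σ • j)) * single (t (σ • j)) 1 := by
  -- The lifts `t j` are permuted only up to elements of `M`, and `c` records this defect.
  have hc : ∀ (σ : L ≃ₐ[k] L) j, ∃ m, i m = τ σ (t j) - t (σ • j) := fun σ j => by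
    rw [← hiq.apply_eq_zero_iff, map_sub, IntertwiningMap.isIntertwining _ _ q, ht, ht,
      permRep_single, sub_self]
  choose c hc using hc
  -- The product of `g j` with the monomial of `t j` is the trace-like sum over `σ` of `σ a` times
  -- the monomial of `σ t_{σ⁻¹ j}`, which Galois permutes. The coefficient of `g j` at exponent `0`
  -- is a sum of distinct conjugates of `a` including `a` itself, hence nonzero when `a` generates a
  -- normal basis.
  let a := IsGalois.normalBasis k L 1
  refine ⟨fun j => ∑ σ : L ≃ₐ[k] L, single (c σ (σ⁻¹ • j)) (σ a), fun j h => ?_, fun σ j => ?_⟩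
  · classical
    have h0 := DFunLike.congr_fun (congrArg coeff h) 0
    simp only [coeff_sum, coeff_single, Finsupp.coe_finsetSum, Finset.sum_apply,
      Finsupp.single_apply, coeff_zero, Finsupp.coe_zero, Pi.zero_apply] at h0
    have hli := Fintype.linearIndependent_iff.1 (IsGalois.normalBasis k L).linearIndependent
      (fun σ => if c σ (σ⁻¹ • j) = 0 then 1 else 0) (by
        rw [← h0]
        refine Finset.sum_congr rfl fun σ _ => ?_
        rw [IsGalois.normalBasis_apply, ite_smul, one_smul, zero_smul]) 1
    have h1 : c 1 ((1 : L ≃ₐ[k] L)⁻¹ • j) = 0 := hiq.injective (by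
      rw [hc, map_zero, inv_one, one_smul, one_smul, map_one]
      exact sub_self _)
    rw [if_pos h1] at hli
    exact one_ne_zero hli
  · have key : ∀ j, latticeMap i (∑ σ : L ≃ₐ[k] L, single (c σ (σ⁻¹ • j)) (σ a)) *
        single (t j) 1 = ∑ σ : L ≃ₐ[k] L, single (τ σ (t (σ⁻¹ • j))) (σ a) := fun j => by
      rw [map_sum, Finset.sum_mul]
      refine Finset.sum_congr rfl fun σ _ => ?_
      rw [latticeMap_single, single_mul_single, mul_one, hc, smul_inv_smul, sub_add_cancel]
    rw [key, key, map_sum, ← Equiv.sum_comp (Equiv.mulLeft σ) fun σ' =>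
      single (τ σ' (t (σ'⁻¹ • σ • j))) (σ' a)]
    refine Finset.sum_congr rfl fun σ' _ => ?_
    simp [semilinearMap_single, mul_smul]

end NoName

/-! ### Birational splitting off of an affine space. -/

section PolynomialTorus

variable {k : Type*} [Field k] {L : Type*} [Field L] [Algebra k L]
  {M N : Type*} [AddCommGroup M] [AddCommGroup N]
  {ρ : Representation ℤ (L ≃ₐ[k] L) M} {τ : Representation ℤ (L ≃ₐ[k] L) N}
  {T : Type*} {i : IntertwiningMap ρ τ}

lemma semilinearMap_linear [Fintype T] [MulAction (L ≃ₐ[k] L) T] {z : T → AddMonoidAlgebra L N}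
    (hz : ∀ (σ : L ≃ₐ[k] L) j, semilinearMap k σ (τ σ) (z j) = z (σ • j))
    {b : T → L} (hb : ∀ (σ : L ≃ₐ[k] L) j, σ (b j) = b (σ • j)) (σ : L ≃ₐ[k] L) :
    semilinearMap k σ (τ σ) (∑ j, algebraMap L _ (b j) * z j) = ∑ j, algebraMap L _ (b j) * z j := by
  rw [map_sum, ← Equiv.sum_comp (MulAction.toPerm σ) fun j => algebraMap L _ (b j) * z j]
  refine Finset.sum_congr rfl fun j _ => ?_
  rw [map_mul, semilinearMap_algebraMap, hz, hb]
  rfl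

lemma semilinearMap_eval₂Hom {v : T → AddMonoidAlgebra L N}
    (hv : ∀ (σ : L ≃ₐ[k] L) l, semilinearMap k σ (τ σ) (v l) = v l) (σ : L ≃ₐ[k] L)
    (p : MvPolynomial T (AddMonoidAlgebra L M)) :
    semilinearMap k σ (τ σ)
        (MvPolynomial.eval₂Hom (latticeMap i : AddMonoidAlgebra L M →+* AddMonoidAlgebra L N) v p) =
      MvPolynomial.eval₂Hom (latticeMap i : AddMonoidAlgebra L M →+* AddMonoidAlgebra L N) v
        (MvPolynomial.map (semilinearMap k σ (ρ σ) : AddMonoidAlgebra L M →+* _) p) :=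
  MvPolynomial.eval₂Hom_map (a := (semilinearMap k σ (ρ σ) : AddMonoidAlgebra L M →+* _))
    (a' := (semilinearMap k σ (τ σ) : AddMonoidAlgebra L N →+* _))
    (semilinearMap_latticeMap i σ) (hv σ) p

/-- Polynomials over the group algebra whose value in invariant elements is invariant have
invariant coefficients. -/
lemma exists_map_val_eq {v : T → AddMonoidAlgebra L N}
    (hv : ∀ (σ : L ≃ₐ[k] L) l, semilinearMap k σ (τ σ) (v l) = v l)
    (hinj : Function.Injective
      (MvPolynomial.eval₂Hom (latticeMap i : AddMonoidAlgebra L M →+* AddMonoidAlgebra L N) v))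
    (p : MvPolynomial T (AddMonoidAlgebra L M))
    (hp : MvPolynomial.eval₂Hom (latticeMap i : AddMonoidAlgebra L M →+* AddMonoidAlgebra L N) v p ∈
      torusOfLattice k L τ) :
    ∃ p₀ : MvPolynomial T (torusOfLattice k L ρ),
      MvPolynomial.map ((torusOfLattice k L ρ).val : _ →+* AddMonoidAlgebra L M) p₀ = p := by
  refine MvPolynomial.mem_range_map_iff_coeffs_subset.2 ?_
  intro c hc
  obtain ⟨d, -, rfl⟩ := MvPolynomial.mem_coeffs_iff.1 (Finset.mem_coe.1 hc)
  refine ⟨⟨MvPolynomial.coeff d p, mem_torusOfLattice.2 fun σ => ?_⟩, rfl⟩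
  have h := hinj ((semilinearMap_eval₂Hom hv σ p).symm.trans (mem_torusOfLattice.1 hp σ))
  conv_rhs => rw [← h]
  rw [MvPolynomial.coeff_map]
  rfl

/-- The homomorphism from polynomials over the invariants to the invariants given by invariant
elements. -/
def invariantEval (i : IntertwiningMap ρ τ) (v : T → AddMonoidAlgebra L N)
    (hv : ∀ (σ : L ≃ₐ[k] L) l, semilinearMap k σ (τ σ) (v l) = v l) :
    MvPolynomial T (torusOfLattice k L ρ) →ₐ[k] torusOfLattice k L τ :=
  MvPolynomial.aevalTower (torusOfLatticeMap i) fun l => ⟨v l, fun σ => hv σ l⟩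

lemma coe_invariantEval (i : IntertwiningMap ρ τ) (v : T → AddMonoidAlgebra L N)
    (hv : ∀ (σ : L ≃ₐ[k] L) l, semilinearMap k σ (τ σ) (v l) = v l)
    (p : MvPolynomial T (torusOfLattice k L ρ)) :
    (invariantEval i v hv p).1 = MvPolynomial.eval₂Hom (latticeMap i : AddMonoidAlgebra L M →+* _) v
      (MvPolynomial.map ((torusOfLattice k L ρ).val : _ →+* AddMonoidAlgebra L M) p) := by
  induction p using MvPolynomial.induction_on with
  | C x =>
    rw [invariantEval, MvPolynomial.aevalTower_C, MvPolynomial.map_C, MvPolynomial.eval₂Hom_C]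
    rfl
  | add p p' h h' => rw [map_add, map_add, map_add, ← h, ← h']; rfl
  | mul_X p l h =>
    rw [map_mul, map_mul, map_mul, ← h, MvPolynomial.map_X, MvPolynomial.eval₂Hom_X',
      invariantEval, MvPolynomial.aevalTower_X]
    rfl

variable [Fintype T] [DecidableEq T] [MulAction (L ≃ₐ[k] L) T]
  {q : IntertwiningMap τ (permRep (L ≃ₐ[k] L) T)}

/-- The exponents whose monomial is a quotient of two values of nonzero polynomials form a subgroup
of `N`. It contains the image of `M`, and each `t j` because its monomial is the variable divided by
`g j`; these generate `N`. -/
lemma exists_mul_eval₂Hom_eq [IsDomain (AddMonoidAlgebra L M)] (hiq : IsShortExact i q)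
    {t : T → N} (ht : ∀ j, q (t j) = Pi.single j 1) {g : T → AddMonoidAlgebra L M}
    (hg : ∀ j, g j ≠ 0) (x : AddMonoidAlgebra L N) :
    ∃ a b : MvPolynomial T (AddMonoidAlgebra L M), b ≠ 0 ∧
      x * MvPolynomial.eval₂Hom (latticeMap i : AddMonoidAlgebra L M →+* _)
        (fun j => latticeMap i (g j) * single (t j) 1) b =
      MvPolynomial.eval₂Hom (latticeMap i : AddMonoidAlgebra L M →+* _)
        (fun j => latticeMap i (g j) * single (t j) 1) a := by
  have hinj := MvPolynomial.eval₂Hom_mul_injective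
    (eval₂Hom_latticeMap_injective hiq.injective hiq.apply_apply ht) hg
  set Φ := MvPolynomial.eval₂Hom (latticeMap i : AddMonoidAlgebra L M →+* _)
    (fun j => latticeMap i (g j) * single (t j) 1) with hΦ
  have hΦX : ∀ j, Φ (MvPolynomial.X j) = latticeMap i (g j) * single (t j) 1 := fun j => by
    simp [hΦ]
  have hΦC : ∀ a, Φ (MvPolynomial.C a) = latticeMap i a := fun a => by simp [hΦ]
  let A : AddSubgroup N :=
    { carrier := {n | ∃ a b, a ≠ 0 ∧ b ≠ 0 ∧ single n 1 * Φ b = Φ a}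
      zero_mem' := ⟨1, 1, one_ne_zero, one_ne_zero, by rw [← one_def, one_mul]⟩
      add_mem' := by
        rintro n n' ⟨a, b, ha, hb, h⟩ ⟨a', b', ha', hb', h'⟩
        refine ⟨a * a', b * b', mul_ne_zero ha ha', mul_ne_zero hb hb', ?_⟩
        rw [map_mul, map_mul, ← h, ← h', ← one_mul (1 : L), ← single_mul_single, one_mul]
        ring
      neg_mem' := by
        rintro n ⟨a, b, ha, hb, h⟩
        refine ⟨b, a, hb, ha, ?_⟩
        rw [← h, ← mul_assoc, single_mul_single, neg_add_cancel, one_mul, ← one_def, one_mul] }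
  have hAi : ∀ m, i m ∈ A := fun m => ⟨MvPolynomial.C (single m 1), 1,
    MvPolynomial.C_ne_zero.2 (by simp), one_ne_zero, by
      rw [map_one, mul_one, hΦC, latticeMap_single]⟩
  have hAt : ∀ j, t j ∈ A := fun j => ⟨MvPolynomial.X j, MvPolynomial.C (g j),
    MvPolynomial.X_ne_zero j, MvPolynomial.C_ne_zero.2 (hg j), by rw [hΦX, hΦC, mul_comm]⟩
  have hA : ∀ n, n ∈ A := fun n => by
    obtain ⟨m, hm⟩ := (hiq.apply_eq_zero_iff (n - ∑ j, q n j • t j)).1 (by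
      rw [map_sub, map_sum, sub_eq_zero]
      ext j
      simp [ht, Pi.single_apply])
    rw [← sub_add_cancel n (∑ j, q n j • t j), ← hm]
    exact add_mem (hAi m) (sum_mem fun j _ => zsmul_mem (hAt j) _)
  induction x using induction_linear with
  | zero => exact ⟨0, 1, one_ne_zero, by rw [zero_mul, map_zero]⟩
  | add x y hx hy =>
    obtain ⟨a, b, hb, h⟩ := hx
    obtain ⟨a', b', hb', h'⟩ := hy
    refine ⟨a * b' + a' * b, b * b', mul_ne_zero hb hb', ?_⟩
    rw [map_add, map_mul, map_mul, map_mul, ← h, ← h']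
    ring
  | single n c =>
    obtain ⟨a, b, -, hb, h⟩ := hA n
    refine ⟨MvPolynomial.C (algebraMap L _ c) * a, b, hb, ?_⟩
    rw [map_mul, ← h, hΦC, AlgHom.commutes, ← mul_assoc]
    congr 1
    change _ = single 0 c * _
    rw [single_mul_single, zero_add, mul_one]

variable [FiniteDimensional k L]

-- Multiplying the denominator by its other conjugates makes its value invariant, and then the value
-- of the numerator is invariant too. Injectivity of the evaluation forces the coefficients of both
-- polynomials to be invariant.
omit [Fintype T] [DecidableEq T] [MulAction (L ≃ₐ[k] L) T] in
lemma exists_mul_invariantEval_eq [IsDomain (AddMonoidAlgebra L M)] {v : T → AddMonoidAlgebra L N}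
    (hv : ∀ (σ : L ≃ₐ[k] L) l, semilinearMap k σ (τ σ) (v l) = v l)
    (hinj : Function.Injective
      (MvPolynomial.eval₂Hom (latticeMap i : AddMonoidAlgebra L M →+* AddMonoidAlgebra L N) v))
    (x : torusOfLattice k L τ) {a b : MvPolynomial T (AddMonoidAlgebra L M)} (hb : b ≠ 0)
    (h : x.1 * MvPolynomial.eval₂Hom (latticeMap i : AddMonoidAlgebra L M →+* _) v b =
      MvPolynomial.eval₂Hom (latticeMap i : AddMonoidAlgebra L M →+* _) v a) :
    ∃ a b, b ≠ 0 ∧ x * invariantEval i v hv b = invariantEval i v hv a := by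
  let S : (L ≃ₐ[k] L) → MvPolynomial T (AddMonoidAlgebra L M) :=
    fun σ => MvPolynomial.map (semilinearMap k σ (ρ σ) : AddMonoidAlgebra L M →+* _) b
  have hS0 : ∏ σ, S σ ≠ 0 := Finset.prod_ne_zero_iff.2 fun σ _ =>
    (map_ne_zero_iff _ (MvPolynomial.map_injective _ (semilinearMap_injective σ))).2 hb
  have hprod : MvPolynomial.eval₂Hom (latticeMap i : AddMonoidAlgebra L M →+* _) v (∏ σ, S σ) ∈
      torusOfLattice k L τ := by
    rw [map_prod]
    simp only [S, ← semilinearMap_eval₂Hom hv]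
    exact prod_semilinearMap_mem _
  have h1 : S 1 = b := by
    ext d : 1
    rw [MvPolynomial.coeff_map]
    exact semilinearMap_one _
  obtain ⟨c, hc⟩ := Finset.dvd_prod_of_mem S (Finset.mem_univ (1 : L ≃ₐ[k] L))
  rw [h1] at hc
  have hxa : x.1 * MvPolynomial.eval₂Hom (latticeMap i : AddMonoidAlgebra L M →+* _) v (∏ σ, S σ) =
      MvPolynomial.eval₂Hom (latticeMap i : AddMonoidAlgebra L M →+* _) v (a * c) := by
    rw [hc, map_mul, map_mul, ← mul_assoc, h]
  obtain ⟨b₀, hb₀⟩ := exists_map_val_eq hv hinj _ hprod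
  obtain ⟨a₀, ha₀⟩ := exists_map_val_eq hv hinj (a * c) (hxa ▸ mul_mem x.2 hprod)
  refine ⟨a₀, b₀, ?_, Subtype.ext ?_⟩
  · rintro rfl
    rw [map_zero] at hb₀
    exact hS0 hb₀.symm
  · rw [MulMemClass.coe_mul, coe_invariantEval, coe_invariantEval, hb₀, ha₀]
    exact hxa

omit [FiniteDimensional k L] [DecidableEq T] [MulAction (L ≃ₐ[k] L) T] in
lemma eval₂Hom_eq_linearSubst {z v : T → AddMonoidAlgebra L N} {B : Matrix T T L}
    (hv : ∀ l, v l = ∑ j, algebraMap L _ (B l j) * z j)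
    (p : MvPolynomial T (AddMonoidAlgebra L M)) :
    MvPolynomial.eval₂Hom (latticeMap i : AddMonoidAlgebra L M →+* _) v p =
      MvPolynomial.eval₂Hom (latticeMap i : AddMonoidAlgebra L M →+* _) z
        (MvPolynomial.linearSubst (B.map (algebraMap L _)) p) := by
  rw [← MvPolynomial.eval₂Hom_linear]
  refine congrArg (fun w => MvPolynomial.eval₂Hom _ w p) (funext fun l => ?_)
  rw [hv]
  refine Finset.sum_congr rfl fun j _ => ?_
  exact congrArg (· * z j) ((latticeMap i).commutes _).symm

/-- A torus is birational to the product of an affine space and a torus if the quotient of the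
character lattices is a permutation lattice. -/
lemma exists_polynomial_torusOfLattice [IsGalois k L]
    [IsDomain (AddMonoidAlgebra L M)] (hiq : IsShortExact i q) :
    ∃ Θ : MvPolynomial T (torusOfLattice k L ρ) →ₐ[k] torusOfLattice k L τ,
      Function.Injective Θ ∧ ∀ x, ∃ a b, b ≠ 0 ∧ x * Θ b = Θ a := by
  choose t ht using fun j => hiq.surjective (Pi.single j 1)
  obtain ⟨g, hg, hgt⟩ := exists_twist hiq ht
  obtain ⟨B, B', hBB', hB'B, hB⟩ := exists_invariant_matrix k L T
  have h1 : B.map (algebraMap L (AddMonoidAlgebra L M)) * B'.map (algebraMap L _) = 1 := by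
    rw [← Matrix.map_mul, hBB', Matrix.map_one _ (map_zero _) (map_one _)]
  have h2 := mul_eq_one_comm.1 h1
  obtain ⟨z, hz⟩ : ∃ z : T → AddMonoidAlgebra L N,
      z = fun j => latticeMap i (g j) * single (t j) 1 := ⟨_, rfl⟩
  -- The permuted variables `z` are replaced by invariant linear combinations through the invertible
  -- matrix `B`, whose entries transform in the opposite way. Being an invertible linear
  -- substitution, this loses no polynomials.
  obtain ⟨v, hv⟩ : ∃ v : T → AddMonoidAlgebra L N,
      ∀ l, v l = ∑ j, algebraMap L _ (B l j) * z j := ⟨_, fun _ => rfl⟩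
  have hvσ : ∀ (σ : L ≃ₐ[k] L) l, semilinearMap k σ (τ σ) (v l) = v l := fun σ l => by
    rw [hv]
    exact semilinearMap_linear (hz ▸ hgt) (fun σ j => hB σ l j) σ
  have hzinj : Function.Injective
      (MvPolynomial.eval₂Hom (latticeMap i : AddMonoidAlgebra L M →+* _) z) := by
    rw [hz]
    exact MvPolynomial.eval₂Hom_mul_injective
      (eval₂Hom_latticeMap_injective hiq.injective hiq.apply_apply ht) hg
  have hvinj : Function.Injective
      (MvPolynomial.eval₂Hom (latticeMap i : AddMonoidAlgebra L M →+* _) v) := fun p p' h => by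
    rw [eval₂Hom_eq_linearSubst hv, eval₂Hom_eq_linearSubst hv] at h
    rw [← MvPolynomial.linearSubst_linearSubst h1 p, hzinj h,
      MvPolynomial.linearSubst_linearSubst h1 p']
  refine ⟨invariantEval i v hvσ, fun p p' h => ?_, fun x => ?_⟩
  · have h := congrArg Subtype.val h
    rw [coe_invariantEval, coe_invariantEval] at h
    have hval : Function.Injective
        ((torusOfLattice k L ρ).val : torusOfLattice k L ρ →+* AddMonoidAlgebra L M) :=
      fun _ _ h => Subtype.ext h
    exact MvPolynomial.map_injective _ hval (hvinj h)
  · obtain ⟨a, b, hb, h⟩ := exists_mul_eval₂Hom_eq hiq ht hg x.1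
    rw [← hz, ← MvPolynomial.linearSubst_linearSubst h2 a,
      ← MvPolynomial.linearSubst_linearSubst h2 b, ← eval₂Hom_eq_linearSubst hv,
      ← eval₂Hom_eq_linearSubst hv] at h
    have hb' : MvPolynomial.linearSubst (B'.map (algebraMap L _)) b ≠ 0 := fun h0 => hb (by
      rw [← MvPolynomial.linearSubst_linearSubst h2 b, h0, map_zero])
    exact exists_mul_invariantEval_eq hvσ hvinj x hb' h

end PolynomialTorus

/-! ### Quasi-trivial tori -/

section PermutationTorus

variable {k : Type*} [Field k] {L : Type*} [Field L] [Algebra k L] [FiniteDimensional k L]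
  [IsGalois k L] {S : Type*} [Fintype S] [DecidableEq S] [MulAction (L ≃ₐ[k] L) S]

variable (k L S) in
/-- A quasi-trivial torus is the complement of a hypersurface in an affine space. -/
lemma exists_isAwayExtension_permRep :
    ∃ (θ : MvPolynomial S k →ₐ[k] torusOfLattice k L (permRep (L ≃ₐ[k] L) S))
      (f : MvPolynomial S k), f ≠ 0 ∧ IsAwayExtension θ f := by
  obtain ⟨B, B', hBB', hB'B, hB⟩ := exists_invariant_matrix k L S
  -- Invariant linear combinations of the basis monomials: these are the coordinates of the affine
  -- space over `k`.
  let v : S → AddMonoidAlgebra L (S → ℤ) := fun l =>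
    ∑ j, algebraMap L _ (B l j) * single (Pi.single j 1) 1
  have hv : ∀ (σ : L ≃ₐ[k] L) l, semilinearMap k σ (permRep _ S σ) (v l) = v l := fun σ l =>
    semilinearMap_linear (fun σ j => by rw [semilinearMap_single, map_one, permRep_single])
      (fun σ j => hB σ l j) σ
  let Φ : MvPolynomial S L →ₐ[L] AddMonoidAlgebra L (S → ℤ) :=
    (laurentMap L S).comp (MvPolynomial.linearSubst B)
  have hΦX : ∀ l, Φ (MvPolynomial.X l) = v l := fun l => by
    simp only [Φ, v, AlgHom.comp_apply, MvPolynomial.linearSubst, MvPolynomial.aeval_X, map_sum,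
      map_mul, laurentMap_X]
    refine Finset.sum_congr rfl fun j _ => ?_
    congr 1
    exact (laurentMap L S).commutes _
  have hΦinj : Function.Injective Φ := fun p p' h => by
    have h' : MvPolynomial.linearSubst B p = MvPolynomial.linearSubst B p' :=
      laurentMap_injective S h
    rw [← MvPolynomial.linearSubst_linearSubst hBB' p, h',
      MvPolynomial.linearSubst_linearSubst hBB' p']
  have hΦσ : ∀ (σ : L ≃ₐ[k] L) p, semilinearMap k σ (permRep _ S σ) (Φ p) =
      Φ (MvPolynomial.map (σ : L →+* L) p) := fun σ p => by
    induction p using MvPolynomial.induction_on with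
    | C c =>
      rw [MvPolynomial.map_C, ← MvPolynomial.algebraMap_eq, AlgHom.commutes, AlgHom.commutes,
        semilinearMap_algebraMap]
      rfl
    | add p p' h h' => simp only [map_add, h, h']
    | mul_X p l h =>
      rw [map_mul, map_mul, map_mul, map_mul, h, MvPolynomial.map_X, hΦX, hv]
  have hdesc : ∀ p, Φ p ∈ torusOfLattice k L (permRep _ S) →
      ∃ p₀, MvPolynomial.map (algebraMap k L) p₀ = p := fun p hp => by
    refine MvPolynomial.mem_range_map_iff_coeffs_subset.2 ?_
    intro c hc
    obtain ⟨d, -, rfl⟩ := MvPolynomial.mem_coeffs_iff.1 (Finset.mem_coe.1 hc)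
    refine (InfiniteGalois.mem_range_algebraMap_iff_fixed _).2 fun σ => ?_
    have h := hΦinj ((hΦσ σ p).symm.trans (mem_torusOfLattice.1 hp σ))
    conv_rhs => rw [← h]
    rw [MvPolynomial.coeff_map]
    rfl
  let θ : MvPolynomial S k →ₐ[k] torusOfLattice k L (permRep (L ≃ₐ[k] L) S) :=
    MvPolynomial.aeval fun l => ⟨v l, fun σ => hv σ l⟩
  have hθ : ∀ p, (θ p).1 = Φ (MvPolynomial.map (algebraMap k L) p) := fun p => by
    induction p using MvPolynomial.induction_on with
    | C c =>
      rw [MvPolynomial.map_C, ← MvPolynomial.algebraMap_eq, ← MvPolynomial.algebraMap_eq,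
        AlgHom.commutes, AlgHom.commutes]
      rfl
    | add p p' h h' => rw [map_add, map_add, map_add, ← h, ← h']; rfl
    | mul_X p l h =>
      rw [map_mul, map_mul, map_mul, ← h, MvPolynomial.map_X, hΦX, MvPolynomial.aeval_X]
      rfl
  have hΦs : ∀ p, Φ (MvPolynomial.linearSubst B' p) = laurentMap L S p := fun p => by
    simp only [Φ, AlgHom.comp_apply]
    rw [MvPolynomial.linearSubst_linearSubst hB'B]
  -- The product of all the variables is invariant, so it descends to a polynomial `f` over `k`. The
  -- torus is the complement of its zero locus, since inverting the product of variables yields all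
  -- Laurent polynomials.
  have hδ : (single (fun _ => 1) 1 : AddMonoidAlgebra L (S → ℤ)) ∈
      torusOfLattice k L (permRep _ S) := mem_torusOfLattice.2 fun σ => by
    rw [semilinearMap_single, map_one]
    rfl
  obtain ⟨f, hf⟩ := hdesc (MvPolynomial.linearSubst B' (∏ i, MvPolynomial.X i)) (by
    rw [hΦs, laurentMap_prod_X]
    exact hδ)
  have hθf : (θ f).1 = single (fun _ => 1) 1 := by
    rw [hθ, hf, hΦs, laurentMap_prod_X]
  have hδ' : (single (-fun _ => 1) 1 : AddMonoidAlgebra L (S → ℤ)) ∈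
      torusOfLattice k L (permRep _ S) := mem_torusOfLattice.2 fun σ => by
    rw [semilinearMap_single, map_one]
    rfl
  refine ⟨θ, f, fun h => ?_, fun p p' h => ?_, ?_, fun x => ?_⟩
  · rw [h, map_zero] at hθf
    have := congrArg (fun x => x.coeff fun _ => 1) hθf
    simp at this
  · have h := congrArg Subtype.val h
    rw [hθ, hθ] at h
    exact MvPolynomial.map_injective _ (algebraMap k L).injective (hΦinj h)
  · refine IsUnit.of_mul_eq_one ⟨_, hδ'⟩ (Subtype.ext ?_)
    rw [MulMemClass.coe_mul, hθf, single_mul_single, add_neg_cancel, one_mul, ← one_def]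
    rfl
  · obtain ⟨n, p, hp⟩ := exists_mul_pow_eq_laurentMap x.1
    rw [← hΦs] at hp
    obtain ⟨p₀, hp₀⟩ := hdesc _ (hp ▸ mul_mem x.2 (pow_mem hδ n))
    refine ⟨n, p₀, Subtype.ext ?_⟩
    rw [hθ, hp₀, ← hp, MulMemClass.coe_mul, SubmonoidClass.coe_pow, hθf]

end PermutationTorus

/-! ### Stable rationality -/

section FractionRing

variable {k : Type*} [Field k] {R R' : Type*} [CommRing R] [Algebra k R] [IsDomain R]
  [CommRing R'] [Algebra k R'] [IsDomain R']

lemma nonempty_fractionRing_algEquiv (f : R →ₐ[k] R') (hf : Function.Injective f)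
    (h : ∀ x, ∃ a b, b ≠ 0 ∧ x * f b = f a) :
    Nonempty (FractionRing R ≃ₐ[k] FractionRing R') := by
  let w : R' →ₐ[k] FractionRing R' := IsScalarTower.toAlgHom k _ _
  have hw : Function.Injective w := IsFractionRing.injective _ _
  have hg : Function.Injective (w.comp f) := fun x y h => hf (hw h)
  let F : FractionRing R →ₐ[k] FractionRing R' := IsFractionRing.liftAlgHom (g := w.comp f) hg
  have hF : ∀ x, F (algebraMap R _ x) = w (f x) := fun x => 
    IsFractionRing.lift_algebraMap (g := (w.comp f).toRingHom) hg x
  have hmem : ∀ x, w x ∈ F.fieldRange := fun x => by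
    obtain ⟨a, b, hb, h⟩ := h x
    refine ⟨algebraMap R _ a / algebraMap R _ b, ?_⟩
    change F _ = _
    rw [map_div₀, hF, hF, div_eq_iff, ← h, map_mul]
    exact (map_ne_zero_iff (w.comp f) hg).2 hb
  refine ⟨AlgEquiv.ofBijective F ⟨F.toRingHom.injective, fun y => ?_⟩⟩
  obtain ⟨p, q, -, rfl⟩ := IsFractionRing.div_surjective (A := R') y
  exact div_mem (hmem p) (hmem q)

lemma nonempty_fractionRing_algEquiv_of_algEquiv (e : R ≃ₐ[k] R') :
    Nonempty (FractionRing R ≃ₐ[k] FractionRing R') :=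
  nonempty_fractionRing_algEquiv e.toAlgHom e.injective fun x =>
    ⟨e.symm x, 1, one_ne_zero, by rw [map_one, mul_one]; exact (e.apply_symm_apply x).symm⟩

lemma isStablyRational_of_fractionRing_algEquiv (H : Type*) [CommRing H] [Algebra k H] [IsDomain H]
    {S T : Type*} [Fintype S] [Fintype T]
    (e : FractionRing (MvPolynomial T H) ≃ₐ[k] FractionRing (MvPolynomial S k)) :
    IsStablyRational k H := by
  let n := Fintype.card T
  obtain ⟨e₁⟩ := nonempty_fractionRing_algEquiv
    (MvPolynomial.mapAlgHom (σ := Fin n) (IsScalarTower.toAlgHom k H (FractionRing H)))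
    (MvPolynomial.map_injective _ (IsFractionRing.injective H (FractionRing H))) fun x => by
      obtain ⟨c, p, hc, h⟩ := exists_mul_map_eq H n x
      exact ⟨p, MvPolynomial.C c, MvPolynomial.C_ne_zero.2 hc, h⟩
  obtain ⟨e₂⟩ := nonempty_fractionRing_algEquiv_of_algEquiv
    ((MvPolynomial.renameEquiv H (Fintype.equivFin T).symm).restrictScalars k)
  obtain ⟨e₃⟩ := nonempty_fractionRing_algEquiv_of_algEquiv
    (MvPolynomial.renameEquiv k (Fintype.equivFin S))
  exact ⟨inferInstance, n, Fintype.card S, ⟨e₁.symm.trans (e₂.trans (e.trans e₃))⟩⟩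

end FractionRing

section Stable

variable {k : Type*} [Field k] {L : Type*} [Field L] [Algebra k L] [FiniteDimensional k L]
  [IsGalois k L] {M : Type*} [AddCommGroup M] {ρ : Representation ℤ (L ≃ₐ[k] L) M}

/-- Adding one affine coordinate for each point of `T` makes the torus birational to the
quasi-trivial torus of `ℤ[S]`, whose function field is rational. -/
lemma isStablyRational_of_isShortExact [IsDomain (AddMonoidAlgebra L M)] {S T : Type*} [Fintype S]
    [Fintype T] [MulAction (L ≃ₐ[k] L) S] [MulAction (L ≃ₐ[k] L) T]
    {i : IntertwiningMap ρ (permRep (L ≃ₐ[k] L) S)}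
    {q : IntertwiningMap (permRep (L ≃ₐ[k] L) S) (permRep (L ≃ₐ[k] L) T)}
    (hiq : IsShortExact i q) : IsStablyRational k (torusOfLattice k L ρ) := by
  classical
  obtain ⟨Θ, hΘ, hΘ'⟩ := exists_polynomial_torusOfLattice hiq
  obtain ⟨θ, f, hf, hθ⟩ := exists_isAwayExtension_permRep k L S
  have := isDomain_of_free L (S → ℤ)
  have : IsDomain (torusOfLattice k L ρ) := inferInstance
  obtain ⟨e₃⟩ := nonempty_fractionRing_algEquiv (R := MvPolynomial T (torusOfLattice k L ρ))
    (R' := torusOfLattice k L (permRep (L ≃ₐ[k] L) S)) Θ hΘ hΘ'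
  obtain ⟨e₄⟩ := nonempty_fractionRing_algEquiv θ hθ.injective fun x => by
    obtain ⟨n, d, h⟩ := hθ.exists_mul_pow_eq x
    exact ⟨d, f ^ n, pow_ne_zero n hf, by rw [map_pow, h]⟩
  exact isStablyRational_of_fractionRing_algEquiv _ (e₃.trans e₄.symm)

end Stable

/-! ### Resolutions by permutation lattices -/

namespace Representation

section Normalize

variable {G : Type*} [Group G] {M P F : Type*} [AddCommGroup M] [AddCommGroup P] [AddCommGroup F]
  {ρ : Representation ℤ G M} {μ : Representation ℤ G P} {ν : Representation ℤ G F}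
  {i : IntertwiningMap ρ μ} {q : IntertwiningMap μ ν}

lemma IsShortExact.trans_equiv (h : IsShortExact i q) {P' F' : Type*} [AddCommGroup P']
    [AddCommGroup F'] {μ' : Representation ℤ G P'} {ν' : Representation ℤ G F'}
    (e : μ.Equiv μ') (e' : ν.Equiv ν') :
    IsShortExact (e.toIntertwiningMap.comp i)
      ((e'.toIntertwiningMap.comp q).comp e.symm.toIntertwiningMap) where
  injective := e.toLinearEquiv.injective.comp h.injective
  surjective := e'.toLinearEquiv.surjective.comp (h.surjective.comp e.symm.toLinearEquiv.surjective)
  apply_eq_zero_iff x := by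
    refine (e'.toLinearEquiv.map_eq_zero_iff (x := q (e.symm x))).trans ?_
    rw [h.apply_eq_zero_iff]
    exact exists_congr fun m => (LinearEquiv.eq_symm_apply e.toLinearEquiv)

lemma IsShortExact.prod_right (h : IsShortExact i q) {K : Type*} [AddCommGroup K]
    (σ : Representation ℤ G K) :
    IsShortExact ((IntertwiningMap.inl ℤ μ σ).comp i)
      ((q.comp (.fst ℤ μ σ)).prod (.snd ℤ μ σ)) where
  injective x y hxy := h.injective (congrArg Prod.fst hxy)
  surjective := by
    rintro ⟨f, s⟩
    obtain ⟨p, rfl⟩ := h.surjective f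
    exact ⟨(p, s), rfl⟩
  apply_eq_zero_iff := by
    rintro ⟨p, s⟩
    refine Prod.ext_iff.trans ?_
    change q p = 0 ∧ s = 0 ↔ ∃ m, (i m, (0 : K)) = (p, s)
    simp [h.apply_eq_zero_iff, eq_comm]

/-- Add both permutation complements, the one for `μ` and the one for `ν`, to the middle term and to
the quotient at once; this leaves the kernel unchanged. -/
lemma HasResolution.exists_perm
    (h : HasResolution (fun _ _ (ρ : Representation ℤ G _) => IsStablyPerm ρ) ρ) :
    ∃ (S T : Type) (_ : Finite S) (_ : Finite T) (_ : MulAction G S) (_ : MulAction G T)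
      (i : IntertwiningMap ρ (permRep G S)) (q : IntertwiningMap (permRep G S) (permRep G T)),
      IsShortExact i q := by
  obtain ⟨P, F, _, _, μ, ν, i, q, hiq, hμ, hν⟩ := h
  obtain ⟨S₁, _, _, T₁, _, _, ⟨e₁⟩⟩ := hμ
  obtain ⟨S₂, _, _, T₂, _, _, ⟨e₂⟩⟩ := hν
  exact ⟨T₁ ⊕ S₂, T₂ ⊕ S₁, inferInstance, inferInstance, inferInstance, inferInstance, _, _,
    ((hiq.prod_right (permRep G S₁)).prod_right (permRep G S₂)).trans_equiv
      ((e₁.prodCongr (Equiv.refl _)).trans (permRepSum G T₁ S₂))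
      ((Equiv.prodAssoc ν (permRep G S₁) (permRep G S₂)).trans
        (((Equiv.refl ν).prodCongr (Equiv.prodComm _ _)).trans
          ((Equiv.prodAssoc ν (permRep G S₂) (permRep G S₁)).symm.trans
            ((e₂.prodCongr (Equiv.refl _)).trans (permRepSum G T₂ S₁)))))⟩

/-- Pull the resolution back along the retraction `b : ℤ[T] → ν`. The fibre product is an extension
of `ℤ[T]` by `ρ`, and the section `a` of `b` makes it a direct summand of `μ ⊕ ℤ[T]`, hence
invertible. -/
lemma HasResolution.exists_invertible
    (h : HasResolution (fun _ _ (ρ : Representation ℤ G _) => IsInvertible ρ) ρ) :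
    ∃ (N : Type) (_ : AddCommGroup N) (τ : Representation ℤ G N) (T : Type) (_ : Finite T)
      (_ : MulAction G T) (i : IntertwiningMap ρ τ) (q : IntertwiningMap τ (permRep G T)),
      IsInvertible τ ∧ IsShortExact i q := by
  obtain ⟨P, F, _, _, μ, ν, i, q, hiq, hμ, T, _, _, a, b, hba⟩ := h
  let π := permRep G T
  -- the projection onto the fibre product of `q` and `b`
  let e : IntertwiningMap (μ.prod π) (μ.prod π) := IntertwiningMap.ofAddHom
    { toFun := fun x => (x.1, x.2 - a (b x.2) + a (q x.1))
      map_zero' := by simp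
      map_add' := fun x y => by
        ext1
        · rfl
        · simp only [Prod.fst_add, Prod.snd_add, map_add]
          abel } fun g x => by
      ext1
      · rfl
      · change π g x.2 - a (b (π g x.2)) + a (q (μ g x.1)) = π g (x.2 - a (b x.2) + a (q x.1))
        rw [b.isIntertwining, q.isIntertwining, a.isIntertwining, a.isIntertwining, map_add, map_sub]
  have he : ∀ x, e x = (x.1, x.2 - a (b x.2) + a (q x.1)) := fun _ => rfl
  have hfix : ∀ p t, b t = q p → e (p, t) = (p, t) := fun p t h => by
    rw [he]
    ext1
    · rfl
    · change t - a (b t) + a (q p) = t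
      rw [h, sub_add_cancel]
  have hb : ∀ x, b (e x).2 = q x.1 := fun x => by
    rw [he]
    change b (x.2 - a (b x.2) + a (q x.1)) = _
    rw [map_add, map_sub, hba, hba, sub_self, zero_add]
  let j : IntertwiningMap (rangeRep e) (μ.prod π) := IntertwiningMap.ofAddHom
    (AddSubgroup.subtype _) fun g x => rfl
  let r : IntertwiningMap (μ.prod π) (rangeRep e) := IntertwiningMap.ofAddHom
    e.toLinearMap.toAddMonoidHom.rangeRestrict fun g x =>
      Subtype.ext (IntertwiningMap.isIntertwining _ _ e g x)
  have hr : ∀ x, (r x).1 = e x := fun _ => rfl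
  refine ⟨_, _, rangeRep e, T, inferInstance, inferInstance,
    r.comp ((IntertwiningMap.inl ℤ μ π).comp i), (IntertwiningMap.snd ℤ μ π).comp j,
    (hμ.prod (IsInvertible.perm T)).of_retract j r ?_, ?_, ?_, ?_⟩
  · rintro ⟨_, x, rfl⟩
    refine Subtype.ext ?_
    rw [hr]
    exact hfix _ _ (hb x)
  · intro m m' h
    have h := congrArg (fun x => x.1.1) h
    exact hiq.injective h
  · intro t
    obtain ⟨p, hp⟩ := hiq.surjective (b t)
    exact ⟨r (p, t), congrArg Prod.snd ((hr _).trans (hfix p t hp.symm))⟩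
  · rintro ⟨_, x, rfl⟩
    change (e x).2 = 0 ↔ ∃ m, r (i m, 0) = _
    constructor
    · intro h
      have h1 := hb x
      rw [h, map_zero, eq_comm, hiq.apply_eq_zero_iff] at h1
      obtain ⟨m, hm⟩ := h1
      refine ⟨m, Subtype.ext ?_⟩
      rw [hr, hfix _ _ (by rw [map_zero, hiq.apply_apply])]
      exact Prod.ext hm h.symm
    · rintro ⟨m, hm⟩
      have h1 := congrArg (fun y => y.1.2) hm
      change (e (i m, 0)).2 = (e x).2 at h1
      rw [← h1, hfix _ _ (by rw [map_zero, hiq.apply_apply])]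

end Normalize

end Representation

section Stable

variable {k : Type*} [Field k] {L : Type*} [Field L] [Algebra k L] [FiniteDimensional k L]
  [IsGalois k L] {M : Type*} [AddCommGroup M] [Module.Free ℤ M] [Module.Finite ℤ M]
  {ρ : Representation ℤ (L ≃ₐ[k] L) M}

/-- A torus whose character lattice has a resolution by stably permutation lattices is stably
rational. -/
theorem Representation.HasResolution.isStablyRational
    (h : HasResolution (fun _ _ (ρ : Representation ℤ (L ≃ₐ[k] L) _) => IsStablyPerm ρ) ρ) :
    IsStablyRational k (torusOfLattice k L ρ) := by
  obtain ⟨S, T, _, _, _, _, i, q, hiq⟩ := h.exists_perm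
  have := Fintype.ofFinite S
  have := Fintype.ofFinite T
  have := isDomain_of_free L M
  exact isStablyRational_of_isShortExact hiq

end Stable

/-! ### Retract rationality -/

section Retract

variable {k : Type*} [Field k]

/-- A criterion for retract rationality in terms of a retraction defined on a localization of a
polynomial ring. -/
lemma isRetractRational_of_isAwayExtension {H Q : Type*} [CommRing H] [Algebra k H] [IsDomain H]
    [CommRing Q] [Algebra k Q] {n : ℕ} {θ : MvPolynomial (Fin n) k →ₐ[k] Q}
    {f : MvPolynomial (Fin n) k} (hf : f ≠ 0) (hθ : IsAwayExtension θ f) (α : H →ₐ[k] Q) {h : H}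
    (hh : h ≠ 0) (hα : α h ≠ 0) (β : Q →ₐ[k] FractionRing H)
    (hβ : ∀ x, β x ∈ awaySubalgebra (IsScalarTower.toAlgHom k H (FractionRing H)) h)
    (hβα : ∀ x, β (α x) = algebraMap H (FractionRing H) x) : IsRetractRational k H := by
  let w : H →ₐ[k] FractionRing H := IsScalarTower.toAlgHom k H (FractionRing H)
  have hw : Function.Injective w := IsFractionRing.injective _ _
  let R := awaySubalgebra w h
  have hR : IsAwayExtension (toAwaySubalgebra w h) h := isAwayExtension_toAwaySubalgebra hw hh
  let β' : Q →ₐ[k] R := β.codRestrict R hβ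
  have hβα' : ∀ x, β' (α x) = toAwaySubalgebra w h x := fun x => Subtype.ext (hβα x)
  -- Since `α h = f' / f ^ N` in `Q`, inverting `f * f'` in the polynomial ring makes `α h` a unit,
  -- which lets `α` extend to `H[1/h]`.
  obtain ⟨N, f', hf'⟩ := hθ.exists_mul_pow_eq (α h)
  have hf'0 : f' ≠ 0 := by
    rintro rfl
    rw [map_zero] at hf'
    exact hα ((hθ.isUnit.pow N).mul_left_eq_zero.1 hf')
  have hl := isAwayExtension_localizationAway (k := k) (mul_ne_zero hf hf'0)
  have hl' : IsUnit (IsScalarTower.toAlgHom k _ (Localization.Away (f * f')) f *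
      IsScalarTower.toAlgHom k _ (Localization.Away (f * f')) f') := by
    rw [← map_mul]
    exact hl.isUnit
  obtain ⟨κ, hκ⟩ := hθ.exists_lift (IsScalarTower.toAlgHom k _ (Localization.Away (f * f')))
    (isUnit_of_mul_isUnit_left hl')
  obtain ⟨φ, hφ⟩ := hR.exists_lift (κ.comp α) (by
    have h1 := congrArg κ hf'
    rw [map_mul, map_pow, hκ, hκ] at h1
    exact isUnit_of_mul_isUnit_left (h1 ▸ isUnit_of_mul_isUnit_right hl'))
  obtain ⟨ψ, hψ⟩ := hl.exists_lift (β'.comp θ) (by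
    change IsUnit (β' (θ (f * f')))
    rw [map_mul, ← hf', map_mul, map_mul, map_pow, hβα']
    exact (hθ.isUnit.map β').mul (hR.isUnit.mul ((hθ.isUnit.map β').pow N)))
  refine ⟨inferInstance, R, ?_, n, f * f', φ, ψ, AlgHom.ext fun x => ?_⟩
  · refine IsFractionRing.of_field R (FractionRing H) fun z => ?_
    obtain ⟨x, y, -, rfl⟩ := IsFractionRing.div_surjective (A := H) z
    exact ⟨toAwaySubalgebra w h x, toAwaySubalgebra w h y, rfl⟩
  · refine hR.apply_eq (g := ψ.comp φ) (g' := AlgHom.id k R) (fun y => ?_) x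
    change ψ (φ _) = _
    rw [hφ]
    have h1 : ∀ z, ψ (κ z) = β' z := hθ.apply_eq (g := ψ.comp κ) (g' := β') fun p => by
      change ψ (κ (θ p)) = _
      rw [hκ, hψ]
      rfl
    exact (h1 _).trans (hβα' y)

end Retract

/-! ### Sequences split by lifting the basis of the quotient. -/

section SplitExact

variable {G : Type*} [Group G] {M N : Type*} [AddCommGroup M] [AddCommGroup N]
  {ρ : Representation ℤ G M} {τ : Representation ℤ G N} {T : Type*} [Fintype T] [DecidableEq T]
  [MulAction G T] {i : IntertwiningMap ρ τ} {q : IntertwiningMap τ (permRep G T)} {t : T → N}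

namespace Representation.IsShortExact

lemma exists_eq_add (hiq : IsShortExact i q) (ht : ∀ j, q (t j) = Pi.single j 1) (n : N) :
    ∃ m, i m + ∑ j, q n j • t j = n := by
  obtain ⟨m, hm⟩ := (hiq.apply_eq_zero_iff (n - ∑ j, q n j • t j)).1 (by
    rw [map_sub, map_sum, sub_eq_zero]
    ext j
    simp [ht, Pi.single_apply])
  exact ⟨m, by rw [hm, sub_add_cancel]⟩

lemma exists_addHom {X : Type*} [AddCommGroup X] (hiq : IsShortExact i q)
    (ht : ∀ j, q (t j) = Pi.single j 1) (a : M →+ X) (b : T → X) :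
    ∃ κ : N →+ X, (∀ m, κ (i m) = a m) ∧ ∀ j, κ (t j) = b j := by
  choose l hl using hiq.exists_eq_add ht
  have hl' : ∀ m n, i m + ∑ j, q n j • t j = n → l n = m := fun m n h =>
    hiq.injective (add_right_cancel ((hl n).trans h.symm))
  refine ⟨AddMonoidHom.mk' (fun n => a (l n) + ∑ j, q n j • b j) fun n n' => ?_, fun m => ?_,
    fun j => ?_⟩
  · have h : l (n + n') = l n + l n' := hl' _ _ (by
      conv_rhs => rw [← hl n, ← hl n']
      simp only [map_add, Pi.add_apply, add_smul, Finset.sum_add_distrib]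
      abel)
    rw [h]
    simp only [map_add, Pi.add_apply, add_smul, Finset.sum_add_distrib]
    abel
  · have h : l (i m) = m := hl' _ _ (by simp [hiq.apply_apply])
    change a (l (i m)) + ∑ j, q (i m) j • b j = a m
    simp [h, hiq.apply_apply]
  · have h : l (t j) = 0 := hl' _ _ (by simp [ht, Pi.single_apply])
    change a (l (t j)) + ∑ j', q (t j) j' • b j' = b j
    simp [h, ht, Pi.single_apply]

lemma mem_of_mem (hiq : IsShortExact i q) (ht : ∀ j, q (t j) = Pi.single j 1) {A : AddSubgroup N}
    (hi : ∀ m, i m ∈ A) (htA : ∀ j, t j ∈ A) (n : N) : n ∈ A := by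
  obtain ⟨m, hm⟩ := hiq.exists_eq_add ht n
  rw [← hm]
  exact add_mem (hi m) (sum_mem fun j _ => zsmul_mem (htA j) _)

end Representation.IsShortExact

end SplitExact

section Retract

variable {k : Type*} [Field k] {L : Type*} [Field L] [Algebra k L]
  {M N : Type*} [AddCommGroup M] [AddCommGroup N] [IsDomain (AddMonoidAlgebra L M)]
  {ρ : Representation ℤ (L ≃ₐ[k] L) M} {τ : Representation ℤ (L ≃ₐ[k] L) N} {T : Type*} [Fintype T]
  [DecidableEq T] [MulAction (L ≃ₐ[k] L) T] {i : IntertwiningMap ρ τ}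
  {q : IntertwiningMap τ (permRep (L ≃ₐ[k] L) T)} {t : T → N}

/-- Specialize the coordinates `g j * t j` to `1`, that is, send the monomial of `t j` to the
inverse of `g j`. When Galois permutes these coordinates the specialization is equivariant, so it
will descend to `k`. -/
lemma exists_algHom_fractionRing (hiq : IsShortExact i q) (ht : ∀ j, q (t j) = Pi.single j 1)
    {g : T → AddMonoidAlgebra L M} (hg : ∀ j, g j ≠ 0) :
    ∃ γ : AddMonoidAlgebra L N →ₐ[L] FractionRing (AddMonoidAlgebra L M),
      (∀ x, γ (latticeMap i x) = algebraMap _ _ x) ∧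
        ∀ j, γ (latticeMap i (g j) * single (t j) 1) = 1 := by
  let Ω := FractionRing (AddMonoidAlgebra L M)
  have hgΩ : ∀ j, algebraMap (AddMonoidAlgebra L M) Ω (g j) ≠ 0 := fun j =>
    (map_ne_zero_iff _ (IsFractionRing.injective _ _)).2 (hg j)
  let a : M →+ Additive Ωˣ := MonoidHom.toAdditiveRight
    ((Units.map (algebraMap (AddMonoidAlgebra L M) Ω : _ →* Ω)).comp
      (MonoidHom.toHomUnits (AddMonoidAlgebra.of L M)))
  have ha : ∀ m, (a m).toMul.1 = algebraMap (AddMonoidAlgebra L M) Ω (single m 1) := fun _ => rfl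
  obtain ⟨κ, hκi, hκt⟩ := hiq.exists_addHom ht a fun j => -Additive.ofMul (Units.mk0 _ (hgΩ j))
  let γ := AddMonoidAlgebra.lift L Ω N ((Units.coeHom Ω).comp (AddMonoidHom.toMultiplicativeLeft κ))
  have hγ : ∀ n c, γ (single n c) = algebraMap L Ω c * (κ n).toMul.1 := fun n c => by
    simp only [γ]
    rw [AddMonoidAlgebra.lift_single, Algebra.smul_def]
    rfl
  have hγi : ∀ x, γ (latticeMap i x) = algebraMap _ _ x := fun x => by
    induction x using induction_linear with
    | zero => simp
    | add x y hx hy => simp only [map_add, hx, hy]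
    | single m c =>
      have : (single m c : AddMonoidAlgebra L M) = algebraMap L _ c * single m 1 := by
        change _ = single 0 c * _
        rw [single_mul_single, zero_add, mul_one]
      rw [latticeMap_single, hγ, hκi, ha, this, map_mul, ← IsScalarTower.algebraMap_apply]
  refine ⟨γ, hγi, fun j => ?_⟩
  rw [map_mul, hγi, hγ, hκt, map_one, one_mul]
  exact mul_inv_cancel₀ (hgΩ j)

/-- The exponents whose monomial and inverse monomial have image in `L[M][1/h]` form a subgroup. It
contains `M`, and it contains `t j` because its monomial goes to `1 / g j` with `g j ∣ h`. -/
lemma apply_mem_awaySubalgebra (hiq : IsShortExact i q) (ht : ∀ j, q (t j) = Pi.single j 1)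
    {g : T → AddMonoidAlgebra L M}
    {γ : AddMonoidAlgebra L N →ₐ[L] FractionRing (AddMonoidAlgebra L M)}
    (hγi : ∀ x, γ (latticeMap i x) = algebraMap _ _ x)
    (hγt : ∀ j, γ (latticeMap i (g j) * single (t j) 1) = 1) {h : AddMonoidAlgebra L M}
    (hh : h ≠ 0) (hgh : ∀ j, g j ∣ h) (y : AddMonoidAlgebra L N) :
    γ y ∈ awaySubalgebra (IsScalarTower.toAlgHom L (AddMonoidAlgebra L M)
      (FractionRing (AddMonoidAlgebra L M))) h := by
  let w := IsScalarTower.toAlgHom L (AddMonoidAlgebra L M) (FractionRing (AddMonoidAlgebra L M))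
  have hw : Function.Injective w := IsFractionRing.injective _ _
  have hwγ : ∀ x, γ (latticeMap i x) = w x := hγi
  let R := awaySubalgebra w h
  have hwR : ∀ x, w x ∈ R := fun x => range_le_awaySubalgebra w h ⟨x, rfl⟩
  have hneg : ∀ n, γ (single n 1) * γ (single (-n) 1) = 1 := fun n => by
    rw [← map_mul, single_mul_single, add_neg_cancel, one_mul, ← one_def, map_one]
  let A : AddSubgroup N :=
    { carrier := {n | γ (single n 1) ∈ R ∧ γ (single (-n) 1) ∈ R}
      zero_mem' := by
        rw [Set.mem_ofPred_eq, neg_zero, ← one_def, map_one]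
        exact ⟨one_mem R, one_mem R⟩
      add_mem' := by
        rintro n n' ⟨h₁, h₂⟩ ⟨h₁', h₂'⟩
        rw [Set.mem_ofPred_eq, neg_add, ← one_mul (1 : L), ← single_mul_single, ← single_mul_single,
          map_mul, map_mul]
        exact ⟨mul_mem h₁ h₁', mul_mem h₂ h₂'⟩
      neg_mem' := by
        rintro n ⟨h₁, h₂⟩
        exact ⟨h₂, by rwa [neg_neg]⟩ }
  have hA : ∀ n, n ∈ A := hiq.mem_of_mem ht (fun m => by
      refine ⟨?_, ?_⟩
      · rw [← latticeMap_single, hwγ]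
        exact hwR _
      · rw [← map_neg, ← latticeMap_single, hwγ]
        exact hwR _) (fun j => by
      have h1 := hγt j
      rw [map_mul, hwγ] at h1
      have h2 : γ (single (t j) 1) = (w (g j))⁻¹ := eq_inv_of_mul_eq_one_right h1
      have h3 : γ (single (-t j) 1) = w (g j) := by
        have h4 := hneg (t j)
        have h5 : γ (single (t j) 1) ≠ 0 := left_ne_zero_of_mul_eq_one h4
        exact mul_left_cancel₀ h5 (h4.trans ((mul_comm _ _).trans h1).symm)
      refine ⟨?_, ?_⟩
      · rw [h2]
        exact inv_mem_awaySubalgebra w ((map_ne_zero_iff w hw).2 hh) (hgh j)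
      · rw [h3]
        exact hwR _)
  induction y using induction_linear with
  | zero => rw [map_zero]; exact zero_mem R
  | add x y hx hy => rw [map_add]; exact add_mem hx hy
  | single n c =>
    have : (single n c : AddMonoidAlgebra L N) = algebraMap L _ c * single n 1 := by
      change _ = single 0 c * _
      rw [single_mul_single, zero_add, mul_one]
    rw [this, map_mul, AlgHom.commutes]
    exact mul_mem (R.algebraMap_mem c) (hA n).1

/-- The action of the Galois group on the fraction field of the group algebra. -/
def semilinearFraction (ρ : Representation ℤ (L ≃ₐ[k] L) M) (σ : L ≃ₐ[k] L) :
    FractionRing (AddMonoidAlgebra L M) →+* FractionRing (AddMonoidAlgebra L M) :=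
  IsFractionRing.lift (g := (algebraMap (AddMonoidAlgebra L M) (FractionRing (AddMonoidAlgebra L M))).comp
    (semilinearMap k σ (ρ σ) : AddMonoidAlgebra L M →+* AddMonoidAlgebra L M))
    fun _ _ h => semilinearMap_injective σ (IsFractionRing.injective _ _ h)

lemma semilinearFraction_algebraMap (σ : L ≃ₐ[k] L) (x : AddMonoidAlgebra L M) :
    semilinearFraction ρ σ (algebraMap _ _ x) = algebraMap _ _ (semilinearMap k σ (ρ σ) x) :=
  IsFractionRing.lift_algebraMap _ x

/-- Equivariance need only be checked on the constants, on the image of `M` and on the `t j`. For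
the last, both sides are inverse to the same element, as all `g j * t j` go to `1`. -/
lemma semilinearFraction_apply (hiq : IsShortExact i q) (ht : ∀ j, q (t j) = Pi.single j 1)
    {g : T → AddMonoidAlgebra L M}
    (hgt : ∀ (σ : L ≃ₐ[k] L) j, semilinearMap k σ (τ σ) (latticeMap i (g j) * single (t j) 1) =
      latticeMap i (g (σ • j)) * single (t (σ • j)) 1)
    {γ : AddMonoidAlgebra L N →ₐ[L] FractionRing (AddMonoidAlgebra L M)}
    (hγi : ∀ x, γ (latticeMap i x) = algebraMap _ _ x)
    (hγt : ∀ j, γ (latticeMap i (g j) * single (t j) 1) = 1) (σ : L ≃ₐ[k] L)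
    (y : AddMonoidAlgebra L N) :
    semilinearFraction ρ σ (γ y) = γ (semilinearMap k σ (τ σ) y) := by
  have hconst : ∀ c : L, semilinearFraction ρ σ (γ (algebraMap L _ c)) =
      γ (semilinearMap k σ (τ σ) (algebraMap L _ c)) := fun c => by
    rw [semilinearMap_algebraMap, AlgHom.commutes, AlgHom.commutes, IsScalarTower.algebraMap_apply
      L (AddMonoidAlgebra L M), semilinearFraction_algebraMap, semilinearMap_algebraMap,
      ← IsScalarTower.algebraMap_apply]
  have hi : ∀ x, semilinearFraction ρ σ (γ (latticeMap i x)) =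
      γ (semilinearMap k σ (τ σ) (latticeMap i x)) := fun x => by
    rw [hγi, semilinearFraction_algebraMap, semilinearMap_latticeMap, hγi]
  let A : AddSubgroup N :=
    { carrier := {n | semilinearFraction ρ σ (γ (single n 1)) =
        γ (semilinearMap k σ (τ σ) (single n 1))}
      zero_mem' := by
        rw [Set.mem_ofPred_eq, ← one_def]
        simp only [map_one]
      add_mem' := by
        intro n n' h h'
        rw [Set.mem_ofPred_eq] at h h' ⊢
        rw [← one_mul (1 : L), ← single_mul_single]
        simp only [map_mul, h, h']
      neg_mem' := by
        intro n h
        rw [Set.mem_ofPred_eq] at h ⊢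
        have h1 : (single n 1 * single (-n) 1 : AddMonoidAlgebra L N) = 1 := by
          rw [single_mul_single, add_neg_cancel, one_mul, ← one_def]
        have h2 : γ (semilinearMap k σ (τ σ) (single n 1)) *
            γ (semilinearMap k σ (τ σ) (single (-n) 1)) = 1 := by
          rw [← map_mul, ← map_mul, h1, map_one, map_one]
        refine mul_left_cancel₀ (left_ne_zero_of_mul_eq_one h2) ?_
        rw [h2, ← h, ← map_mul, ← map_mul, h1, map_one, map_one] }
  have hA : ∀ n, n ∈ A := hiq.mem_of_mem ht (fun m => by
      have h1 := hi (single m 1)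
      rwa [latticeMap_single] at h1) fun j => by
    have h1 := hγt j
    have h2 : γ (semilinearMap k σ (τ σ) (latticeMap i (g j) * single (t j) 1)) = 1 := by
      rw [hgt, hγt]
    rw [map_mul, map_mul, ← hi] at h2
    have h3 := congrArg (semilinearFraction ρ σ) h1
    rw [map_mul, map_mul, map_one] at h3
    exact mul_left_cancel₀ (left_ne_zero_of_mul_eq_one h3) (h3.trans h2.symm)
  induction y using induction_linear with
  | zero => simp
  | add x y hx hy => simp only [map_add, hx, hy]
  | single n c =>
    have : (single n c : AddMonoidAlgebra L N) = algebraMap L _ c * single n 1 := by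
      change _ = single 0 c * _
      rw [single_mul_single, zero_add, mul_one]
    rw [this]
    have h1 : semilinearFraction ρ σ (γ (single n 1)) =
      γ (semilinearMap k σ (τ σ) (single n 1)) := hA n
    rw [map_mul, map_mul, map_mul, map_mul, hconst, h1]

variable [FiniteDimensional k L] [IsGalois k L]

/-- A torus is a retract of a localization of a larger torus if the quotient of the character
lattices is a permutation lattice. -/
lemma exists_retraction_torusOfLattice (hiq : IsShortExact i q) :
    ∃ (h : torusOfLattice k L ρ)
      (β : torusOfLattice k L τ →ₐ[k] FractionRing (torusOfLattice k L ρ)), h ≠ 0 ∧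
      (∀ x, β x ∈ awaySubalgebra (IsScalarTower.toAlgHom k (torusOfLattice k L ρ)
        (FractionRing (torusOfLattice k L ρ))) h) ∧
      ∀ x, β (torusOfLatticeMap i x) = algebraMap _ _ x := by
  choose t ht using fun j => hiq.surjective (Pi.single j 1)
  obtain ⟨g, hg, hgt⟩ := exists_twist hiq ht
  obtain ⟨γ, hγi, hγt⟩ := exists_algHom_fractionRing hiq ht hg
  let H := torusOfLattice k L ρ
  let E := FractionRing H
  let Ω := FractionRing (AddMonoidAlgebra L M)
  let w : AddMonoidAlgebra L M →ₐ[k] Ω := IsScalarTower.toAlgHom k _ _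
  have hw : Function.Injective w := IsFractionRing.injective _ _
  have hwH : Function.Injective (w.comp H.val) := fun x y h => Subtype.ext (hw h)
  let J : E →ₐ[k] Ω := IsFractionRing.liftAlgHom (g := w.comp H.val) hwH
  have hJ : ∀ x : H, J (algebraMap H E x) = w x.1 := fun x =>
    IsFractionRing.lift_algebraMap (g := (w.comp H.val).toRingHom) hwH x
  -- The product of the conjugates of `h₀` is an invariant denominator divisible by every `g j`.
  let h₀ : AddMonoidAlgebra L M := ∏ j, g j
  have hh₀ : h₀ ≠ 0 := Finset.prod_ne_zero_iff.2 fun j _ => hg j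
  let h : H := ⟨_, prod_semilinearMap_mem (k := k) (ρ := ρ) h₀⟩
  have hh : h.1 ≠ 0 := Finset.prod_ne_zero_iff.2 fun σ _ =>
    (map_ne_zero_iff _ (semilinearMap_injective σ)).2 hh₀
  have hh' : h ≠ 0 := fun h0 => hh (congrArg Subtype.val h0)
  have hgh : ∀ j, g j ∣ h.1 := fun j =>
    (Finset.dvd_prod_of_mem g (Finset.mem_univ j)).trans (dvd_prod_semilinearMap h₀)
  have key : ∀ y : torusOfLattice k L τ, ∃ x : E, J x = γ y.1 ∧
      x ∈ awaySubalgebra (IsScalarTower.toAlgHom k H E) h := fun y => by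
    obtain ⟨n, d, hd⟩ := apply_mem_awaySubalgebra hiq ht hγi hγt hh hgh y.1
    change γ y.1 * w h.1 ^ n = w d at hd
    -- Both the image of `y` and the denominator are invariant, hence so is the numerator, and the
    -- fraction already lies in the fraction field of the invariants.
    have hdH : d ∈ H := mem_torusOfLattice.2 fun σ => hw (by
      have h1 := congrArg (semilinearFraction ρ σ) hd
      rw [map_mul, map_pow, semilinearFraction_apply hiq ht hgt hγi hγt,
        mem_torusOfLattice.1 y.2 σ] at h1
      have h2 : ∀ x, semilinearFraction ρ σ (w x) = w (semilinearMap k σ (ρ σ) x) :=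
        semilinearFraction_algebraMap σ
      rw [h2, h2, mem_torusOfLattice.1 h.2 σ, hd] at h1
      exact h1.symm)
    have hE : algebraMap H E h ≠ 0 :=
      (map_ne_zero_iff _ (IsFractionRing.injective H E)).2 hh'
    have hwh : w h.1 ≠ 0 := (map_ne_zero_iff w hw).2 hh
    refine ⟨algebraMap H E ⟨d, hdH⟩ / algebraMap H E h ^ n, ?_, n, ⟨d, hdH⟩, ?_⟩
    · rw [map_div₀, map_pow, hJ, hJ, ← hd]
      exact mul_div_cancel_right₀ _ (pow_ne_zero n hwh)
    · exact div_mul_cancel₀ _ (pow_ne_zero n hE)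
  let χ : torusOfLattice k L τ →ₐ[k] Ω := (γ.restrictScalars k).comp (torusOfLattice k L τ).val
  let JE := AlgEquiv.ofInjective J J.toRingHom.injective
  let β : torusOfLattice k L τ →ₐ[k] E := JE.symm.toAlgHom.comp
    (χ.codRestrict J.range fun y => (key y).imp fun x hx => hx.1)
  have hβ : ∀ y, J (β y) = γ y.1 := fun y =>
    congrArg Subtype.val (JE.apply_symm_apply (χ.codRestrict J.range _ y))
  refine ⟨h, β, hh', fun y => ?_, fun x => J.toRingHom.injective ?_⟩
  · obtain ⟨x, hx, hxh⟩ := key y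
    rwa [J.toRingHom.injective ((hβ y).trans hx.symm)]
  · exact (hβ _).trans ((hγi x.1).trans (hJ x).symm)

end Retract

section Main

variable {k : Type*} [Field k] {L : Type*} [Field L] [Algebra k L] [FiniteDimensional k L]
  [IsGalois k L] {M : Type*} [AddCommGroup M] [Module.Free ℤ M] [Module.Finite ℤ M]
  {ρ : Representation ℤ (L ≃ₐ[k] L) M}

/-- A torus whose character lattice has a resolution by invertible lattices is retract rational. -/
theorem Representation.HasResolution.isRetractRational
    (h : HasResolution (fun _ _ (ρ : Representation ℤ (L ≃ₐ[k] L) _) => IsInvertible ρ) ρ) :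
    IsRetractRational k (torusOfLattice k L ρ) := by
  classical
  obtain ⟨N, _, τ, T, _, _, i, q, ⟨S, _, _, j, r, hrj⟩, hiq⟩ := h.exists_invertible
  have := Fintype.ofFinite S
  have := Fintype.ofFinite T
  have := isDomain_of_free L M
  obtain ⟨h, β, hh, hβ, hβi⟩ := exists_retraction_torusOfLattice hiq
  obtain ⟨θ, f, hf, hθ⟩ := exists_isAwayExtension_permRep k L S
  let e := MvPolynomial.renameEquiv k (Fintype.equivFin S).symm
  have hθ' : IsAwayExtension (θ.comp e.toAlgHom) (e.symm f) :=
    { injective := hθ.injective.comp e.injective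
      isUnit := by
        change IsUnit (θ (e (e.symm f)))
        rw [e.apply_symm_apply]
        exact hθ.isUnit
      exists_mul_pow_eq := fun x => by
        obtain ⟨n, d, hd⟩ := hθ.exists_mul_pow_eq x
        refine ⟨n, e.symm d, ?_⟩
        change x * θ (e (e.symm f)) ^ n = θ (e (e.symm d))
        rw [e.apply_symm_apply, e.apply_symm_apply, hd] }
  have hα : Function.Injective (torusOfLatticeMap (k := k) (j.comp i)) := fun x y hxy =>
    Subtype.ext (latticeMap_injective (i := j.comp i) (fun a b hab => hiq.injective (by
      have h1 : j (i a) = j (i b) := hab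
      rw [← hrj (i a), h1, hrj])) (congrArg Subtype.val hxy))
  -- Go from the torus into the quasi-trivial one by `j ∘ i`, and back by `r` followed by `β`. Since
  -- `r j = 1` this is `β` after the map of `i`, which is the identity up to the embedding in the
  -- fraction field.
  refine isRetractRational_of_isAwayExtension ((map_ne_zero_iff _ e.symm.injective).2 hf) hθ'
    (torusOfLatticeMap (j.comp i)) hh ((map_ne_zero_iff _ hα).2 hh)
    (β.comp (torusOfLatticeMap r)) (fun x => hβ _) fun x => ?_
  rw [← hβi]
  refine congrArg β (Subtype.ext ?_)
  change latticeMap r (latticeMap (j.comp i) x.1) = latticeMap i x.1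
  induction x.1 using induction_linear with
  | zero => simp
  | add x y hx hy => simp only [map_add, hx, hy]
  | single m c =>
    simp only [latticeMap_single]
    congr 1
    exact hrj (i m)

end Main

/-! ### Splitting a finite algebra by its homomorphisms to a field. -/

section HomAction

variable {k A L : Type*} [CommSemiring k] [Semiring A] [Algebra k A] [Semiring L] [Algebra k L]

instance AlgEquiv.mulActionAlgHom : MulAction (L ≃ₐ[k] L) (A →ₐ[k] L) where
  smul σ x := (σ : L →ₐ[k] L).comp x
  one_smul _ := rfl
  mul_smul _ _ _ := rfl

lemma AlgEquiv.smul_algHom_apply (σ : L ≃ₐ[k] L) (x : A →ₐ[k] L) (a : A) :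
    (σ • x) a = σ (x a) := rfl

end HomAction

/-- The norm of a finite power of a ring is the product of the coordinates. -/
lemma Algebra.norm_pi {R X : Type*} [CommRing R] [Fintype X] (f : X → R) :
    Algebra.norm R f = ∏ x, f x := by
  classical
  rw [Algebra.norm_eq_matrix_det (Pi.basisFun R X), ← Matrix.det_diagonal]
  congr 1
  ext i j
  rw [Algebra.leftMulMatrix_eq_repr_mul]
  by_cases h : i = j
  · subst h; simp
  · simp [h]

section EvalHoms

variable {k : Type*} [Field k] {A : Type*} [CommRing A] [Algebra k A]
  {L : Type*} [Field L] [Algebra k L]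

section Defs

variable (k A L) (R : Type*) [CommRing R] [Algebra k R] [Algebra L R] [IsScalarTower k L R]

/-- The homomorphism from `R ⊗ A` to a power of the `L`-algebra `R` given by all homomorphisms from
`A` to `L`. -/
def evalHoms : R ⊗[k] A →ₐ[R] ((A →ₐ[k] L) → R) :=
  Algebra.TensorProduct.lift (Algebra.ofId R _)
    (AlgHom.pi (R := k) fun x => (IsScalarTower.toAlgHom k L R).comp x)
    fun _ _ => Commute.all _ _

variable {R}

@[simp]
lemma evalHoms_tmul (r : R) (a : A) (x : A →ₐ[k] L) :
    evalHoms k A L R (r ⊗ₜ a) x = r * algebraMap L R (x a) := rfl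

lemma map_evalHoms {S : Type*} [CommRing S] [Algebra k S] [Algebra L S] [IsScalarTower k L S]
    (σ : L ≃ₐ[k] L) (f : R →ₐ[k] S)
    (hf : ∀ c, f (algebraMap L R c) = algebraMap L S (σ c)) (z : R ⊗[k] A) (x : A →ₐ[k] L) :
    evalHoms k A L S (Algebra.TensorProduct.map f (AlgHom.id k A) z) (σ • x) =
      f (evalHoms k A L R z x) := by
  induction z with
  | zero => simp
  | add z w hz hw => simp only [map_add, Pi.add_apply, hz, hw]
  | tmul r a => simp [hf, AlgEquiv.smul_algHom_apply]

end Defs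

variable [Module.Finite k A]

/-- A functional that vanishes on the image is a linear relation between the homomorphisms `A → L`,
hence zero by Dedekind's theorem. -/
lemma evalHoms_self_surjective : Function.Surjective (evalHoms k A L L) := by
  classical
  have : Finite (A →ₐ[k] L) := (linearIndependent_toLinearMap k A L).finite
  have := Fintype.ofFinite (A →ₐ[k] L)
  refine (LinearMap.dualMap_injective_iff (f := (evalHoms k A L L).toLinearMap)).1
    ((injective_iff_map_eq_zero _).2 fun φ hφ => ?_)
  have h := Fintype.linearIndependent_iff.1 (linearIndependent_toLinearMap k A L)
    (fun x => φ (Pi.single x 1)) (LinearMap.ext fun a => by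
      have h1 : φ (evalHoms k A L L (1 ⊗ₜ a)) = 0 := LinearMap.congr_fun hφ (1 ⊗ₜ a)
      rw [LinearMap.pi_apply_eq_sum_univ φ] at h1
      simp only [evalHoms_tmul, one_mul, Algebra.algebraMap_self, RingHom.id_apply,
        smul_eq_mul] at h1
      simp only [LinearMap.coe_sum, Finset.sum_apply, LinearMap.smul_apply,
        AlgHom.toLinearMap_apply, smul_eq_mul, LinearMap.zero_apply]
      rw [← h1]
      refine Finset.sum_congr rfl fun x _ => ?_
      rw [mul_comm]
      congr 2
      ext y
      simp [Pi.single_apply, eq_comm])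
  refine LinearMap.pi_ext fun x c => ?_
  have : (Pi.single x c : (A →ₐ[k] L) → L) = c • Pi.single x 1 := by
    ext y; by_cases hy : y = x
    · subst hy; simp
    · simp [hy]
  rw [this, map_smul, h x, smul_zero, map_smul, LinearMap.zero_apply, smul_zero]

variable (hX : Nat.card (A →ₐ[k] L) = Module.finrank k A)
include hX

lemma evalHoms_self_bijective : Function.Bijective (evalHoms k A L L) := by
  have : Finite (A →ₐ[k] L) := (linearIndependent_toLinearMap k A L).finite
  have := Fintype.ofFinite (A →ₐ[k] L)
  have hs : Function.Surjective (evalHoms k A L L).toLinearMap := evalHoms_self_surjective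
  refine ⟨(LinearMap.injective_iff_surjective_of_finrank_eq_finrank ?_).2 hs, hs⟩
  rw [Module.finrank_baseChange, Module.finrank_fintype_fun_eq_card, ← hX,
    Nat.card_eq_fintype_card]

variable (R : Type*) [CommRing R] [Algebra k R] [Algebra L R] [IsScalarTower k L R]

lemma evalHoms_bijective : Function.Bijective (evalHoms k A L R) := by
  classical
  have : Finite (A →ₐ[k] L) := (linearIndependent_toLinearMap k A L).finite
  have := Fintype.ofFinite (A →ₐ[k] L)
  let e : R ⊗[k] A ≃ₐ[R] ((A →ₐ[k] L) → R) :=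
    (Algebra.TensorProduct.cancelBaseChange k L R R A).symm.trans
      ((Algebra.TensorProduct.congr AlgEquiv.refl
        (AlgEquiv.ofBijective _ (evalHoms_self_bijective hX))).trans
        (Algebra.TensorProduct.piScalarRight L R R (A →ₐ[k] L)))
  have he : ∀ z, evalHoms k A L R z = e z := fun z => by
    induction z with
    | zero => simp
    | add z w hz hw => rw [map_add, map_add, hz, hw]
    | tmul r a =>
      ext x
      simp [e, Algebra.smul_def, mul_comm]
  have : (evalHoms k A L R : R ⊗[k] A → _) = e := funext he
  rw [this]
  exact e.bijective

lemma norm_eq_prod_evalHoms [Fintype (A →ₐ[k] L)] (z : R ⊗[k] A) :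
    Algebra.norm R z = ∏ x, evalHoms k A L R z x := by
  rw [← Algebra.norm_pi, ← Algebra.norm_eq_of_algEquiv
    (AlgEquiv.ofBijective _ (evalHoms_bijective hX R)) z]
  rfl

end EvalHoms

/-- The quotient is generated by the classes of the points of `X`, subject only to the relation that
they sum to zero. -/
lemma Representation.IsNormOneQuotient.exists_addMonoidHom {G X M B : Type*} [Group G]
    [MulAction G X] [AddCommGroup M] [AddCommGroup B] {ρ : Representation ℤ G M}
    {π : IntertwiningMap (permRep G X) ρ} [Fintype X] [DecidableEq X] (hπ : IsNormOneQuotient π)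
    (u : X → B) (hu : ∑ x, u x = 0) : ∃ g : M →+ B, ∀ x, g (π (Pi.single x 1)) = u x := by
  let h : (X → ℤ) →+ B :=
    { toFun := fun f => ∑ x, f x • u x
      map_zero' := by simp
      map_add' := fun f g => by simp [add_smul, Finset.sum_add_distrib] }
  let g := π.toLinearMap.toAddMonoidHom.liftOfSurjective hπ.surjective ⟨h, fun f hf => by
    obtain ⟨c, hc⟩ := (hπ.apply_eq_zero_iff f).1 hf
    change ∑ x, f x • u x = 0
    simp only [hc]
    rw [← Finset.smul_sum, hu, smul_zero]⟩
  have hg : ∀ f, g (π f) = h f := fun f =>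
    π.toLinearMap.toAddMonoidHom.liftOfRightInverse_comp_apply _ _ _ f
  refine ⟨g, fun x => (hg _).trans ?_⟩
  change ∑ y, (Pi.single x 1 : X → ℤ) y • u y = _
  rw [Finset.sum_eq_single x (fun y _ hy => by simp [hy]) (by simp)]
  simp

/-! ### Coordinates of a split norm one torus. -/

namespace NormOneTorus

variable {k : Type*} [Field k] {A : Type*} [CommRing A] [Algebra k A] [Module.Finite k A]
  {L : Type*} [Field L] [Algebra k L]

/-- The norm of the universal point, under a homomorphism from `A` to `L`. -/
def coord (x : A →ₐ[k] L) : L ⊗[k] NormOneTorus k A :=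
  evalHoms k A L _ (eval Algebra.TensorProduct.includeRight) x

section AlgHom

variable {S : Type*} [CommRing S] [Algebra k S] [Algebra L S] [IsScalarTower k L S]

/-- Allowing a twist `σ` covers both the Galois action and the `L`-linear structure maps, where `σ =
1`: in each case the image of a coordinate is read off from the point that the homomorphism defines.
-/
lemma apply_coord (σ : L ≃ₐ[k] L) (f : L ⊗[k] NormOneTorus k A →ₐ[k] S)
    (hf : ∀ c, f (algebraMap L _ c) = algebraMap L S (σ c)) (x : A →ₐ[k] L) :
    f (coord x) =
      evalHoms k A L S (eval (f.comp Algebra.TensorProduct.includeRight)) (σ • x) := by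
  rw [eval_comp, map_evalHoms k A L σ f hf]
  rfl

lemma galoisTensor_coord (σ : L ≃ₐ[k] L) (x : A →ₐ[k] L) :
    galoisTensor L (NormOneTorus k A) σ (coord x) = coord (σ • x) := by
  refine (apply_coord σ (galoisAct σ) (fun c => by simp [galoisAct]) x).trans ?_
  have h : (galoisAct (L := L) (H := NormOneTorus k A) σ).comp
      Algebra.TensorProduct.includeRight = Algebra.TensorProduct.includeRight :=
    AlgHom.ext fun z => by simp [galoisAct]
  rw [h]
  rfl

/-- The coordinates determine the point of norm one, by bijectivity of `evalHoms`, and the point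
determines the homomorphism. -/
lemma algHom_ext_coord (hX : Nat.card (A →ₐ[k] L) = Module.finrank k A) (σ : L ≃ₐ[k] L)
    {f g : L ⊗[k] NormOneTorus k A →ₐ[k] S}
    (hf : ∀ c, f (algebraMap L _ c) = algebraMap L S (σ c))
    (hg : ∀ c, g (algebraMap L _ c) = algebraMap L S (σ c))
    (h : ∀ x, f (coord x) = g (coord x)) : f = g := by
  have h1 : f.comp Algebra.TensorProduct.includeRight =
      g.comp Algebra.TensorProduct.includeRight :=
    eval_injective ((evalHoms_bijective hX S).1 (funext fun x => by
      have := h (σ⁻¹ • x)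
      rwa [apply_coord σ f hf, apply_coord σ g hg, smul_inv_smul] at this))
  refine Algebra.TensorProduct.ext' fun a z => ?_
  have : a ⊗ₜ[k] z = algebraMap L _ a * Algebra.TensorProduct.includeRight z := by simp
  rw [this, map_mul, map_mul, hf, hg]
  exact congrArg _ (AlgHom.congr_fun h1 z)

lemma algHom_ext_coord_one (hX : Nat.card (A →ₐ[k] L) = Module.finrank k A)
    {f g : L ⊗[k] NormOneTorus k A →ₐ[L] S} (h : ∀ x, f (coord x) = g (coord x)) : f = g := by
  have := algHom_ext_coord hX 1 (f := f.restrictScalars k) (g := g.restrictScalars k)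
    (fun c => f.commutes c) (fun c => g.commutes c) h
  exact AlgHom.ext fun z => AlgHom.congr_fun this z

end AlgHom

lemma prod_coord (hX : Nat.card (A →ₐ[k] L) = Module.finrank k A) [Fintype (A →ₐ[k] L)] :
    ∏ x : A →ₐ[k] L, coord x = 1 := by
  rw [← norm_eval (Algebra.TensorProduct.includeRight : _ →ₐ[k] L ⊗[k] NormOneTorus k A),
    norm_eq_prod_evalHoms hX]
  rfl

-- The comultiplication multiplies the two universal points, and taking a coordinate is
-- multiplicative in the point, so each coordinate is a character.
open Coalgebra in
lemma isGroupLikeElem_coord (x : A →ₐ[k] L) : IsGroupLikeElem L (coord x) where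
  counit_eq_one := by
    refine (apply_coord 1 ((Bialgebra.counitAlgHom L
      (L ⊗[k] NormOneTorus k A)).restrictScalars k) (fun c => by simp) x).trans ?_
    have h : ((Bialgebra.counitAlgHom L (L ⊗[k] NormOneTorus k A)).restrictScalars k).comp
        Algebra.TensorProduct.includeRight = (Algebra.ofId k L).comp (counitHom k A) := by
      ext z
      simp [Algebra.ofId_apply]
      rfl
    rw [h, eval_comp_counitHom, map_one]
    rfl
  comul_eq_tmul_self := by
    let T := (L ⊗[k] NormOneTorus k A) ⊗[L] (L ⊗[k] NormOneTorus k A)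
    let j₁ : L ⊗[k] NormOneTorus k A →ₐ[k] T :=
      (Algebra.TensorProduct.includeLeft : _ →ₐ[L] T).restrictScalars k
    let j₂ : L ⊗[k] NormOneTorus k A →ₐ[k] T :=
      (Algebra.TensorProduct.includeRight : _ →ₐ[L] T).restrictScalars k
    let i : NormOneTorus k A →ₐ[k] L ⊗[k] NormOneTorus k A := Algebra.TensorProduct.includeRight
    let f : NormOneTorus k A ⊗[k] NormOneTorus k A →ₐ[k] T :=
      Algebra.TensorProduct.lift (j₁.comp i) (j₂.comp i) fun _ _ => Commute.all _ _
    have hf₁ : f.comp Algebra.TensorProduct.includeLeft = j₁.comp i := by ext z; simp [f]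
    have hf₂ : f.comp Algebra.TensorProduct.includeRight = j₂.comp i := by ext z; simp [f]
    let δ : L ⊗[k] NormOneTorus k A →ₐ[k] T :=
      (Bialgebra.comulAlgHom L (L ⊗[k] NormOneTorus k A)).restrictScalars k
    have hδ : δ.comp i = f.comp (comulHom k A) := by
      ext z
      change comul (R := L) ((1 : L) ⊗ₜ[k] z) = f (comul (R := k) z)
      simp only [TensorProduct.comul_tmul]
      induction comul (R := k) z with
      | zero => simp
      | add x y hx hy => simp only [TensorProduct.tmul_add, map_add, hx, hy]
      | tmul x y =>
        refine Eq.trans ?_ (Algebra.TensorProduct.lift_tmul _ _ (fun _ _ => Commute.all _ _)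
          x y).symm
        refine Eq.trans ?_ (Algebra.TensorProduct.tmul_mul_tmul _ _ _ _).symm
        rw [mul_one, one_mul]
        simp [i]
    have h₁ := apply_coord 1 j₁ (fun c => (Algebra.TensorProduct.includeLeft :
      L ⊗[k] NormOneTorus k A →ₐ[L] T).commutes c) x
    have h₂ := apply_coord 1 j₂ (fun c => (Algebra.TensorProduct.includeRight :
      L ⊗[k] NormOneTorus k A →ₐ[L] T).commutes c) x
    refine (apply_coord 1 δ (fun c => (Bialgebra.comulAlgHom L
      (L ⊗[k] NormOneTorus k A)).commutes c) x).trans ?_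
    change evalHoms k A L T (eval (δ.comp i)) (1 • x) = _
    rw [hδ, eval_comp_comulHom, hf₁, hf₂, map_mul, Pi.mul_apply]
    change j₁ _ = evalHoms k A L T (eval (j₁.comp i)) (1 • x) at h₁
    change j₂ _ = evalHoms k A L T (eval (j₂.comp i)) (1 • x) at h₂
    rw [← h₁, ← h₂]
    exact (Algebra.TensorProduct.tmul_mul_tmul _ _ _ _).trans (by rw [mul_one, one_mul])

section Split

variable {M : Type*} [AddCommGroup M] {ρ : Representation ℤ (L ≃ₐ[k] L) M}
  {π : IntertwiningMap (permRep (L ≃ₐ[k] L) (A →ₐ[k] L)) ρ}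

/-- The tuple of monomials `π (e_x)` corresponds to an element of `L[M] ⊗ A` whose norm is the
monomial of `∑ π (e_x) = π (1) = 0`, that is `1`; this is the required point. -/
lemma exists_algHom_addMonoidAlgebra (hX : Nat.card (A →ₐ[k] L) = Module.finrank k A)
    [DecidableEq (A →ₐ[k] L)] (hπ : IsNormOneQuotient π) :
    ∃ f : L ⊗[k] NormOneTorus k A →ₐ[L] L[M],
      ∀ x, f (coord x) = single (π (Pi.single x 1)) 1 := by
  have : Finite (A →ₐ[k] L) := (linearIndependent_toLinearMap k A L).finite
  have := Fintype.ofFinite (A →ₐ[k] L)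
  obtain ⟨z, hz⟩ := (evalHoms_bijective hX L[M]).2 fun x => single (π (Pi.single x 1)) 1
  have hz1 : Algebra.norm L[M] z = 1 := by
    rw [norm_eq_prod_evalHoms hX, hz, ← single_sum, ← map_sum, one_def]
    congr 1
    refine (hπ.apply_eq_zero_iff _).2 ⟨1, fun x => ?_⟩
    rw [Finset.sum_apply, Finset.sum_eq_single x (fun y _ hy => by simp [hy.symm]) (by simp)]
    simp
  let f : L ⊗[k] NormOneTorus k A →ₐ[L] L[M] :=
    Algebra.TensorProduct.lift (Algebra.ofId L _) (point z hz1) fun _ _ => Commute.all _ _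
  refine ⟨f, fun x => ?_⟩
  refine (apply_coord 1 (f.restrictScalars k) (fun c => f.commutes c) x).trans ?_
  have h : (f.restrictScalars k).comp Algebra.TensorProduct.includeRight = point z hz1 :=
    AlgHom.ext fun z => by simp [f]
  rw [h, eval_point, hz, one_smul]

/-- The coordinates have product `1`, so they are units and satisfy multiplicatively the one
relation between the generators of `M`. -/
lemma exists_algHom_of_addMonoidAlgebra (hX : Nat.card (A →ₐ[k] L) = Module.finrank k A)
    [DecidableEq (A →ₐ[k] L)] (hπ : IsNormOneQuotient π) :
    ∃ f : L[M] →ₐ[L] L ⊗[k] NormOneTorus k A,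
      ∀ x, f (single (π (Pi.single x 1)) 1) = coord x := by
  have : Finite (A →ₐ[k] L) := (linearIndependent_toLinearMap k A L).finite
  have := Fintype.ofFinite (A →ₐ[k] L)
  have hp := prod_coord (k := k) (A := A) (L := L) hX
  let u : (A →ₐ[k] L) → (L ⊗[k] NormOneTorus k A)ˣ := fun x =>
    Units.mkOfMulEqOne (coord x) (∏ y ∈ Finset.univ.erase x, coord y)
      ((Finset.mul_prod_erase _ _ (Finset.mem_univ x)).trans hp)
  have hu : ∏ x, u x = 1 := Units.ext (by rw [Units.coe_prod]; exact hp)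
  obtain ⟨g, hg⟩ := hπ.exists_addMonoidHom (fun x => Additive.ofMul (u x)) hu
  refine ⟨AddMonoidAlgebra.lift L _ M ((Units.coeHom _).comp (AddMonoidHom.toMultiplicativeLeft g)),
    fun x => ?_⟩
  rw [AddMonoidAlgebra.lift_single, one_smul]
  change Units.val (Additive.toMul (g (π (Pi.single x 1)))) = _
  rw [hg]
  rfl

end Split

end NormOneTorus

/-- A homomorphism out of a group algebra is determined by its values on a system of generators of
the group. -/
lemma AddMonoidAlgebra.algHom_ext_of_closure {R M S : Type*} [CommSemiring R] [AddCommGroup M]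
    [Semiring S] [Algebra R S] {t : Set M} (ht : AddSubgroup.closure t = ⊤)
    {f g : R[M] →ₐ[R] S} (h : ∀ m ∈ t, f (single m 1) = g (single m 1)) : f = g := by
  suffices hs : ∀ m, f (single m 1) = g (single m 1) by
    refine AlgHom.ext fun p => ?_
    induction p using induction_linear with
    | zero => rw [map_zero, map_zero]
    | add p q hp hq => rw [map_add, map_add, hp, hq]
    | single m c =>
      rw [← mul_one c, ← smul_eq_mul, ← smul_single, map_smul, map_smul, hs]
  intro m
  have hm : m ∈ AddSubgroup.closure t := ht ▸ AddSubgroup.mem_top m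
  induction hm using AddSubgroup.closure_induction with
  | mem m hm => exact h m hm
  | zero => rw [← one_def, map_one, map_one]
  | add a b _ _ ha hb =>
    rw [← mul_one (1 : R), ← single_mul_single, map_mul, map_mul, ha, hb]
  | neg a _ ha =>
    have h1 (φ : R[M] →ₐ[R] S) : φ (single a 1) * φ (single (-a) 1) = 1 := by
      rw [← map_mul, single_mul_single, add_neg_cancel, mul_one, ← one_def, map_one]
    have h2 (φ : R[M] →ₐ[R] S) : φ (single (-a) 1) * φ (single a 1) = 1 := by
      rw [← map_mul, single_mul_single, neg_add_cancel, mul_one, ← one_def, map_one]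
    exact left_inv_eq_right_inv (h2 f) (ha ▸ h1 g)

lemma Representation.IsNormOneQuotient.closure_eq_top {G X M : Type*} [Group G]
    [MulAction G X] [AddCommGroup M] {ρ : Representation ℤ G M}
    {π : IntertwiningMap (permRep G X) ρ} [Finite X] [DecidableEq X] (hπ : IsNormOneQuotient π) :
    AddSubgroup.closure (Set.range fun x => π (Pi.single x 1)) = ⊤ := by
  have := Fintype.ofFinite X
  refine eq_top_iff.2 fun m _ => ?_
  obtain ⟨f, rfl⟩ := hπ.surjective m
  have : f = ∑ x, f x • Pi.single x 1 := by
    ext y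
    simp [Finset.sum_apply, Pi.single_apply]
  rw [this, map_sum]
  refine AddSubgroup.sum_mem _ fun x _ => ?_
  rw [map_smul]
  exact AddSubgroup.zsmul_mem _ (AddSubgroup.subset_closure (Set.mem_range_self x)) _

/-! ### The splitting isomorphism and the character lattice. -/

namespace NormOneTorus

variable {k : Type*} [Field k] {A : Type*} [CommRing A] [Algebra k A] [Module.Finite k A]
  {L : Type*} [Field L] [Algebra k L] {M : Type*} [AddCommGroup M]
  {ρ : Representation ℤ (L ≃ₐ[k] L) M}
  {π : IntertwiningMap (permRep (L ≃ₐ[k] L) (A →ₐ[k] L)) ρ}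

instance : Algebra.FiniteType k (NormOneTorus k A) :=
  Algebra.FiniteType.of_surjective (mk k A) mk_surjective

open Coalgebra in
/-- A norm one torus splits over a field `L` that splits the algebra, with characters the quotient
of the permutation lattice of the homomorphisms to `L` by the constants. -/
lemma exists_bialgEquiv (hX : Nat.card (A →ₐ[k] L) = Module.finrank k A)
    [DecidableEq (A →ₐ[k] L)] (hπ : IsNormOneQuotient π) :
    ∃ e : (L ⊗[k] NormOneTorus k A) ≃ₐc[L] L[M],
      (∀ x, e (coord x) = single (π (Pi.single x 1)) 1) ∧
      ∀ σ z, e (galoisTensor L (NormOneTorus k A) σ z) = semilinearMap k σ (ρ σ) (e z) := by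
  have : Finite (A →ₐ[k] L) := (linearIndependent_toLinearMap k A L).finite
  obtain ⟨f, hf⟩ := exists_algHom_addMonoidAlgebra hX hπ
  obtain ⟨g, hg⟩ := exists_algHom_of_addMonoidAlgebra hX hπ
  have hfg : f.comp g = AlgHom.id L _ := algHom_ext_of_closure hπ.closure_eq_top (by
    rintro _ ⟨x, rfl⟩
    rw [AlgHom.comp_apply, hg, hf]
    rfl)
  have hgf : g.comp f = AlgHom.id L _ := algHom_ext_coord_one hX fun x => by
    rw [AlgHom.comp_apply, hf, hg]
    rfl
  let e : (L ⊗[k] NormOneTorus k A) ≃ₐ[L] L[M] := AlgEquiv.ofAlgHom f g hfg hgf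
  have he : ∀ x, e (coord x) = single (π (Pi.single x 1)) 1 := hf
  refine ⟨BialgEquiv.ofAlgEquiv e ?_ ?_, he, fun σ z => ?_⟩
  · refine algHom_ext_coord_one hX fun x => ?_
    change counit (R := L) (e (coord x)) = counit (R := L) (coord x)
    rw [he, (isGroupLikeElem_single_one _).counit_eq_one, (isGroupLikeElem_coord x).counit_eq_one]
  · refine algHom_ext_coord_one hX fun x => ?_
    change Algebra.TensorProduct.map e.toAlgHom e.toAlgHom (comul (R := L) (coord x)) =
      comul (R := L) (e (coord x))
    rw [he, (isGroupLikeElem_single_one _).comul_eq_tmul_self,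
      (isGroupLikeElem_coord x).comul_eq_tmul_self, Algebra.TensorProduct.map_tmul]
    change e (coord x) ⊗ₜ[L] e (coord x) = _
    rw [he]
  -- Both composites are `σ`-semilinear over `L`, so they agree once they agree on the coordinates,
  -- which Galois permutes in the same way as the basis of the permutation lattice.
  · have := algHom_ext_coord hX σ
      (f := (e.toAlgHom.restrictScalars k).comp (galoisAct (H := NormOneTorus k A) σ))
      (g := (semilinearMap k σ (ρ σ)).comp (e.toAlgHom.restrictScalars k))
      (fun c => ?_) (fun c => ?_) (fun x => ?_)
    · exact AlgHom.congr_fun this z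
    · change e (galoisAct σ (c ⊗ₜ 1)) = _
      simp only [galoisAct, Algebra.TensorProduct.map_tmul, map_one]
      exact e.commutes (σ c)
    · change semilinearMap k σ _ (e (algebraMap L _ c)) = _
      rw [e.commutes]
      exact semilinearMap_algebraMap σ (ρ σ) c
    · change e (galoisTensor L (NormOneTorus k A) σ (coord x)) = semilinearMap k σ _ (e (coord x))
      rw [galoisTensor_coord, he, he, semilinearMap_single, map_one]
      congr 1
      rw [← permRep_single]
      exact IntertwiningMap.isIntertwining _ _ π σ _


/-- The lattice of characters of a norm one torus. -/
lemma exists_equiv_characterRep (hX : Nat.card (A →ₐ[k] L) = Module.finrank k A)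
    (hπ : IsNormOneQuotient π) :
    Nonempty (ρ.Equiv (characterRep k L (NormOneTorus k A))) := by
  classical
  obtain ⟨e, -, he⟩ := exists_bialgEquiv hX hπ
  have hs : ∀ m, IsGroupLikeElem L (e.symm (single m 1 : L[M])) := fun m =>
    (isGroupLikeElem_single_one m).map e.symm
  let f : M →+ Characters k L (NormOneTorus k A) :=
    { toFun := fun m => Additive.ofMul ⟨e.symm (single m 1), hs m⟩
      map_zero' := congrArg Additive.ofMul (GroupLike.ext (by
        change e.symm (single 0 1) = 1
        rw [← one_def, map_one]))
      map_add' := fun a b => congrArg Additive.ofMul (GroupLike.ext (by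
        change e.symm (single (a + b) 1) = e.symm (single a 1) * e.symm (single b 1)
        rw [← map_mul, single_mul_single, mul_one])) }
  refine ⟨(IntertwiningMap.ofAddHom f fun σ m => ?_).toEquiv ⟨fun a b hab => ?_, fun c => ?_⟩⟩
  · refine congrArg Additive.ofMul (GroupLike.ext ?_)
    change e.symm (single (ρ σ m) 1) = galoisTensor L (NormOneTorus k A) σ (e.symm (single m 1))
    refine e.injective (?_ : e _ = e _)
    rw [he, BialgEquiv.apply_symm_apply, BialgEquiv.apply_symm_apply, semilinearMap_single,
      map_one]
  · have h : e.symm (single a 1) = e.symm (single b 1) :=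
      congrArg (fun c : Characters k L (NormOneTorus k A) => (Additive.toMul c).val) hab
    exact single_left_injective one_ne_zero (e.symm.injective h)
  · have hc := (Additive.toMul c).isGroupLikeElem_val.map e
    obtain ⟨m, hm⟩ := isGroupLikeElem_iff_mem_range_single_one.1 hc
    refine ⟨m, congrArg Additive.ofMul (GroupLike.ext ?_)⟩
    change e.symm (single m 1) = _
    rw [show (single m 1 : L[M]) = _ from hm, BialgEquiv.symm_apply_apply]
    rfl

end NormOneTorus

/-- An additive isomorphism induces an isomorphism of the group algebras as bialgebras. -/
lemma AddMonoidAlgebra.nonempty_bialgEquiv (R : Type*) [CommRing R] {M N : Type*} [AddCommGroup M]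
    [AddCommGroup N] (e : M ≃+ N) : Nonempty (R[M] ≃ₐc[R] R[N]) :=
  ⟨BialgEquiv.ofBijective (mapDomainBialgHom R e.toAddMonoidHom) (by
    refine Function.bijective_iff_has_inverse.2
      ⟨mapDomainBialgHom R e.symm.toAddMonoidHom, fun x => ?_, fun x => ?_⟩
    · rw [mapDomainBialgHom_mapDomainBialgHom]
      have : e.symm.toAddMonoidHom.comp e.toAddMonoidHom = .id M := by ext; simp
      rw [this, mapDomainBialgHom_id]; rfl
    · rw [mapDomainBialgHom_mapDomainBialgHom]
      have : e.toAddMonoidHom.comp e.symm.toAddMonoidHom = .id N := by ext; simp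
      rw [this, mapDomainBialgHom_id]; rfl)⟩

/-! ### The quotient of a permutation lattice by constants. -/

section NormOneLattice

variable (G X : Type*) [Group G] [MulAction G X]

/-- The quotient of a permutation lattice by the constant functions. -/
def NormOneLattice (X : Type*) : Type _ := (X → ℤ) ⧸ (ℤ ∙ (1 : X → ℤ))

instance (X : Type*) : AddCommGroup (NormOneLattice X) :=
  inferInstanceAs (AddCommGroup ((X → ℤ) ⧸ (ℤ ∙ (1 : X → ℤ))))

/-- The representation on the quotient of a permutation lattice by the constant functions. -/
def normOneRep : Representation ℤ G (NormOneLattice X) where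
  toFun g := Submodule.mapQ _ _ (permRep G X g) (by
    rw [Submodule.span_le, Set.singleton_subset_iff]
    exact Submodule.mem_span_singleton_self (1 : X → ℤ))
  map_one' := LinearMap.ext fun x => by
    obtain ⟨f, rfl⟩ := Submodule.mkQ_surjective _ x
    refine (Submodule.mapQ_apply _ _ _ f).trans ?_
    rw [map_one]
    rfl
  map_mul' g h := LinearMap.ext fun x => by
    obtain ⟨f, rfl⟩ := Submodule.mkQ_surjective _ x
    refine (Submodule.mapQ_apply _ _ _ f).trans ?_
    rw [map_mul]
    rfl

/-- The projection of a permutation lattice to its quotient by the constant functions. -/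
def normOneProj : IntertwiningMap (permRep G X) (normOneRep G X) :=
  IntertwiningMap.ofAddHom (Submodule.mkQ (ℤ ∙ (1 : X → ℤ))).toAddMonoidHom fun _ _ => rfl

lemma isNormOneQuotient_normOneProj : IsNormOneQuotient (normOneProj G X) where
  surjective := Submodule.mkQ_surjective _
  apply_eq_zero_iff f := by
    refine (Submodule.Quotient.mk_eq_zero (ℤ ∙ (1 : X → ℤ))).trans ?_
    rw [Submodule.mem_span_singleton]
    refine exists_congr fun c => ⟨fun h x => ?_, fun h => funext fun x => ?_⟩
    · rw [← h]; simp
    · rw [h x]; simp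

end NormOneLattice

section Rank

variable {G X M : Type*} [Group G] [MulAction G X] [AddCommGroup M] {ρ : Representation ℤ G M}
  {π : IntertwiningMap (permRep G X) ρ} [Finite X]

/-- The quotient of a permutation lattice by the constants is free of rank `|X| - 1`. -/
lemma Representation.IsNormOneQuotient.nonempty_addEquiv (hπ : IsNormOneQuotient π) :
    Nonempty (M ≃+ (Fin (Nat.card X - 1) → ℤ)) := by
  classical
  rcases isEmpty_or_nonempty X with hX | ⟨⟨x₀⟩⟩
  -- For empty `X` the truncated difference `|X| - 1` is `0`, in agreement with the trivial lattice.
  · have : Subsingleton M := hπ.surjective.subsingleton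
    have : Nat.card X - 1 = 0 := by simp
    rw [this]
    exact ⟨⟨⟨fun _ => 0, fun _ => 0, fun _ => Subsingleton.elim _ _, fun _ =>
      Subsingleton.elim _ _⟩, fun _ _ => Subsingleton.elim _ _⟩⟩
  · have := Fintype.ofFinite X
    let Y := {x : X // x ≠ x₀}
    have hY : Fintype.card Y = Nat.card X - 1 := by
      rw [Nat.card_eq_fintype_card]
      exact Set.card_ne_eq x₀
    let r : (X → ℤ) →+ (Y → ℤ) :=
      { toFun := fun f y => f y - f x₀
        map_zero' := by ext; simp
        map_add' := fun f g => by ext; simp; ring }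
    -- Functions vanishing at `x₀` are a complement of the constants.
    let j : (Y → ℤ) →+ M := π.toLinearMap.toAddMonoidHom.comp
      { toFun := fun f x => if h : x ≠ x₀ then f ⟨x, h⟩ else 0
        map_zero' := by ext; simp
        map_add' := fun f g => by ext x; by_cases h : x = x₀ <;> simp [h] }
    have hj : Function.Bijective j := by
      refine ⟨(injective_iff_map_eq_zero _).2 fun f hf => ?_, fun m => ?_⟩
      · obtain ⟨c, hc⟩ := (hπ.apply_eq_zero_iff _).1 hf
        have h0 := hc x₀
        ext y
        have h1 := hc y
        simp only [AddMonoidHom.coe_mk, ZeroHom.coe_mk, ne_eq, not_true_eq_false, dite_false,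
          y.2, not_false_eq_true, dite_true] at h0 h1
        rw [← h0] at h1
        exact h1
      · obtain ⟨f, rfl⟩ := hπ.surjective m
        refine ⟨r f, ?_⟩
        refine sub_eq_zero.1 ((map_sub π _ f).symm.trans ((hπ.apply_eq_zero_iff _).2
          ⟨-f x₀, fun x => ?_⟩))
        by_cases h : x = x₀
        · subst h; simp
        · simp [r, h]
    exact ⟨(AddEquiv.ofBijective j hj).symm.trans
      (LinearEquiv.funCongrLeft ℤ ℤ (Fintype.equivFinOfCardEq hY).symm).toAddEquiv⟩

lemma Representation.IsNormOneQuotient.free (hπ : IsNormOneQuotient π) : Module.Free ℤ M :=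
  let ⟨e⟩ := hπ.nonempty_addEquiv
  Module.Free.of_equiv e.toIntLinearEquiv.symm

lemma Representation.IsNormOneQuotient.finite (hπ : IsNormOneQuotient π) : Module.Finite ℤ M :=
  Module.Finite.of_surjective π.toLinearMap hπ.surjective

end Rank

/-- The norm one torus of an algebra split by the separable closure is an algebraic torus. -/
theorem NormOneTorus.isAlgebraicTorus {k : Type*} [Field k] {A : Type*} [CommRing A] [Algebra k A]
    [Module.Finite k A]
    (hX : Nat.card (A →ₐ[k] SeparableClosure k) = Module.finrank k A) :
    IsAlgebraicTorus k (NormOneTorus k A) (Module.finrank k A - 1) := by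
  classical
  have : Finite (A →ₐ[k] SeparableClosure k) :=
    (linearIndependent_toLinearMap k A (SeparableClosure k)).finite
  have hπ := isNormOneQuotient_normOneProj (SeparableClosure k ≃ₐ[k] SeparableClosure k)
    (A →ₐ[k] SeparableClosure k)
  obtain ⟨e, -⟩ := exists_bialgEquiv hX hπ
  obtain ⟨f⟩ := hπ.nonempty_addEquiv
  obtain ⟨g⟩ := nonempty_bialgEquiv (SeparableClosure k) f
  rw [← hX]
  exact ⟨e.trans g⟩

/-! ### Transport of rationality along isomorphisms. -/

section Transfer

variable {k : Type*} [Field k] {H H' : Type*} [CommRing H] [Algebra k H] [CommRing H']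
  [Algebra k H']

lemma IsStablyRational.of_algEquiv (h : IsStablyRational k H) (e : H ≃ₐ[k] H') :
    IsStablyRational k H' := by
  obtain ⟨_, m, n, ⟨g⟩⟩ := h
  have : IsDomain H' := e.symm.toMulEquiv.isDomain H
  obtain ⟨e₁⟩ := nonempty_fractionRing_algEquiv_of_algEquiv e
  obtain ⟨e₂⟩ := nonempty_fractionRing_algEquiv_of_algEquiv (MvPolynomial.mapAlgEquiv (Fin m) e₁)
  exact ⟨this, m, n, ⟨e₂.symm.trans g⟩⟩

lemma IsRetractRationalField.of_algEquiv {F F' : Type*} [Field F] [Field F'] [Algebra k F]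
    [Algebra k F'] (h : IsRetractRationalField k F) (e : F ≃ₐ[k] F') :
    IsRetractRationalField k F' := by
  obtain ⟨R, hR, n, f, φ, ψ, hψ⟩ := h
  let eR := R.equivMapOfInjective e.toAlgHom e.injective
  refine ⟨R.map e.toAlgHom, ?_, n, f, φ.comp eR.symm.toAlgHom, eR.toAlgHom.comp ψ, ?_⟩
  · refine IsFractionRing.of_field _ _ fun z => ?_
    obtain ⟨x, y, -, hxy⟩ := IsFractionRing.div_surjective R (e.symm z)
    refine ⟨eR x, eR y, ?_⟩
    rw [← e.apply_symm_apply z, ← hxy, map_div₀]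
    rfl
  · ext x
    have := AlgHom.congr_fun hψ (eR.symm x)
    simp only [AlgHom.comp_apply] at this ⊢
    change _ = eR.symm x at this
    change ((eR (ψ (φ (eR.symm x))) : _) : F') = _
    rw [this, eR.apply_symm_apply]
    rfl

lemma IsRetractRational.of_algEquiv (h : IsRetractRational k H) (e : H ≃ₐ[k] H') :
    IsRetractRational k H' := by
  obtain ⟨_, h⟩ := h
  have : IsDomain H' := e.symm.toMulEquiv.isDomain H
  obtain ⟨e₁⟩ := nonempty_fractionRing_algEquiv_of_algEquiv e
  exact ⟨this, h.of_algEquiv e₁⟩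

end Transfer

/-! ### Galois descent of tori and change of the splitting field. -/

section Lattice

variable {k : Type*} [Field k] {L : Type*} [Field L] [Algebra k L]
  {M : Type*} [AddCommGroup M] {ρ : Representation ℤ (L ≃ₐ[k] L) M}
  {N : Type*} [AddCommGroup N] {τ : Representation ℤ (L ≃ₐ[k] L) N}

lemma nonempty_torusOfLattice_algEquiv (e : ρ.Equiv τ) :
    Nonempty (torusOfLattice k L ρ ≃ₐ[k] torusOfLattice k L τ) := by
  refine ⟨AlgEquiv.ofAlgHom (torusOfLatticeMap e.toIntertwiningMap)
    (torusOfLatticeMap e.symm.toIntertwiningMap) ?_ ?_⟩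
  · refine AlgHom.ext fun x => Subtype.ext ?_
    change latticeMap _ (latticeMap _ x.1) = x.1
    induction x.1 using induction_linear with
    | zero => simp
    | add x y hx hy => simp only [map_add, hx, hy]
    | single m c =>
      rw [latticeMap_single, latticeMap_single]
      exact congrArg (single · c) (e.apply_symm_apply m)
  · refine AlgHom.ext fun x => Subtype.ext ?_
    change latticeMap _ (latticeMap _ x.1) = x.1
    induction x.1 using induction_linear with
    | zero => simp
    | add x y hx hy => simp only [map_add, hx, hy]
    | single m c =>
      rw [latticeMap_single, latticeMap_single]
      exact congrArg (single · c) (e.symm_apply_apply m)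

/-- Galois descent for a base change. -/
lemma exists_eq_one_tmul [IsGalois k L] {V : Type*} [CommRing V] [Algebra k V] {z : L ⊗[k] V}
    (hz : ∀ σ : L ≃ₐ[k] L, galoisTensor L V σ z = z) : ∃ v : V, z = 1 ⊗ₜ v := by
  let b := Module.Free.chooseBasis k V
  let B := Algebra.TensorProduct.basis L b
  have hB : ∀ σ (y : L ⊗[k] V) i, B.repr (galoisTensor L V σ y) i = σ (B.repr y i) := by
    intro σ y i
    induction y with
    | zero => simp
    | add x y hx hy => simp [hx, hy]
    | tmul a v => simp [B, galoisTensor_tmul]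
  have h : ∀ i, ∃ c : k, algebraMap k L c = B.repr z i := fun i =>
    (InfiniteGalois.mem_range_algebraMap_iff_fixed _).2 fun σ => by
      rw [← hB, hz]
  choose c hc using h
  refine ⟨(B.repr z).sum fun i _ => c i • b i, ?_⟩
  refine (B.linearCombination_repr z).symm.trans ?_
  rw [Finsupp.linearCombination_apply, Finsupp.sum, Finsupp.sum, TensorProduct.tmul_sum]
  refine Finset.sum_congr rfl fun i _ => ?_
  rw [← hc i, TensorProduct.tmul_smul, ← algebraMap_smul L (c i)]
  simp [B]

/-- A torus that splits over a Galois extension is determined by its lattice of characters. -/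
lemma nonempty_algEquiv_torusOfLattice [IsGalois k L] {H : Type*} [CommRing H] [Algebra k H]
    (e : (L ⊗[k] H) ≃ₐ[L] L[M])
    (he : ∀ σ z, e (galoisTensor L H σ z) = semilinearMap k σ (ρ σ) (e z)) :
    Nonempty (H ≃ₐ[k] torusOfLattice k L ρ) := by
  let f : H →ₐ[k] L[M] := (e.toAlgHom.restrictScalars k).comp Algebra.TensorProduct.includeRight
  have hf : ∀ h, f h = e (1 ⊗ₜ h) := fun _ => rfl
  have hfinj : Function.Injective f := fun x y hxy =>
    Algebra.TensorProduct.includeRight_injective (algebraMap k L).injective (e.injective hxy)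
  refine ⟨AlgEquiv.ofBijective (f.codRestrict (torusOfLattice k L ρ) fun h σ => ?_)
    ⟨fun x y hxy => hfinj (congrArg Subtype.val hxy), fun y => ?_⟩⟩
  · change semilinearMap k σ (ρ σ) (f h) = f h
    rw [hf, ← he, galoisTensor_tmul, map_one]
  · obtain ⟨v, hv⟩ := exists_eq_one_tmul (z := e.symm y.1) fun σ => e.injective (by
      rw [he, e.apply_symm_apply]
      exact y.2 σ)
    exact ⟨v, Subtype.ext (by
      change f v = y.1
      rw [hf, ← hv, e.apply_symm_apply])⟩

end Lattice

section Restriction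

variable {k : Type*} [Field k] {F : Type*} [Field F] [Algebra k F]
  {L : Type*} [Field L] [Algebra k L] [Algebra L F] [IsScalarTower k L F]
  {M : Type*} [AddCommGroup M]

/-- The torus attached to a lattice may be computed over any Galois extension over which it
splits. -/
lemma nonempty_torusOfLattice_comp [IsGalois k F] [Normal k L]
    (ρ : Representation ℤ (L ≃ₐ[k] L) M) :
    Nonempty (torusOfLattice k L ρ ≃ₐ[k] torusOfLattice k F
      (ρ.comp (AlgEquiv.restrictNormalHom (F := k) (K₁ := F) L))) := by
  let r := AlgEquiv.restrictNormalHom (F := k) (K₁ := F) L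
  have hr : Function.Surjective r := AlgEquiv.restrictNormalHom_surjective F
  have hr' : ∀ σ (c : L), algebraMap L F (r σ c) = σ (algebraMap L F c) := fun σ c =>
    AlgEquiv.restrictNormal_commutes σ L c
  let i : L →ₐ[k] F := IsScalarTower.toAlgHom k L F
  let f : L[M] →ₐ[k] F[M] := mapAlgHom M i
  have hfc : ∀ x m, (f x).coeff m = algebraMap L F (x.coeff m) := coeff_mapAlgHom i
  have hf : Function.Injective f := fun x y hxy => by
    ext m
    exact (algebraMap L F).injective (by rw [← hfc, ← hfc, hxy])
  have hfs : ∀ σ x, f (semilinearMap k (r σ) (ρ (r σ)) x) = semilinearMap k σ (ρ (r σ)) (f x) :=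
    fun σ x => by
      induction x using induction_linear with
      | zero => simp
      | add x y hx hy => simp only [map_add, hx, hy]
      | single m c =>
        simp [f, semilinearMap_single, mapAlgHom_single, i, hr']
  refine ⟨AlgEquiv.ofBijective ((f.comp (torusOfLattice k L ρ).val).codRestrict _ fun x σ => ?_)
    ⟨fun x y hxy => Subtype.ext (hf (congrArg Subtype.val hxy)), fun y => ?_⟩⟩
  · change semilinearMap k σ (ρ (r σ)) (f x.1) = f x.1
    rw [← hfs]
    exact congrArg f (x.2 (r σ))
  · have hy : ∀ σ, semilinearMap k σ (ρ (r σ)) y.1 = y.1 := y.2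
    have : IsGalois L F := IsGalois.tower_top_of_isGalois k L F
    -- Automorphisms of `F` over `L` act trivially on `M`, so for them invariance only concerns the
    -- coefficients, which therefore lie in `L`.
    have hy' : ∀ m, ∃ c : L, algebraMap L F c = y.1.coeff m := fun m => by
      refine (InfiniteGalois.mem_range_algebraMap_iff_fixed _).2 fun σ => ?_
      let σ' : F ≃ₐ[k] F := σ.restrictScalars k
      have hσ : r σ' = 1 := AlgEquiv.ext fun c => (algebraMap L F).injective
        ((hr' σ' c).trans (σ.commutes c))
      have h : semilinearMap k σ' 1 y.1 = y.1 := by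
        have := hy σ'
        rwa [hσ, map_one] at this
      have h' : semilinearMap k σ' 1 y.1 = mapAlgHom M σ'.toAlgHom y.1 := by
        generalize y.1 = x
        induction x using induction_linear with
        | zero => simp
        | add x y hx hy => simp only [map_add, hx, hy]
        | single m c => rw [semilinearMap_single, mapAlgHom_single]; rfl
      rw [h'] at h
      exact (coeff_mapAlgHom σ'.toAlgHom y.1 m).symm.trans (by rw [h])
    choose c hc using hy'
    let x : L[M] := .ofCoeff (Finsupp.onFinset y.1.coeff.support c fun m hm =>
      Finsupp.mem_support_iff.2 (by rwa [← hc, map_ne_zero]))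
    have hx : f x = y.1 := by
      ext m
      rw [hfc]
      exact hc m
    refine ⟨⟨x, fun σ => hf ?_⟩, Subtype.ext hx⟩
    obtain ⟨σ, rfl⟩ := hr σ
    refine (hfs σ x).trans ?_
    rw [hx]
    exact hy σ

end Restriction

/-! ### Homomorphisms out of étale algebras. -/

section Homs

variable {k : Type*} [Field k]

section Pi

variable {ι : Type*} {K : ι → Type*} [∀ i, Field (K i)] [∀ i, Algebra k (K i)]
  {A : Type*} [CommRing A] [Algebra k A] (e : A ≃ₐ[k] ∀ i, K i)
  {L : Type*} [Field L] [Algebra k L]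

/-- The homomorphism out of a product of fields given by one out of a factor. -/
def homOfFactor (x : Σ i, K i →ₐ[k] L) : A →ₐ[k] L :=
  (x.2.comp (Pi.evalAlgHom k K x.1)).comp e.toAlgHom

lemma homOfFactor_apply (x : Σ i, K i →ₐ[k] L) (a : A) :
    homOfFactor e x a = x.2 (e a x.1) := rfl

lemma homOfFactor_injective : Function.Injective (homOfFactor (L := L) e) := by
  classical
  rintro ⟨i, f⟩ ⟨j, g⟩ h
  have h' : ∀ y : ∀ i, K i, f (y i) = g (y j) := fun y => by
    have := AlgHom.congr_fun h (e.symm y)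
    rwa [homOfFactor_apply, homOfFactor_apply, e.apply_symm_apply] at this
  have hij : i = j := by
    by_contra hij
    have := h' (Pi.single i 1)
    rw [Pi.single_eq_same, Pi.single_eq_of_ne (Ne.symm hij), map_one, map_zero] at this
    exact one_ne_zero this
  subst hij
  congr
  ext c
  have := h' (Pi.single i c)
  rwa [Pi.single_eq_same] at this

variable [Fintype ι] [∀ i, FiniteDimensional k (K i)] [Module.Finite k A]

include e in
omit [Module.Finite k A] in
lemma finrank_eq_sum : Module.finrank k A = ∑ i, Module.finrank k (K i) := by
  rw [e.toLinearEquiv.finrank_eq, Module.finrank_pi_fintype]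

/-- The homomorphisms through the factors already number `∑ [K i : k] = dim A`, an upper bound for
all homomorphisms `A → L`. -/
lemma bijective_homOfFactor (h : ∀ i, Nat.card (K i →ₐ[k] L) = Module.finrank k (K i)) :
    Function.Bijective (homOfFactor (L := L) e) ∧
      Nat.card (A →ₐ[k] L) = Module.finrank k A := by
  have : Finite (A →ₐ[k] L) := (linearIndependent_toLinearMap k A L).finite
  have : ∀ i, Finite (K i →ₐ[k] L) := fun i => (linearIndependent_toLinearMap k (K i) L).finite
  have hc : Nat.card (Σ i, K i →ₐ[k] L) = Module.finrank k A := by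
    rw [Nat.card_sigma, finrank_eq_sum e]
    exact Finset.sum_congr rfl fun i _ => h i
  have hb := (homOfFactor_injective (L := L) e).bijective_of_nat_card_le (by
    rw [hc]
    exact card_algHom_le_finrank k A L)
  exact ⟨hb, by rw [← hc, Nat.card_congr (Equiv.ofBijective _ hb)]⟩

include e in
/-- An invariant weight on the homomorphisms out of a product of fields, constant on those that
factor through a given field. -/
lemma exists_weight (h : ∀ i, Nat.card (K i →ₐ[k] L) = Module.finrank k (K i)) (a : ι → ℤ) :
    ∃ w : (A →ₐ[k] L) → ℤ, (∀ (g : L ≃ₐ[k] L) x, w (g • x) = w x) ∧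
      ∑ᶠ x, w x = ∑ i, a i * Module.finrank k (K i) := by
  have : ∀ i, Finite (K i →ₐ[k] L) := fun i => (linearIndependent_toLinearMap k (K i) L).finite
  have := fun i => Fintype.ofFinite (K i →ₐ[k] L)
  let Ψ := Equiv.ofBijective _ (bijective_homOfFactor (L := L) e h).1
  refine ⟨fun x => a (Ψ.symm x).1, fun g x => ?_, ?_⟩
  · obtain ⟨y, rfl⟩ := Ψ.surjective x
    have : g • Ψ y = Ψ ⟨y.1, g • y.2⟩ := rfl
    change a (Ψ.symm (g • Ψ y)).1 = a (Ψ.symm (Ψ y)).1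
    rw [this, Ψ.symm_apply_apply, Ψ.symm_apply_apply]
  · rw [← finsum_comp_equiv Ψ]
    simp only [Ψ.symm_apply_apply]
    rw [finsum_eq_sum_of_fintype, Fintype.sum_sigma]
    refine Finset.sum_congr rfl fun i _ => ?_
    change ∑ _ : K i →ₐ[k] L, a i = _
    rw [Finset.sum_const, Finset.card_univ, ← Nat.card_eq_fintype_card, h, nsmul_eq_mul, mul_comm]

end Pi

lemma natCard_algHom_separableClosure (K : Type*) [Field K] [Algebra k K] [FiniteDimensional k K]
    [Algebra.IsSeparable k K] :
    Nat.card (K →ₐ[k] SeparableClosure k) = Module.finrank k K :=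
  AlgHom.natCard_of_splits k K _ fun x =>
    IsSepClosed.splits_codomain _ (Algebra.IsSeparable.isSeparable k x)

section Intermediate

variable {F : Type*} [Field F] [Algebra k F] {A : Type*} [CommRing A] [Algebra k A]

lemma bijective_comp_val (L : IntermediateField k F)
    (h : ∀ (x : A →ₐ[k] F) a, x a ∈ L) :
    Function.Bijective fun x : A →ₐ[k] L => L.val.comp x :=
  ⟨fun _ _ hxy => AlgHom.ext fun a => Subtype.ext (AlgHom.congr_fun hxy a),
    fun x => ⟨x.codRestrict L.toSubalgebra (h x), rfl⟩⟩

variable [Module.Finite k A]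

/-- There are finitely many homomorphisms, each determined by its values on a finite basis; these
values form the set. -/
lemma exists_finite_set_range_le :
    ∃ s : Set F, s.Finite ∧ ∀ L : IntermediateField k F, s ⊆ L →
      ∀ (x : A →ₐ[k] F) a, x a ∈ L := by
  have : Finite (A →ₐ[k] F) := (linearIndependent_toLinearMap k A F).finite
  let b := Module.finBasis k A
  refine ⟨Set.range fun p : (A →ₐ[k] F) × Fin (Module.finrank k A) => p.1 (b p.2),
    Set.finite_range _, fun L hL x a => ?_⟩
  rw [← b.sum_repr a, map_sum]
  refine sum_mem fun i _ => ?_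
  rw [map_smul]
  exact L.smul_mem (hL ⟨(x, i), rfl⟩)

end Intermediate

section Tensor

variable {A B : Type*} [CommRing A] [Algebra k A] [CommRing B] [Algebra k B]
  {L : Type*} [Field L] [Algebra k L]

/-- Homomorphisms out of a tensor product are pairs of homomorphisms. -/
def homProdEquiv : (A →ₐ[k] L) × (B →ₐ[k] L) ≃ (A ⊗[k] B →ₐ[k] L) where
  toFun p := Algebra.TensorProduct.lift p.1 p.2 fun _ _ => Commute.all _ _
  invFun x := (x.comp Algebra.TensorProduct.includeLeft, x.comp Algebra.TensorProduct.includeRight)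
  left_inv p := by ext <;> simp
  right_inv x := by ext <;> simp

lemma smul_homProdEquiv (σ : L ≃ₐ[k] L) (p : (A →ₐ[k] L) × (B →ₐ[k] L)) :
    homProdEquiv (σ • p) = σ • homProdEquiv p := by
  refine Algebra.TensorProduct.ext' fun a b => ?_
  simp [homProdEquiv, AlgEquiv.smul_algHom_apply]

lemma natCard_homs_tensor (hA : Nat.card (A →ₐ[k] L) = Module.finrank k A)
    (hB : Nat.card (B →ₐ[k] L) = Module.finrank k B) :
    Nat.card (A ⊗[k] B →ₐ[k] L) = Module.finrank k (A ⊗[k] B) := by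
  rw [← Nat.card_congr homProdEquiv, Nat.card_prod, hA, hB, Module.finrank_tensorProduct]

end Tensor

end Homs

section NormOneQuotient

/-- Norm one quotients may be transported along an equivariant bijection. -/
lemma Representation.IsNormOneQuotient.exists_comp {G G' X Y M : Type*} [Group G] [Group G']
    [MulAction G X] [MulAction G' Y] [AddCommGroup M] {ρ : Representation ℤ G M}
    {π : IntertwiningMap (permRep G X) ρ} (hπ : IsNormOneQuotient π) (r : G' →* G) {φ : X → Y}
    (hφ : Function.Bijective φ) (hr : ∀ g x, φ (r g • x) = g • φ x) :
    ∃ π' : IntertwiningMap (permRep G' Y) (ρ.comp r), IsNormOneQuotient π' := by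
  let c : (Y → ℤ) →+ (X → ℤ) :=
    { toFun := fun f x => f (φ x)
      map_zero' := rfl
      map_add' := fun _ _ => rfl }
  have hc : Function.Surjective c := fun f =>
    ⟨fun y => f ((Equiv.ofBijective φ hφ).symm y), funext fun x => congrArg f
      ((Equiv.ofBijective φ hφ).symm_apply_apply x)⟩
  refine ⟨IntertwiningMap.ofAddHom (π.toLinearMap.toAddMonoidHom.comp c) fun g f => ?_,
    hπ.surjective.comp hc, fun f => ?_⟩
  · change π (c _) = ρ (r g) (π (c f))
    rw [← π.isIntertwining]
    congr 1
    ext x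
    change f (g⁻¹ • φ x) = f (φ ((r g)⁻¹ • x))
    rw [← map_inv, hr]
  · refine (hπ.apply_eq_zero_iff (c f)).trans (exists_congr fun a => ⟨fun h y => ?_, fun h x => h _⟩)
    obtain ⟨x, rfl⟩ := hφ.2 y
    exact h x

end NormOneQuotient

lemma exists_sum_mul_add_sum_mul_eq_one {ι κ : Type*} [Fintype ι] [Fintype κ] (m : ι → ℕ)
    (n : κ → ℕ) (h : Nat.gcd (Finset.univ.gcd m) (Finset.univ.gcd n) = 1) :
    ∃ (a : ι → ℤ) (b : κ → ℤ), ∑ i, a i * m i + ∑ j, b j * n j = 1 := by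
  obtain ⟨a, ha⟩ := Finset.univ.gcd_eq_sum_mul fun i => (m i : ℤ)
  obtain ⟨b, hb⟩ := Finset.univ.gcd_eq_sum_mul fun j => (n j : ℤ)
  have hc : IsCoprime (Finset.univ.gcd fun i => (m i : ℤ)) (Finset.univ.gcd fun j => (n j : ℤ)) := by
    rw [Int.isCoprime_iff_gcd_eq_one, ← Nat.dvd_one, ← h]
    refine Nat.dvd_gcd (Finset.dvd_gcd fun i hi => ?_) (Finset.dvd_gcd fun j hj => ?_)
    · exact Int.natCast_dvd_natCast.1 ((Int.gcd_dvd_left ..).trans (Finset.gcd_dvd hi))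
    · exact Int.natCast_dvd_natCast.1 ((Int.gcd_dvd_right ..).trans (Finset.gcd_dvd hj))
  obtain ⟨x, y, hxy⟩ := hc
  refine ⟨fun i => x * a i, fun j => y * b j, ?_⟩
  rw [← hxy, ha, hb, Finset.mul_sum, Finset.mul_sum]
  congr 1 <;> exact Finset.sum_congr rfl fun _ _ => by ring

/-- A norm one torus splits equivariantly over a field that splits the algebra. -/
lemma NormOneTorus.exists_algEquiv {k A L M : Type*} [Field k] [CommRing A] [Algebra k A]
    [Module.Finite k A] [Field L] [Algebra k L] [AddCommGroup M]
    {ρ : Representation ℤ (L ≃ₐ[k] L) M}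
    {π : IntertwiningMap (permRep (L ≃ₐ[k] L) (A →ₐ[k] L)) ρ}
    (hX : Nat.card (A →ₐ[k] L) = Module.finrank k A) (hπ : IsNormOneQuotient π) :
    ∃ e : (L ⊗[k] NormOneTorus k A) ≃ₐ[L] L[M],
      ∀ σ z, e (galoisTensor L (NormOneTorus k A) σ z) = semilinearMap k σ (ρ σ) (e z) := by
  classical
  obtain ⟨e, -, he⟩ := exists_bialgEquiv hX hπ
  exact ⟨(e : (L ⊗[k] NormOneTorus k A) ≃ₐ[L] L[M]), he⟩

/-! ### Passage to a finite splitting field. -/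

section Splitting

variable {k : Type*} [Field k]

/-- The character lattice of a norm one torus over a field extension that splits the algebra. -/
abbrev normOneCharacters (k A L : Type*) [Field k] [CommRing A] [Algebra k A] [Field L]
    [Algebra k L] : Representation ℤ (L ≃ₐ[k] L) (NormOneLattice (A →ₐ[k] L)) :=
  normOneRep (L ≃ₐ[k] L) (A →ₐ[k] L)

section Levels

variable {A : Type*} [CommRing A] [Algebra k A] [Module.Finite k A]
  {B : Type*} [CommRing B] [Algebra k B] [Module.Finite k B]
  {L : Type*} [Field L] [Algebra k L]

/-- The torus of the lattice of characters of a norm one torus, over a field that splits it. -/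
lemma nonempty_torusOfLattice_normOneTorus [IsGalois k L]
    (hX : Nat.card (A →ₐ[k] L) = Module.finrank k A) :
    Nonempty (torusOfLattice k L (normOneCharacters k A L) ≃ₐ[k] NormOneTorus k A) := by
  obtain ⟨e, he⟩ := NormOneTorus.exists_algEquiv hX (isNormOneQuotient_normOneProj _ _)
  obtain ⟨f⟩ := nonempty_algEquiv_torusOfLattice e he
  exact ⟨f.symm⟩

/-- By counting, every homomorphism `A → F` takes values in `L`. The characters over `F` are thus
the lattice over `L`, with Galois acting through restriction. -/
lemma nonempty_equiv_characterRep_comp {F : Type*} [Field F] [Algebra k F] [Algebra L F]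
    [IsScalarTower k L F] [Normal k L]
    (hX : Nat.card (A →ₐ[k] L) = Module.finrank k A)
    (hXF : Nat.card (A →ₐ[k] F) = Module.finrank k A) :
    Nonempty (Representation.Equiv
      ((normOneCharacters k A L).comp (AlgEquiv.restrictNormalHom (F := k) (K₁ := F) L))
      (characterRep k F (NormOneTorus k A))) := by
  let i : L →ₐ[k] F := IsScalarTower.toAlgHom k L F
  have : Finite (A →ₐ[k] F) := (linearIndependent_toLinearMap k A F).finite
  have hφ : Function.Injective fun x : A →ₐ[k] L => i.comp x := fun x y hxy =>
    AlgHom.ext fun a => i.injective (AlgHom.congr_fun hxy a)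
  obtain ⟨π, hπ⟩ := (isNormOneQuotient_normOneProj (L ≃ₐ[k] L) (A →ₐ[k] L)).exists_comp
    (AlgEquiv.restrictNormalHom (F := k) (K₁ := F) L)
    (hφ.bijective_of_nat_card_le (by rw [hX, hXF])) fun σ x =>
      AlgHom.ext fun a => AlgEquiv.restrictNormal_commutes σ L (x a)
  exact NormOneTorus.exists_equiv_characterRep hXF hπ

/-- The tensor product of two norm one tori, computed over a field that splits both. -/
lemma nonempty_torusOfLattice_tensorTorus [Algebra L (SeparableClosure k)]
    [IsScalarTower k L (SeparableClosure k)] [Normal k L]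
    (hX : Nat.card (A →ₐ[k] L) = Module.finrank k A)
    (hXF : Nat.card (A →ₐ[k] SeparableClosure k) = Module.finrank k A)
    (hY : Nat.card (B →ₐ[k] L) = Module.finrank k B)
    (hYF : Nat.card (B →ₐ[k] SeparableClosure k) = Module.finrank k B) :
    Nonempty (torusOfLattice k L ((normOneCharacters k A L).tprodInt (normOneCharacters k B L))
      ≃ₐ[k] TensorTorus k (NormOneTorus k A) (NormOneTorus k B)) := by
  obtain ⟨e⟩ := nonempty_torusOfLattice_comp (F := SeparableClosure k)
    ((normOneCharacters k A L).tprodInt (normOneCharacters k B L))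
  obtain ⟨f⟩ := nonempty_equiv_characterRep_comp (F := SeparableClosure k) hX hXF
  obtain ⟨g⟩ := nonempty_equiv_characterRep_comp (F := SeparableClosure k) hY hYF
  obtain ⟨h⟩ := nonempty_torusOfLattice_algEquiv (f.tprodCongr g)
  exact ⟨e.trans h⟩

/-- Resolutions of the lattices of characters of the tensor product of two norm one tori and of
the norm one torus of a tensor product. -/
lemma hasResolution_normOneCharacters [FiniteDimensional k L]
    {C : ∀ (V : Type) [AddCommGroup V], Representation ℤ (L ≃ₐ[k] L) V → Prop}
    (hC : IsLatticeClass C)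
    (w : (A →ₐ[k] L) → ℤ) (hw : ∀ (g : L ≃ₐ[k] L) x, w (g • x) = w x)
    (w' : (B →ₐ[k] L) → ℤ) (hw' : ∀ (g : L ≃ₐ[k] L) x, w' (g • x) = w' x)
    (hww' : ∑ᶠ x, w x + ∑ᶠ y, w' y = 1)
    (h : HasResolution C (normOneCharacters k A L))
    (h' : HasResolution C (normOneCharacters k B L)) :
    HasResolution C ((normOneCharacters k A L).tprodInt (normOneCharacters k B L)) ∧
      HasResolution C (normOneCharacters k (A ⊗[k] B) L) := by
  have : Finite (A →ₐ[k] L) := (linearIndependent_toLinearMap k A L).finite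
  have : Finite (B →ₐ[k] L) := (linearIndependent_toLinearMap k B L).finite
  have hA := isNormOneQuotient_normOneProj (L ≃ₐ[k] L) (A →ₐ[k] L)
  have hB := isNormOneQuotient_normOneProj (L ≃ₐ[k] L) (B →ₐ[k] L)
  obtain ⟨π, hπ⟩ := (isNormOneQuotient_normOneProj (L ≃ₐ[k] L) (A ⊗[k] B →ₐ[k] L)).exists_comp
    (MonoidHom.id _) (homProdEquiv (k := k) (A := A) (B := B) (L := L)).symm.bijective
    fun g x => by
      rw [Equiv.symm_apply_eq, smul_homProdEquiv, Equiv.apply_symm_apply]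
      rfl
  exact ⟨h.tensor hC hA hB w hw w' hw' hww' h', h.normOne_prod hC hA hB w hw w' hw' hww' h' hπ⟩

end Levels

end Splitting

section IntTensor

variable (M N : Type*) [AddCommGroup M] [AddCommGroup N]

/-- An abelian group has only one `ℤ`-module structure, so freeness passes from the tensor product
structure to that of the underlying additive group. -/
instance tensorProduct_free_int [Module.Free ℤ M] [Module.Free ℤ N] :
    @Module.Free ℤ (M ⊗[ℤ] N) _ _ (AddCommGroup.toIntModule _) := by
  have h : @Module.Free ℤ (M ⊗[ℤ] N) _ _ TensorProduct.leftModule := inferInstance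
  convert! h

instance tensorProduct_finite_int [Module.Finite ℤ M] [Module.Finite ℤ N] :
    @Module.Finite ℤ (M ⊗[ℤ] N) _ _ (AddCommGroup.toIntModule _) := by
  have h : @Module.Finite ℤ (M ⊗[ℤ] N) _ _ TensorProduct.leftModule := inferInstance
  convert! h

end IntTensor

section Levels

variable {k : Type*} [Field k] {A : Type*} [CommRing A] [Algebra k A] [Module.Finite k A]
  {B : Type*} [CommRing B] [Algebra k B] [Module.Finite k B]
  {L : Type*} [Field L] [Algebra k L] [FiniteDimensional k L] [IsGalois k L]
  [Algebra L (SeparableClosure k)] [IsScalarTower k L (SeparableClosure k)]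
  (hX : Nat.card (A →ₐ[k] L) = Module.finrank k A)
  (hXF : Nat.card (A →ₐ[k] SeparableClosure k) = Module.finrank k A)
  (hY : Nat.card (B →ₐ[k] L) = Module.finrank k B)
  (hYF : Nat.card (B →ₐ[k] SeparableClosure k) = Module.finrank k B)
  (w : (A →ₐ[k] L) → ℤ) (hw : ∀ (g : L ≃ₐ[k] L) x, w (g • x) = w x)
  (w' : (B →ₐ[k] L) → ℤ) (hw' : ∀ (g : L ≃ₐ[k] L) x, w' (g • x) = w' x)
  (hww' : ∑ᶠ x, w x + ∑ᶠ y, w' y = 1)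

instance {X : Type*} [Finite X] : Module.Free ℤ (NormOneLattice X) :=
  (isNormOneQuotient_normOneProj Unit X).free

instance {X : Type*} [Finite X] : Module.Finite ℤ (NormOneLattice X) :=
  (isNormOneQuotient_normOneProj Unit X).finite

include hX hXF hY hYF hw hw' hww'

lemma isStablyRational_tensor (h : IsStablyRational k (NormOneTorus k A))
    (h' : IsStablyRational k (NormOneTorus k B)) :
    IsStablyRational k (TensorTorus k (NormOneTorus k A) (NormOneTorus k B)) ∧
      IsStablyRational k (NormOneTorus k (A ⊗[k] B)) := by
  have : Finite (A →ₐ[k] L) := (linearIndependent_toLinearMap k A L).finite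
  have : Finite (B →ₐ[k] L) := (linearIndependent_toLinearMap k B L).finite
  have : Finite (A ⊗[k] B →ₐ[k] L) := (linearIndependent_toLinearMap k (A ⊗[k] B) L).finite
  obtain ⟨e, he⟩ := NormOneTorus.exists_algEquiv hX (isNormOneQuotient_normOneProj _ _)
  obtain ⟨e', he'⟩ := NormOneTorus.exists_algEquiv hY (isNormOneQuotient_normOneProj _ _)
  obtain ⟨h₁, h₂⟩ := hasResolution_normOneCharacters isLatticeClass_isStablyPerm w hw w' hw' hww'
    (h.hasResolution he) (h'.hasResolution he')
  obtain ⟨f⟩ := nonempty_torusOfLattice_tensorTorus hX hXF hY hYF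
  obtain ⟨g⟩ := nonempty_torusOfLattice_normOneTorus (natCard_homs_tensor hX hY)
  exact ⟨h₁.isStablyRational.of_algEquiv f, h₂.isStablyRational.of_algEquiv g⟩

lemma isRetractRational_tensor (h : IsRetractRational k (NormOneTorus k A))
    (h' : IsRetractRational k (NormOneTorus k B)) :
    IsRetractRational k (TensorTorus k (NormOneTorus k A) (NormOneTorus k B)) ∧
      IsRetractRational k (NormOneTorus k (A ⊗[k] B)) := by
  have : Finite (A →ₐ[k] L) := (linearIndependent_toLinearMap k A L).finite
  have : Finite (B →ₐ[k] L) := (linearIndependent_toLinearMap k B L).finite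
  have : Finite (A ⊗[k] B →ₐ[k] L) := (linearIndependent_toLinearMap k (A ⊗[k] B) L).finite
  obtain ⟨e, he⟩ := NormOneTorus.exists_algEquiv hX (isNormOneQuotient_normOneProj _ _)
  obtain ⟨e', he'⟩ := NormOneTorus.exists_algEquiv hY (isNormOneQuotient_normOneProj _ _)
  obtain ⟨h₁, h₂⟩ := hasResolution_normOneCharacters isLatticeClass_isInvertible w hw w' hw' hww'
    (h.hasResolution he) (h'.hasResolution he')
  obtain ⟨f⟩ := nonempty_torusOfLattice_tensorTorus hX hXF hY hYF
  obtain ⟨g⟩ := nonempty_torusOfLattice_normOneTorus (natCard_homs_tensor hX hY)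
  exact ⟨h₁.isRetractRational.of_algEquiv f, h₂.isRetractRational.of_algEquiv g⟩

end Levels

/-! ### Splitting fields and weights for products of separable extensions. -/

section Etale

variable {k : Type*} [Field k] {ι κ : Type*} [Fintype ι] [Fintype κ]
  {K : ι → Type*} [∀ i, Field (K i)] [∀ i, Algebra k (K i)]
  [∀ i, FiniteDimensional k (K i)] [∀ i, Algebra.IsSeparable k (K i)]
  {E : κ → Type*} [∀ j, Field (E j)] [∀ j, Algebra k (E j)]
  [∀ j, FiniteDimensional k (E j)] [∀ j, Algebra.IsSeparable k (E j)]
  {A B : Type*} [CommRing A] [Algebra k A] [Module.Finite k A]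
  [CommRing B] [Algebra k B] [Module.Finite k B]
  (eA : A ≃ₐ[k] ∀ i, K i) (eB : B ≃ₐ[k] ∀ j, E j)

include eA in
omit [Fintype ι] [Module.Finite k A] in
lemma natCard_factor_of_forall_mem (L : IntermediateField k (SeparableClosure k))
    (hL : ∀ (x : A →ₐ[k] SeparableClosure k) a, x a ∈ L) (i : ι) :
    Nat.card (K i →ₐ[k] L) = Module.finrank k (K i) := by
  classical
  rw [← natCard_algHom_separableClosure (k := k) (K i)]
  refine Nat.card_eq_of_bijective _ (bijective_comp_val L fun f c => ?_)
  have := hL (homOfFactor eA ⟨i, f⟩) (eA.symm (Pi.single i c))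
  rwa [homOfFactor_apply, eA.apply_symm_apply, Pi.single_eq_same] at this

include eA eB in
/-- A finite Galois extension that splits two étale algebras, with invariant weights on the
homomorphisms to it. -/
lemma exists_splitting (h : Nat.gcd (Finset.univ.gcd fun i => Module.finrank k (K i))
    (Finset.univ.gcd fun j => Module.finrank k (E j)) = 1) :
    ∃ L : FiniteGaloisIntermediateField k (SeparableClosure k),
      Nat.card (A →ₐ[k] L) = Module.finrank k A ∧ Nat.card (B →ₐ[k] L) = Module.finrank k B ∧
      ∃ (w : (A →ₐ[k] L) → ℤ) (w' : (B →ₐ[k] L) → ℤ),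
        (∀ (g : L ≃ₐ[k] L) x, w (g • x) = w x) ∧ (∀ (g : L ≃ₐ[k] L) x, w' (g • x) = w' x) ∧
        ∑ᶠ x, w x + ∑ᶠ y, w' y = 1 := by
  obtain ⟨s, hs, hsA⟩ := exists_finite_set_range_le (k := k) (F := SeparableClosure k) (A := A)
  obtain ⟨t, ht, htB⟩ := exists_finite_set_range_le (k := k) (F := SeparableClosure k) (A := B)
  have : Finite ↑(s ∪ t) := hs.union ht
  -- The finite Galois extension generated by the images of bases of `A` and `B` contains the image
  -- of every homomorphism to the separable closure.
  let L := FiniteGaloisIntermediateField.adjoin k (s ∪ t)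
  have hL : s ∪ t ⊆ L.toIntermediateField := FiniteGaloisIntermediateField.subset_adjoin k _
  have hA := natCard_factor_of_forall_mem eA L.toIntermediateField
    (hsA _ (Set.subset_union_left.trans hL))
  have hB := natCard_factor_of_forall_mem eB L.toIntermediateField
    (htB _ (Set.subset_union_right.trans hL))
  obtain ⟨a, b, hab⟩ := exists_sum_mul_add_sum_mul_eq_one _ _ h
  obtain ⟨w, hw, hwa⟩ := exists_weight eA hA a
  obtain ⟨w', hw', hwb⟩ := exists_weight eB hB b
  exact ⟨L, (bijective_homOfFactor eA hA).2, (bijective_homOfFactor eB hB).2, w, w', hw, hw',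
    by rw [hwa, hwb, hab]⟩

include eA in
lemma natCard_algHom_separableClosure_of_algEquiv :
    Nat.card (A →ₐ[k] SeparableClosure k) = Module.finrank k A :=
  (bijective_homOfFactor eA fun i => natCard_algHom_separableClosure (K i)).2

include eA eB in
omit [∀ i, Algebra.IsSeparable k (K i)] [∀ j, Algebra.IsSeparable k (E j)]
  [Module.Finite k A] [Module.Finite k B] in
lemma gcd_eq_one_of_coprime_finrank
    (h : Nat.Coprime (Module.finrank k A) (Module.finrank k B)) :
    Nat.gcd (Finset.univ.gcd fun i => Module.finrank k (K i))
        (Finset.univ.gcd fun j => Module.finrank k (E j)) = 1 := by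
  rw [finrank_eq_sum eA, finrank_eq_sum eB] at h
  exact Nat.Coprime.coprime_dvd_left (Finset.dvd_sum fun i hi => Finset.gcd_dvd hi)
    (h.coprime_dvd_right (Finset.dvd_sum fun j hj => Finset.gcd_dvd hj))

end Etale

/-! ### The case of two fields. -/

section FieldCase

variable {k : Type*} [Field k]

/-- A product of fields that is a field has a single factor. -/
lemma exists_algEquiv_of_isField {ι : Type*} {K : ι → Type*} [∀ i, Field (K i)]
    [∀ i, Algebra k (K i)] {A : Type*} [CommRing A] [Algebra k A] (e : A ≃ₐ[k] ∀ i, K i)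
    (hA : IsField A) : ∃ i, (∀ j, j = i) ∧ Nonempty (A ≃ₐ[k] K i) := by
  classical
  have hP : IsField (∀ i, K i) := e.symm.toMulEquiv.isField hA
  obtain ⟨x, y, hxy⟩ := hP.exists_pair_ne
  obtain ⟨i, -⟩ := Function.ne_iff.1 hxy
  have hi : ∀ j, j = i := fun j => by
    by_contra hj
    obtain ⟨z, hz⟩ := hP.mul_inv_cancel (a := Pi.single i 1) fun h => by
      have := congrFun h i
      rw [Pi.single_eq_same] at this
      exact one_ne_zero this
    have := congrFun hz j
    rw [Pi.mul_apply, Pi.single_eq_of_ne hj, zero_mul] at this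
    exact zero_ne_one this
  refine ⟨i, hi, ⟨AlgEquiv.ofBijective ((Pi.evalAlgHom k K i).comp e.toAlgHom)
    ⟨fun a b hab => e.injective (funext fun j => ?_), fun c => ⟨e.symm (Pi.single i c), ?_⟩⟩⟩⟩
  · rw [hi j]
    exact hab
  · change e (e.symm (Pi.single i c)) i = c
    rw [e.apply_symm_apply, Pi.single_eq_same]

variable (K E : Type*) [Field K] [Algebra k K] [FiniteDimensional k K] [Algebra.IsSeparable k K]
  [Field E] [Algebra k E] [FiniteDimensional k E] [Algebra.IsSeparable k E]

omit [FiniteDimensional k K] [FiniteDimensional k E] in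
/-- The tensor product of separable extensions of coprime degrees is a separable field
extension. -/
lemma isField_tensor_of_coprime (h : (Module.finrank k K).Coprime (Module.finrank k E)) :
    IsField (K ⊗[k] E) ∧ Algebra.IsSeparable k (K ⊗[k] E) := by
  let f : K →ₐ[k] SeparableClosure k := IsSepClosed.lift
  let g : E →ₐ[k] SeparableClosure k := IsSepClosed.lift
  -- Two subfields of coprime degree over `k` are linearly disjoint, so their tensor product is a
  -- field and embeds in the separable closure, which gives separability as well.
  have hfg : f.fieldRange.LinearDisjoint g.fieldRange :=
    IntermediateField.LinearDisjoint.of_finrank_coprime (by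
      rw [(AlgEquiv.ofInjectiveField f).toLinearEquiv.finrank_eq,
        (AlgEquiv.ofInjectiveField g).toLinearEquiv.finrank_eq] at h
      exact h)
  have hF : IsField (K ⊗[k] E) := hfg.isField_of_isAlgebraic' (.inl inferInstance)
  refine ⟨hF, ⟨fun x => ?_⟩⟩
  let φ : K ⊗[k] E →ₐ[k] SeparableClosure k :=
    Algebra.TensorProduct.lift f g fun _ _ => Commute.all _ _
  have hφ : Function.Injective φ := by
    let := hF.toField
    exact φ.toRingHom.injective
  exact (isSeparable_map_iff φ hφ).1 (Algebra.IsSeparable.isSeparable k (φ x))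

end FieldCase

end

theorem theorem7p5 {k : Type*} [Field k] {ι κ : Type*} [Fintype ι] [Fintype κ]
    (K : ι → Type*) [∀ i, Field (K i)] [∀ i, Algebra k (K i)]
    [∀ i, FiniteDimensional k (K i)] [∀ i, Algebra.IsSeparable k (K i)]
    (E : κ → Type*) [∀ j, Field (E j)] [∀ j, Algebra k (E j)]
    [∀ j, FiniteDimensional k (E j)] [∀ j, Algebra.IsSeparable k (E j)]
    {A B : Type*} [CommRing A] [Algebra k A] [Module.Finite k A]
    [CommRing B] [Algebra k B] [Module.Finite k B]
    (eA : A ≃ₐ[k] ∀ i, K i) (eB : B ≃ₐ[k] ∀ j, E j) :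
    (Nat.Coprime (Module.finrank k A) (Module.finrank k B) →
      Nat.gcd (Finset.univ.gcd fun i => Module.finrank k (K i))
        (Finset.univ.gcd fun j => Module.finrank k (E j)) = 1) ∧
    (Nat.gcd (Finset.univ.gcd fun i => Module.finrank k (K i))
        (Finset.univ.gcd fun j => Module.finrank k (E j)) = 1 →
      (IsStablyRational k (NormOneTorus k A) → IsStablyRational k (NormOneTorus k B) →
        IsStablyRational k (TensorTorus k (NormOneTorus k A) (NormOneTorus k B)) ∧
        IsStablyRational k (NormOneTorus k (A ⊗[k] B))) ∧
      (IsRetractRational k (NormOneTorus k A) → IsRetractRational k (NormOneTorus k B) →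
        IsRetractRational k (TensorTorus k (NormOneTorus k A) (NormOneTorus k B)) ∧
        IsRetractRational k (NormOneTorus k (A ⊗[k] B))) ∧
      (IsField A → IsField B →
        IsField (A ⊗[k] B) ∧ Algebra.IsSeparable k (A ⊗[k] B) ∧
        Module.finrank k (A ⊗[k] B) = Module.finrank k A * Module.finrank k B ∧
        IsAlgebraicTorus k (NormOneTorus k (A ⊗[k] B))
          (Module.finrank k A * Module.finrank k B - 1))) := by
  have hXF := natCard_algHom_separableClosure_of_algEquiv eA
  have hYF := natCard_algHom_separableClosure_of_algEquiv eB
  refine ⟨gcd_eq_one_of_coprime_finrank eA eB, fun h => ⟨fun hA hB => ?_, fun hA hB => ?_,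
    fun hA hB => ?_⟩⟩
  · obtain ⟨L, hX, hY, w, w', hw, hw', hww'⟩ := exists_splitting eA eB h
    exact isStablyRational_tensor hX hXF hY hYF w hw w' hw' hww' hA hB
  · obtain ⟨L, hX, hY, w, w', hw, hw', hww'⟩ := exists_splitting eA eB h
    exact isRetractRational_tensor hX hXF hY hYF w hw w' hw' hww' hA hB
  · obtain ⟨i, hi, ⟨f⟩⟩ := exists_algEquiv_of_isField eA hA
    obtain ⟨j, hj, ⟨g⟩⟩ := exists_algEquiv_of_isField eB hB
    -- Each index type has a single element, so both finite gcds run over one degree only.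
    have hcop : (Module.finrank k (K i)).Coprime (Module.finrank k (E j)) := by
      rw [Nat.coprime_iff_gcd_eq_one, ← Nat.dvd_one, ← h]
      refine Nat.dvd_gcd (Finset.dvd_gcd fun i' _ => ?_) (Finset.dvd_gcd fun j' _ => ?_)
      · rw [hi i']; exact Nat.gcd_dvd_left _ _
      · rw [hj j']; exact Nat.gcd_dvd_right _ _
    obtain ⟨hF, hS⟩ := isField_tensor_of_coprime (K i) (E j) hcop
    let fg := Algebra.TensorProduct.congr f g
    have hfr := Module.finrank_tensorProduct (R := k) (S := k) (M := A) (M' := B)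
    refine ⟨fg.toMulEquiv.isField hF, AlgEquiv.Algebra.isSeparable fg.symm, hfr, ?_⟩
    rw [← hfr]
    exact NormOneTorus.isAlgebraicTorus (natCard_homs_tensor hXF hYF)
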